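/- **Setting.** Let $\Omega$ be a separable metric space with its Borel $\sigma$-algebra, $\tau:\mathbb R\times\Omega\to\Omega$ a continuous $\mathbb R$-action, $\tau_a=\tau(a,\cdot)$, and $\mathbb P$ a $\tau$-invariant ergodic Borel probability measure: $\mathbb P(U)>0$ for every nonempty open $U$; $\mathbb P(\tau_aA)=\mathbb P(A)$ for all $a\in\mathbb R$ and Borel $A$; and $\mathbb P(A)\in\{0,1\}$ for every Borel $A$ with $\tau_aA=A$ for all $a$. Put $\mathcal S=\mathbb R\times[-1,1]$. A measurable map $\bar F=(\bar Q,\bar P):\Omega\times[-1,1]\to\mathcal S$ defines its *stationary lift* $F=(Q,P)$, $$F(q,p;\omega)=\big(q+\bar Q(\tau_q\omega,p),\ \bar P(\tau_q\omega,p)\big),\qquad (q,p)\in\mathcal S,\ \omega\in\Omega .$$ Diffeomorphisms of $\mathcal S$ are $C^1$ up to the boundary, together with their inverses. - $F$ is an *area-preserving random twist* if for $\mathbb P$-almost every $\omega$: (1) $F(\cdot,\cdot;\omega)$ is a diffeomorphism of $\mathcal S$ with $\det \mathrm DF=1$; (2) $P(q,\pm1;\omega)=\pm1$ for all $q$; (3)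 $q\mapsto Q(q,\pm1;\omega)$ is strictly increasing and $\pm\bar Q(\tau_q\omega,\pm1)>0$ for all $q$; and moreover (4) $\sup_{p\in[-1,1]}\mathbb E[\bar Q^2(\omega,p)+\bar P^2(\omega,p)]<\infty$. - An area-preserving random twist is *positive monotone* if for almost every $\omega$ and all $q$ the map $p\mapsto\bar Q(\tau_q\omega,p)$ is strictly increasing on $[-1,1]$. A stationary lift $G$ is a *negative monotone* area-preserving random twist if for almost every $\omega$ the map $G(\cdot,\cdot;\omega)$ is the inverse of $F(\cdot,\cdot;\omega)$ for some positive monotone area-preserving random twist $F$. (A negative monotone one thus satisfies $\pm\bar Q(\cdot,\pm1)<0$ in place of the second half of (3).) - $F$ is *regular* if, for some constant $C$ not depending on $\omega$, almost surely $\|\mathrm DF\|\le C$ and $\|\mathrm D(F^{-1})\|\le C$ on $\mathcal S$. - For $r\in\mathbb N$, $F$ is *isotopic to the identity in $C^r$* if there are stationary lifts $F^t$, $t\in[0,1]$, such that almost surely $F^0=\mathrm{id}$, $F^1=F$, and every $F^t(\cdot,\cdot;\omega)$ is a $C^r$ diffeomorphism of $\mathcal S$; $\frac12\int_{-1}^1\mathbb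 E\,\det(\mathrm dF^t)\,\mathrm dp=1$ for every $t$; and, with a constant $C$ not depending on $\omega$ or $t$, almost surely for every $t$ the derivative $\frac{\mathrm dF^t}{\mathrm dt}$ exists and $\frac{\mathrm dF^t}{\mathrm dt}$, $F^t-\mathrm{id}$, $(F^t)^{-1}-\mathrm{id}$ are of class $C^r$ on $\mathcal S$ with all derivatives of order $0,\dots,r$ bounded by $C$. **Theorem B.** There is an integer $r_0$ such that the following holds for all $(\Omega,\mathbb P,\tau)$ as above and all $r\ge r_0$. Let $F$ be a regular area-preserving random twist that is isotopic to the identity in $C^r$. Then there exist an integer $N\ge0$ and regular area-preserving random monotone twists $F_0,\dots,F_N$ such that for every $\omega\in\Omega$ $$F(\cdot,\cdot;\omega)=F_N(\cdot,\cdot;\omega)\circ\cdots\circ F_1(\cdot,\cdot;\omega)\circ F_0(\cdot,\cdot;\omega)\quad\text{on }\mathcal S,$$ where $F_j$ is negative monotone if $j$ is even and positive monotone if $j$ is odd. -/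

import Mathlib

open MeasureTheory Set

noncomputable section

namespace RandomTwist

/-- The strip `𝒮 = ℝ × [-1, 1]`, as a subset of the plane; a point is `x = (q, p)`.  Only the values
on `strip` of the planar maps considered below are ever used. -/
def strip : Set (ℝ × ℝ) := univ ×ˢ Icc (-1 : ℝ) 1

/-- `P` is a `τ`-invariant ergodic probability measure, positive on nonempty open sets. -/
structure IsInvariantErgodic {Ω : Type*} [TopologicalSpace Ω] [MeasurableSpace Ω]
    (τ : Flow ℝ Ω) (P : Measure Ω) : Prop where
  isProbabilityMeasure : IsProbabilityMeasure P
  positive : ∀ U : Set Ω, IsOpen U → U.Nonempty → 0 < P U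
  invariant : ∀ (a : ℝ) (A : Set Ω), MeasurableSet A → P (τ a '' A) = P A
  ergodic : ∀ A : Set Ω, MeasurableSet A → (∀ a : ℝ, τ a '' A = A) → P A = 1 ∨ P A = 0

/-- `Fbar = (Qbar, Pbar)` is a measurable map `Ω × [-1, 1] → 𝒮`. -/
structure IsGenerator {Ω : Type*} [MeasurableSpace Ω] (Fbar : Ω → ℝ → ℝ × ℝ) : Prop where
  measurable : Measurable fun z : Ω × Icc (-1 : ℝ) 1 => Fbar z.1 z.2
  mapsTo : ∀ ω, ∀ p ∈ Icc (-1 : ℝ) 1, Fbar ω p ∈ strip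

/-- The stationary lift `F(q, p; ω) = (q + Qbar(τ_q ω, p), Pbar(τ_q ω, p))` of
`Fbar = (Qbar, Pbar)`. -/
def lift {Ω : Type*} [TopologicalSpace Ω] (τ : Flow ℝ Ω) (Fbar : Ω → ℝ → ℝ × ℝ) (ω : Ω) :
    ℝ × ℝ → ℝ × ℝ :=
  fun x => (x.1 + (Fbar (τ x.1 ω) x.2).1, (Fbar (τ x.1 ω) x.2).2)

/-- The inverse of a self-map of the strip (meaningful on `strip` if the map is a bijection
of `strip`). -/
def stripInv (f : ℝ × ℝ → ℝ × ℝ) : ℝ × ℝ → ℝ × ℝ := Function.invFunOn f strip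

/-- `f` is a `C^r` diffeomorphism of the strip onto itself (up to the boundary). -/
structure IsStripDiffeo (r : ℕ) (f : ℝ × ℝ → ℝ × ℝ) : Prop where
  bijOn : BijOn f strip strip
  contDiffOn : ContDiffOn ℝ r f strip
  contDiffOn_inv : ContDiffOn ℝ r (stripInv f) strip

/-- `f` is an area-preserving diffeomorphism of the strip: it preserves `dq ∧ dp`. -/
structure IsAreaPreservingDiffeo (f : ℝ × ℝ → ℝ × ℝ) : Prop where
  isStripDiffeo : IsStripDiffeo 1 f
  det_eq_one : ∀ x ∈ strip, (fderivWithin ℝ f strip x).det = 1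

/-- Area-preserving random twist, given by `Fbar = (Qbar, Pbar)`. -/
structure IsAreaPreservingRandomTwist {Ω : Type*} [TopologicalSpace Ω] [MeasurableSpace Ω]
    (τ : Flow ℝ Ω) (P : Measure Ω) (Fbar : Ω → ℝ → ℝ × ℝ) : Prop where
  isGenerator : IsGenerator Fbar
  area_preserving : ∀ᵐ ω ∂P, IsAreaPreservingDiffeo (lift τ Fbar ω)
  boundary_invariance : ∀ᵐ ω ∂P, ∀ q : ℝ,
    (lift τ Fbar ω (q, 1)).2 = 1 ∧ (lift τ Fbar ω (q, -1)).2 = -1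
  boundary_increasing : ∀ᵐ ω ∂P,
    StrictMono (fun q : ℝ => (lift τ Fbar ω (q, 1)).1) ∧
    StrictMono (fun q : ℝ => (lift τ Fbar ω (q, -1)).1)
  boundary_twisting : ∀ᵐ ω ∂P, ∀ q : ℝ,
    0 < (Fbar (τ q ω) 1).1 ∧ (Fbar (τ q ω) (-1)).1 < 0
  finite_second_moment :
    ⨆ p ∈ Icc (-1 : ℝ) 1,
      ∫⁻ ω, ENNReal.ofReal ((Fbar ω p).1 ^ 2 + (Fbar ω p).2 ^ 2) ∂P < ⊤

/-- Positive monotone area-preserving random twist: `p ↦ Qbar(·, p)` is increasing. -/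
structure IsPositiveMonotoneTwist {Ω : Type*} [TopologicalSpace Ω] [MeasurableSpace Ω]
    (τ : Flow ℝ Ω) (P : Measure Ω) (Fbar : Ω → ℝ → ℝ × ℝ) : Prop where
  isTwist : IsAreaPreservingRandomTwist τ P Fbar
  increasing : ∀ᵐ ω ∂P, ∀ q : ℝ,
    StrictMonoOn (fun p : ℝ => (Fbar (τ q ω) p).1) (Icc (-1) 1)

/-- Negative monotone area-preserving random twist: the inverse of a positive monotone one. -/
structure IsNegativeMonotoneTwist {Ω : Type*} [TopologicalSpace Ω] [MeasurableSpace Ω]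
    (τ : Flow ℝ Ω) (P : Measure Ω) (Gbar : Ω → ℝ → ℝ × ℝ) : Prop where
  isGenerator : IsGenerator Gbar
  isInverse : ∃ Fbar : Ω → ℝ → ℝ × ℝ, IsPositiveMonotoneTwist τ P Fbar ∧
    ∀ᵐ ω ∂P, InvOn (lift τ Gbar ω) (lift τ Fbar ω) strip strip

/-- Regularity: the derivatives of `F` and `F⁻¹` are bounded by a nonrandom constant, almost
surely. -/
def IsRegular {Ω : Type*} [TopologicalSpace Ω] [MeasurableSpace Ω]
    (τ : Flow ℝ Ω) (P : Measure Ω) (Fbar : Ω → ℝ → ℝ × ℝ) : Prop :=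
  ∃ C : ℝ, ∀ᵐ ω ∂P, ∀ x ∈ strip,
    ‖fderivWithin ℝ (lift τ Fbar ω) strip x‖ ≤ C ∧
    ‖fderivWithin ℝ (stripInv (lift τ Fbar ω)) strip x‖ ≤ C

/-- `f` is of class `C^r` on the strip and its derivatives of order `0, …, r` are bounded
by `C`. -/
def IsBoundedInC (r : ℕ) (C : ℝ) (f : ℝ × ℝ → ℝ × ℝ) : Prop :=
  ContDiffOn ℝ r f strip ∧
    ∀ k ≤ r, ∀ x ∈ strip, ‖iteratedFDerivWithin ℝ k f strip x‖ ≤ C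

/-- `Φ t`, `t ∈ [0, 1]`, generates a path of stationary lifts `F^t` that are diffeomorphisms,
connects the identity to the lift `F` of `Fbar`, is normalized, and is regular: `dF^t/dt`,
`F^t` and `(F^t)⁻¹` are bounded in `C^r`.  For the two lifts `F^t` and `(F^t)⁻¹`, which are
never bounded in `q`, the bound is on the displacement from the identity. -/
structure IsIsotopy {Ω : Type*} [TopologicalSpace Ω] [MeasurableSpace Ω]
    (τ : Flow ℝ Ω) (P : Measure Ω) (r : ℕ) (Fbar : Ω → ℝ → ℝ × ℝ)
    (Φ : ℝ → Ω → ℝ → ℝ × ℝ) : Prop where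
  isGenerator : ∀ t ∈ Icc (0 : ℝ) 1, IsGenerator (Φ t)
  at_zero : ∀ᵐ ω ∂P, EqOn (lift τ (Φ 0) ω) id strip
  at_one : ∀ᵐ ω ∂P, EqOn (lift τ (Φ 1) ω) (lift τ Fbar ω) strip
  isStripDiffeo : ∀ᵐ ω ∂P, ∀ t ∈ Icc (0 : ℝ) 1, IsStripDiffeo r (lift τ (Φ t) ω)
  normalized : ∀ t ∈ Icc (0 : ℝ) 1,
    (1 / 2 : ℝ) * ∫ p in (-1 : ℝ)..1,
      (∫ ω, (fderivWithin ℝ (lift τ (Φ t) ω) strip (0, p)).det ∂P) = 1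
  differentiable : ∀ᵐ ω ∂P, ∀ t ∈ Icc (0 : ℝ) 1, ∀ x ∈ strip,
    DifferentiableWithinAt ℝ (fun s => lift τ (Φ s) ω x) (Icc 0 1) t
  regular : ∃ C : ℝ, ∀ᵐ ω ∂P, ∀ t ∈ Icc (0 : ℝ) 1,
    IsBoundedInC r C (fun x => derivWithin (fun s => lift τ (Φ s) ω x) (Icc 0 1) t) ∧
    IsBoundedInC r C (fun x => lift τ (Φ t) ω x - x) ∧
    IsBoundedInC r C (fun x => stripInv (lift τ (Φ t) ω) x - x)

/-- Isotopic to the identity, by a path that is regular in the `C^r` sense. -/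
def IsIsotopicToIdentity {Ω : Type*} [TopologicalSpace Ω] [MeasurableSpace Ω]
    (τ : Flow ℝ Ω) (P : Measure Ω) (r : ℕ) (Fbar : Ω → ℝ → ℝ × ℝ) : Prop :=
  ∃ Φ : ℝ → Ω → ℝ → ℝ × ℝ, IsIsotopy τ P r Fbar Φ

/-- The composition `f N ∘ ⋯ ∘ f 1 ∘ f 0`. -/
def compUpTo {X : Type*} (f : ℕ → X → X) : ℕ → X → X
  | 0 => f 0
  | n + 1 => f (n + 1) ∘ compUpTo f n

end RandomTwist

end

open MeasureTheory Set Filter Topology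
open scoped Pointwise

noncomputable section

namespace RandomTwist

/-! Let ψ be an area-preserving map of the strip with bounded differential and ∂Q/∂q ≥ 1/2 (a step).
After precomposition with the shear (q, p) ↦ (q + sp, p) the vertical derivative of its first
coordinate is s ∂Q/∂q + ∂Q/∂p, which is positive for large s. So ψ ∘ shear(s) is a positive monotone
twist, while shear(-s) is a negative one, and ψ = (ψ ∘ shear(s)) ∘ shear(-s). It therefore suffices
to write F as a composition of finitely many stationary steps with uniform bounds.

An area-preserving isotopy could simply be cut into short pieces. Here F^t need not preserve area,
so its Jacobian is divided out by an explicit triangular map k_t = `knothe (F^t)` with the same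
Jacobian. The second coordinate of k_t rearranges the density on each vertical line. The first
coordinate should be half the mass to the left of that line, which is infinite; but its difference
from q is finite and, by Stokes' formula, is an integral over that single line plus boundary terms.
Hence k_t stays at bounded distance from the identity, is stationary and measurable, and has C^{1,1}
bounds that depend only on the C³ bounds of the path (`TameC2.sD_columnShift`, `TameC2.jac_knothe`,
`TameC2.tame_knothe`, `GoodPath.tameC2`).

Now A_t = F^t ∘ k_t⁻¹ preserves area, A_0 = id and F = A_1 ∘ k_1. The map k_1 is a step, and A_1 is
the telescoping product of the quotients A_{(i+1)/n} ∘ A_{i/n}⁻¹. These are C⁰-close to the identity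
because t ↦ A_t is Lipschitz, and their differentials are uniformly Lipschitz; interpolation makes
them C¹-close, so they are steps once n is large, uniformly in ω (`exists_isStep`).

The almost sure hypotheses hold at some point of every orbit outside an invariant measurable null
set, and good behaviour is transported along orbits (`IsInvariantErgodic.exists_invariant_null`). On
the exceptional orbits the first factor is F itself and the others are the identity, which gives the
factorization for every ω (`exists_alternating_twists`). -/

/-! ### The strip and differentials up to its boundary. -/

theorem mem_strip {x : ℝ × ℝ} : x ∈ strip ↔ x.2 ∈ Icc (-1 : ℝ) 1 := by
  simp [strip]

theorem convex_strip : Convex ℝ strip := convex_univ.prod (convex_Icc _ _)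

theorem interior_strip : interior strip = univ ×ˢ Ioo (-1 : ℝ) 1 := by
  rw [strip, interior_prod_eq, interior_univ, interior_Icc]

theorem uniqueDiffOn_strip : UniqueDiffOn ℝ strip :=
  uniqueDiffOn_convex convex_strip ⟨(0, 0), by rw [interior_strip]; norm_num⟩

theorem subset_closure_interior_strip : strip ⊆ closure (interior strip) := by
  rw [interior_strip, closure_prod_eq, closure_univ, closure_Ioo (by norm_num)]
  exact subset_rfl

theorem strip_add_mem {x : ℝ × ℝ} (hx : x ∈ strip) (a : ℝ) : x + (a, 0) ∈ strip := by
  simpa [mem_strip] using hx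

theorem strip_sub_mem {x : ℝ × ℝ} (hx : x ∈ strip) (a : ℝ) : x - (a, 0) ∈ strip := by
  simpa [mem_strip] using hx

theorem vadd_strip (a : ℝ) : ((a, 0) : ℝ × ℝ) +ᵥ strip = strip := by
  ext x
  rw [mem_vadd_set_iff_neg_vadd_mem]
  simp [mem_strip]

/-- At each point of the strip, `v` or `-v` points into the strip. -/
theorem exists_sign_add_smul_mem {x : ℝ × ℝ} (hx : x ∈ strip) (v : ℝ × ℝ) :
    ∃ σ : ℝ, σ * σ = 1 ∧ ∀ s : ℝ, 0 ≤ s → s * |v.2| ≤ 1 → x + (s * σ) • v ∈ strip := by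
  rw [mem_strip, mem_Icc] at hx
  rcases le_total (x.2 * v.2) 0 with h | h
  · refine ⟨1, by norm_num, fun s hs hv => ?_⟩
    simp only [mem_strip, mem_Icc, Prod.snd_add, Prod.smul_snd, smul_eq_mul]
    rcases abs_cases v.2 with ⟨h1, h2⟩ | ⟨h1, h2⟩ <;> rw [h1] at hv <;>
      constructor <;> nlinarith [mul_nonneg hs (abs_nonneg v.2)]
  · refine ⟨-1, by norm_num, fun s hs hv => ?_⟩
    simp only [mem_strip, mem_Icc, Prod.snd_add, Prod.smul_snd, smul_eq_mul]
    rcases abs_cases v.2 with ⟨h1, h2⟩ | ⟨h1, h2⟩ <;> rw [h1] at hv <;>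
      constructor <;> nlinarith [mul_nonneg hs (abs_nonneg v.2)]

theorem exists_tendsto_fderivWithin_apply {x : ℝ × ℝ} (hx : x ∈ strip) (v : ℝ × ℝ) :
    ∃ (c : ℕ → ℝ) (d : ℕ → ℝ × ℝ), (∀ n, c n • d n = v) ∧ (∀ n, x + d n ∈ strip) ∧
      ∀ {E : Type} [NormedAddCommGroup E] [NormedSpace ℝ E] {f : ℝ × ℝ → E}
        {L : ℝ × ℝ →L[ℝ] E}, HasFDerivWithinAt f L strip x →
        Tendsto (fun n => c n • (f (x + d n) - f x)) atTop (𝓝 (L v)) := by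
  obtain ⟨σ, hσ, h⟩ := exists_sign_add_smul_mem hx v
  have hpos : ∀ n : ℕ, 0 < |v.2| + 1 + n := fun n => by positivity
  have hcd : ∀ n : ℕ, ((|v.2| + 1 + n) * σ) • ((1 / (|v.2| + 1 + n) * σ) • v) = v := fun n => by
    rw [smul_smul]
    have : (|v.2| + 1 + n) * σ * (1 / (|v.2| + 1 + n) * σ) = 1 := by
      field_simp [(hpos n).ne']
      nlinarith
    rw [this, one_smul]
  have hmem : ∀ n : ℕ, x + (1 / (|v.2| + 1 + n) * σ) • v ∈ strip := fun n => by
    refine h _ (one_div_nonneg.2 (hpos n).le) ?_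
    rw [one_div, inv_mul_le_iff₀ (hpos n)]
    have : (0 : ℝ) ≤ n := n.cast_nonneg
    linarith
  refine ⟨fun n => (|v.2| + 1 + n) * σ, fun n => (1 / (|v.2| + 1 + n) * σ) • v, hcd, hmem, ?_⟩
  intro E _ _ f L hL
  refine hL.lim ?_ (Eventually.of_forall hmem) ?_
  · have h1 : Tendsto (fun n : ℕ => 1 / (|v.2| + 1 + n)) atTop (𝓝 0) := by
      simp only [one_div]
      exact tendsto_inv_atTop_zero.comp
        (tendsto_atTop_add_const_left _ _ tendsto_natCast_atTop_atTop)
    simpa using (h1.mul_const σ).smul_const v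
  · simp only [hcd, tendsto_const_nhds]

section Bounds

variable {E : Type} [NormedAddCommGroup E] [NormedSpace ℝ E] {f : ℝ × ℝ → E}
  {L : ℝ × ℝ →L[ℝ] E} {x : ℝ × ℝ} {C : ℝ}

theorem norm_apply_le_of_lipschitz (hx : x ∈ strip) (hL : HasFDerivWithinAt f L strip x)
    (hf : ∀ y ∈ strip, ‖f y - f x‖ ≤ C * ‖y - x‖) (v : ℝ × ℝ) : ‖L v‖ ≤ C * ‖v‖ := by
  obtain ⟨c, d, hcd, hd, h⟩ := exists_tendsto_fderivWithin_apply hx v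
  refine le_of_tendsto (h hL).norm (Eventually.of_forall fun n => ?_)
  have := hf _ (hd n)
  rw [add_sub_cancel_left] at this
  calc ‖c n • (f (x + d n) - f x)‖ ≤ ‖c n‖ * (C * ‖d n‖) := by rw [norm_smul]; gcongr
    _ = C * ‖c n • d n‖ := by rw [norm_smul]; ring
    _ = C * ‖v‖ := by rw [hcd]

theorem le_norm_apply_of_antilipschitz (hx : x ∈ strip) (hL : HasFDerivWithinAt f L strip x)
    (hf : ∀ y ∈ strip, ‖y - x‖ ≤ C * ‖f y - f x‖) (v : ℝ × ℝ) : ‖v‖ ≤ C * ‖L v‖ := by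
  obtain ⟨c, d, hcd, hd, h⟩ := exists_tendsto_fderivWithin_apply hx v
  refine ge_of_tendsto ((h hL).norm.const_mul C) (Eventually.of_forall fun n => ?_)
  have := hf _ (hd n)
  rw [add_sub_cancel_left] at this
  calc ‖v‖ = ‖c n‖ * ‖d n‖ := by rw [← norm_smul, hcd]
    _ ≤ ‖c n‖ * (C * ‖f (x + d n) - f x‖) := by gcongr
    _ = C * ‖c n • (f (x + d n) - f x)‖ := by rw [norm_smul]; ring

theorem norm_sub_le_of_fderivWithin (hd : DifferentiableOn ℝ f strip)
    (hf : ∀ y ∈ strip, ‖fderivWithin ℝ f strip y‖ ≤ C) {y : ℝ × ℝ} (hx : x ∈ strip)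
    (hy : y ∈ strip) : ‖f x - f y‖ ≤ C * ‖x - y‖ :=
  convex_strip.norm_image_sub_le_of_norm_fderivWithin_le hd hf hy hx

end Bounds

theorem exists_equiv_of_antilipschitz {L : ℝ × ℝ →L[ℝ] ℝ × ℝ} {C : ℝ} (hC : 0 ≤ C)
    (h : ∀ v, ‖v‖ ≤ C * ‖L v‖) :
    ∃ e : (ℝ × ℝ) ≃L[ℝ] ℝ × ℝ, (e : ℝ × ℝ →L[ℝ] ℝ × ℝ) = L ∧
      ‖(e.symm : ℝ × ℝ →L[ℝ] ℝ × ℝ)‖ ≤ C := by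
  have hinj : Function.Injective (L : ℝ × ℝ →ₗ[ℝ] ℝ × ℝ) := by
    rw [injective_iff_map_eq_zero]
    intro v hv
    have := h v
    rw [show L v = 0 from hv, norm_zero, mul_zero] at this
    exact norm_le_zero_iff.1 this
  let e := (LinearEquiv.ofInjectiveEndo _ hinj).toContinuousLinearEquiv
  have he : ∀ v, e v = L v := fun v => rfl
  refine ⟨e, by ext <;> simp [he], ContinuousLinearMap.opNorm_le_bound _ hC fun v => ?_⟩
  simpa [← he] using h (e.symm v)

/-! ### Tame maps: stability under composition and inversion. -/

/-- The differential of a map of the strip. -/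
abbrev sD {E : Type} [NormedAddCommGroup E] [NormedSpace ℝ E] (f : ℝ × ℝ → E) (x : ℝ × ℝ) :
    ℝ × ℝ →L[ℝ] E := fderivWithin ℝ f strip x

/-- A bi-Lipschitz diffeomorphism of the strip that preserves both boundary components, has a
Lipschitz differential, and stays at bounded distance from the identity. -/
structure Tame (C : ℝ) (f : ℝ × ℝ → ℝ × ℝ) : Prop where
  bijOn : BijOn f strip strip
  top : ∀ q, (f (q, 1)).2 = 1
  bot : ∀ q, (f (q, -1)).2 = -1
  diff : DifferentiableOn ℝ f strip
  norm_le : ∀ x ∈ strip, ‖sD f x‖ ≤ C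
  lip : ∀ x ∈ strip, ∀ y ∈ strip, ‖sD f x - sD f y‖ ≤ C * ‖x - y‖
  antilip : ∀ x ∈ strip, ∀ y ∈ strip, ‖x - y‖ ≤ C * ‖f x - f y‖
  disp : ∀ x ∈ strip, ‖f x - x‖ ≤ C

theorem top_mem_strip (q : ℝ) : (q, (1 : ℝ)) ∈ strip := by simp [mem_strip]

theorem bot_mem_strip (q : ℝ) : (q, (-1 : ℝ)) ∈ strip := by simp [mem_strip]

section

variable {f g : ℝ × ℝ → ℝ × ℝ}

theorem stripInv_apply (h : InjOn f strip) {x : ℝ × ℝ} (hx : x ∈ strip) :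
    stripInv f (f x) = x := h.leftInvOn_invFunOn hx

theorem apply_stripInv (h : SurjOn f strip strip) {x : ℝ × ℝ} (hx : x ∈ strip) :
    f (stripInv f x) = x := h.rightInvOn_invFunOn hx

theorem stripInv_mem (h : SurjOn f strip strip) {x : ℝ × ℝ} (hx : x ∈ strip) :
    stripInv f x ∈ strip := h.mapsTo_invFunOn hx

theorem stripInv_eqOn_of_rightInv (h : InjOn f strip) (hg : MapsTo g strip strip)
    (hfg : ∀ x ∈ strip, f (g x) = x) : EqOn (stripInv f) g strip := fun x hx => by
  conv_lhs => rw [← hfg x hx]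
  exact stripInv_apply h (hg hx)

theorem sD_congr {E : Type} [NormedAddCommGroup E] [NormedSpace ℝ E] {f g : ℝ × ℝ → E}
    (hfg : EqOn f g strip) {x : ℝ × ℝ} (hx : x ∈ strip) : sD f x = sD g x :=
  fderivWithin_congr hfg (hfg hx)

namespace Tame

variable {C C' : ℝ}

theorem nonneg (hf : Tame C f) : 0 ≤ C :=
  (norm_nonneg _).trans (hf.norm_le _ (top_mem_strip 0))

theorem mono (hf : Tame C f) (h : C ≤ C') : Tame C' f where
  bijOn := hf.bijOn
  top := hf.top
  bot := hf.bot
  diff := hf.diff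
  norm_le x hx := (hf.norm_le x hx).trans h
  lip x hx y hy := (hf.lip x hx y hy).trans (by gcongr)
  antilip x hx y hy := (hf.antilip x hx y hy).trans (by gcongr)
  disp x hx := (hf.disp x hx).trans h

theorem congr (hf : Tame C f) (h : EqOn f g strip) : Tame C g where
  bijOn := hf.bijOn.congr h
  top q := by rw [← h (top_mem_strip q), hf.top]
  bot q := by rw [← h (bot_mem_strip q), hf.bot]
  diff := hf.diff.congr h.symm
  norm_le x hx := by rw [← sD_congr h hx]; exact hf.norm_le x hx
  lip x hx y hy := by rw [← sD_congr h hx, ← sD_congr h hy]; exact hf.lip x hx y hy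
  antilip x hx y hy := by rw [← h hx, ← h hy]; exact hf.antilip x hx y hy
  disp x hx := by rw [← h hx]; exact hf.disp x hx

theorem mem (hf : Tame C f) {x : ℝ × ℝ} (hx : x ∈ strip) : f x ∈ strip := hf.bijOn.mapsTo hx

theorem hasFDerivWithinAt (hf : Tame C f) {x : ℝ × ℝ} (hx : x ∈ strip) :
    HasFDerivWithinAt f (sD f x) strip x := (hf.diff x hx).hasFDerivWithinAt

theorem norm_sub_le (hf : Tame C f) {x y : ℝ × ℝ} (hx : x ∈ strip) (hy : y ∈ strip) :
    ‖f x - f y‖ ≤ C * ‖x - y‖ := norm_sub_le_of_fderivWithin hf.diff hf.norm_le hx hy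

theorem exists_equiv (hf : Tame C f) {x : ℝ × ℝ} (hx : x ∈ strip) :
    ∃ e : (ℝ × ℝ) ≃L[ℝ] ℝ × ℝ, (e : ℝ × ℝ →L[ℝ] ℝ × ℝ) = sD f x ∧
      ‖(e.symm : ℝ × ℝ →L[ℝ] ℝ × ℝ)‖ ≤ C :=
  exists_equiv_of_antilipschitz hf.nonneg
    (le_norm_apply_of_antilipschitz hx (hf.hasFDerivWithinAt hx) fun y hy => hf.antilip y hy x hx)

theorem identity : Tame 1 (id : ℝ × ℝ → ℝ × ℝ) where
  bijOn := bijOn_id _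
  top q := rfl
  bot q := rfl
  diff := differentiableOn_id
  norm_le x hx := by
    rw [sD, fderivWithin_id (uniqueDiffOn_strip x hx)]
    exact ContinuousLinearMap.norm_id_le
  lip x hx y hy := by
    rw [sD, sD, fderivWithin_id (uniqueDiffOn_strip x hx),
      fderivWithin_id (uniqueDiffOn_strip y hy), sub_self, norm_zero]
    positivity
  antilip x hx y hy := by simp
  disp x hx := by simp

theorem sD_comp (hf : Tame C f) (hg : Tame C' g) {x : ℝ × ℝ} (hx : x ∈ strip) :
    sD (f ∘ g) x = (sD f (g x)).comp (sD g x) :=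
  ((hf.hasFDerivWithinAt (hg.mem hx)).comp x (hg.hasFDerivWithinAt hx)
    hg.bijOn.mapsTo).fderivWithin (uniqueDiffOn_strip x hx)

theorem comp (hf : Tame C f) (hg : Tame C' g) :
    Tame (C * C' ^ 2 + C * C' + C + C') (f ∘ g) := by
  have h0 := hf.nonneg
  have h1 := hg.nonneg
  have h2 : 0 ≤ C * C' := by positivity
  have h3 : 0 ≤ C * C' ^ 2 := by positivity
  refine ⟨hf.bijOn.comp hg.bijOn, fun q => ?_, fun q => ?_, hf.diff.comp hg.diff hg.bijOn.mapsTo,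
    fun x hx => ?_, fun x hx y hy => ?_, fun x hx y hy => ?_, fun x hx => ?_⟩
  · have : g (q, 1) = ((g (q, 1)).1, 1) := Prod.ext rfl (hg.top q)
    rw [Function.comp_apply, this, hf.top]
  · have : g (q, -1) = ((g (q, -1)).1, -1) := Prod.ext rfl (hg.bot q)
    rw [Function.comp_apply, this, hf.bot]
  · rw [sD_comp hf hg hx]
    calc _ ≤ ‖sD f (g x)‖ * ‖sD g x‖ := ContinuousLinearMap.opNorm_comp_le _ _
      _ ≤ C * C' := by
        gcongr
        exacts [hf.norm_le _ (hg.mem hx), hg.norm_le x hx]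
      _ ≤ _ := by linarith
  · rw [sD_comp hf hg hx, sD_comp hf hg hy]
    have key : (sD f (g x)).comp (sD g x) - (sD f (g y)).comp (sD g y) =
        (sD f (g x) - sD f (g y)).comp (sD g x) + (sD f (g y)).comp (sD g x - sD g y) := by
      rw [ContinuousLinearMap.sub_comp, ContinuousLinearMap.comp_sub]; abel
    rw [key]
    calc _ ≤ ‖sD f (g x) - sD f (g y)‖ * ‖sD g x‖ + ‖sD f (g y)‖ * ‖sD g x - sD g y‖ :=
          (norm_add_le _ _).trans (add_le_add (ContinuousLinearMap.opNorm_comp_le _ _)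
            (ContinuousLinearMap.opNorm_comp_le _ _))
      _ ≤ (C * (C' * ‖x - y‖)) * C' + C * (C' * ‖x - y‖) := by
        gcongr
        · exact (hf.lip _ (hg.mem hx) _ (hg.mem hy)).trans
            (mul_le_mul_of_nonneg_left (hg.norm_sub_le hx hy) h0)
        · exact hg.norm_le x hx
        · exact hf.norm_le _ (hg.mem hy)
        · exact hg.lip x hx y hy
      _ = (C * C' ^ 2 + C * C') * ‖x - y‖ := by ring
      _ ≤ _ := mul_le_mul_of_nonneg_right (by linarith) (norm_nonneg _)
  · calc ‖x - y‖ ≤ C' * ‖g x - g y‖ := hg.antilip x hx y hy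
      _ ≤ C' * (C * ‖f (g x) - f (g y)‖) := by
        gcongr; exact hf.antilip _ (hg.mem hx) _ (hg.mem hy)
      _ = (C * C') * ‖f (g x) - f (g y)‖ := by ring
      _ ≤ _ := by
        rw [Function.comp_apply, Function.comp_apply]
        exact mul_le_mul_of_nonneg_right (by linarith) (norm_nonneg _)
  · calc ‖f (g x) - x‖ = ‖(f (g x) - g x) + (g x - x)‖ := by rw [sub_add_sub_cancel]
      _ ≤ C + C' := (norm_add_le _ _).trans
        (add_le_add (hf.disp _ (hg.mem hx)) (hg.disp x hx))
      _ ≤ _ := by linarith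

section Inverse

variable (hf : Tame C f)
include hf

theorem inv_mem {x : ℝ × ℝ} (hx : x ∈ strip) : stripInv f x ∈ strip :=
  stripInv_mem hf.bijOn.surjOn hx

theorem apply_inv {x : ℝ × ℝ} (hx : x ∈ strip) : f (stripInv f x) = x :=
  apply_stripInv hf.bijOn.surjOn hx

theorem inv_apply {x : ℝ × ℝ} (hx : x ∈ strip) : stripInv f (f x) = x :=
  stripInv_apply hf.bijOn.injOn hx

theorem inv_bijOn : BijOn (stripInv f) strip strip :=
  ⟨fun _ hx => hf.inv_mem hx, fun x hx y hy h => by rw [← hf.apply_inv hx, h, hf.apply_inv hy],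
    fun x hx => ⟨f x, hf.mem hx, hf.inv_apply hx⟩⟩

theorem inv_norm_sub_le {x y : ℝ × ℝ} (hx : x ∈ strip) (hy : y ∈ strip) :
    ‖stripInv f x - stripInv f y‖ ≤ C * ‖x - y‖ := by
  simpa [hf.apply_inv hx, hf.apply_inv hy] using
    hf.antilip _ (hf.inv_mem hx) _ (hf.inv_mem hy)

theorem inv_continuousOn : ContinuousOn (stripInv f) strip :=
  (LipschitzOnWith.of_dist_le_mul (K := C.toNNReal) fun x hx y hy => by
    simpa [dist_eq_norm, hf.nonneg] using hf.inv_norm_sub_le hx hy).continuousOn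

theorem inv_hasFDerivWithinAt {x : ℝ × ℝ} (hx : x ∈ strip) {e : (ℝ × ℝ) ≃L[ℝ] ℝ × ℝ}
    (he : (e : ℝ × ℝ →L[ℝ] ℝ × ℝ) = sD f (stripInv f x)) :
    HasFDerivWithinAt (stripInv f) (e.symm : ℝ × ℝ →L[ℝ] ℝ × ℝ) strip x := by
  refine HasFDerivWithinAt.of_local_left_inverse (f := f) (t := strip) ?_ ?_ hx ?_
  · exact tendsto_nhdsWithin_iff.2 ⟨hf.inv_continuousOn x hx,
      eventually_mem_nhdsWithin.mono fun y hy => hf.inv_mem hy⟩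
  · rw [he]; exact hf.hasFDerivWithinAt (hf.inv_mem hx)
  · exact eventually_mem_nhdsWithin.mono fun y hy => hf.apply_inv hy

theorem exists_equiv_inv {x : ℝ × ℝ} (hx : x ∈ strip) :
    ∃ e : (ℝ × ℝ) ≃L[ℝ] ℝ × ℝ, (e : ℝ × ℝ →L[ℝ] ℝ × ℝ) = sD f (stripInv f x) ∧
      (e.symm : ℝ × ℝ →L[ℝ] ℝ × ℝ) = sD (stripInv f) x ∧
      ‖(e.symm : ℝ × ℝ →L[ℝ] ℝ × ℝ)‖ ≤ C := by
  obtain ⟨e, he, h⟩ := hf.exists_equiv (hf.inv_mem hx)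
  exact ⟨e, he, ((hf.inv_hasFDerivWithinAt hx he).fderivWithin (uniqueDiffOn_strip x hx)).symm, h⟩

/-- A continuous self-map of a line at bounded distance from the identity is onto. This is what
makes the inverse preserve each boundary component. -/
theorem exists_boundary_preimage {p : ℝ} (h : ∀ q, (f (q, p)).2 = p) (hp : p ∈ Icc (-1 : ℝ) 1)
    (q : ℝ) : ∃ q', f (q', p) = (q, p) := by
  have hmem : ∀ q, (q, p) ∈ strip := fun q => mem_strip.2 hp
  have hc : Continuous fun q => (f (q, p)).1 :=
    continuous_fst.comp (hf.diff.continuousOn.comp_continuous (by fun_prop) hmem)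
  have hb : ∀ q, |(f (q, p)).1 - q| ≤ C := fun q =>
    (norm_fst_le (f (q, p) - (q, p))).trans (hf.disp _ (hmem q))
  have h1 : Tendsto (fun q => (f (q, p)).1) atTop atTop :=
    tendsto_atTop_mono (fun q => by have := (abs_le.1 (hb q)).1; change q + -C ≤ _; linarith)
      (tendsto_atTop_add_const_right _ (-C) tendsto_id)
  have h2 : Tendsto (fun q => (f (q, p)).1) atBot atBot :=
    tendsto_atBot_mono (fun q => by have := (abs_le.1 (hb q)).2; change _ ≤ q + C; linarith)
      (tendsto_atBot_add_const_right _ C tendsto_id)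
  obtain ⟨q', hq'⟩ := hc.surjective h1 h2 q
  exact ⟨q', Prod.ext hq' (h q')⟩

theorem inv : Tame (C + C ^ 4) (stripInv f) := by
  have h0 := hf.nonneg
  have h4 : 0 ≤ C ^ 4 := by positivity
  refine ⟨hf.inv_bijOn, fun q => ?_, fun q => ?_, fun x hx => ?_, fun x hx => ?_,
    fun x hx y hy => ?_, fun x hx y hy => ?_, fun x hx => ?_⟩
  · obtain ⟨q', h⟩ := hf.exists_boundary_preimage (fun q => hf.top q) ⟨by norm_num, le_rfl⟩ q
    rw [← h, hf.inv_apply (top_mem_strip q')]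
  · obtain ⟨q', h⟩ := hf.exists_boundary_preimage (fun q => hf.bot q) ⟨le_rfl, by norm_num⟩ q
    rw [← h, hf.inv_apply (bot_mem_strip q')]
  · obtain ⟨e, he, -, -⟩ := hf.exists_equiv_inv hx
    exact (hf.inv_hasFDerivWithinAt hx he).differentiableWithinAt
  · obtain ⟨e, -, he, h⟩ := hf.exists_equiv_inv hx
    rw [← he]
    linarith
  · obtain ⟨e, he1, he2, he⟩ := hf.exists_equiv_inv hx
    obtain ⟨e', he1', he2', he'⟩ := hf.exists_equiv_inv hy
    rw [← he2, ← he2']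
    -- The resolvent identity. The four factors `C` bound the two inverse differentials, the
    -- Lipschitz constant of the differential of `f`, and that of the inverse map.
    have key : (e.symm : ℝ × ℝ →L[ℝ] ℝ × ℝ) - e'.symm =
        (e.symm : ℝ × ℝ →L[ℝ] ℝ × ℝ).comp (((e' : ℝ × ℝ →L[ℝ] ℝ × ℝ) - e).comp
          (e'.symm : ℝ × ℝ →L[ℝ] ℝ × ℝ)) := by
      ext <;> simp
    rw [key]
    calc _ ≤ ‖(e.symm : ℝ × ℝ →L[ℝ] ℝ × ℝ)‖ * (‖(e' : ℝ × ℝ →L[ℝ] ℝ × ℝ) - e‖ *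
          ‖(e'.symm : ℝ × ℝ →L[ℝ] ℝ × ℝ)‖) :=
          (ContinuousLinearMap.opNorm_comp_le _ _).trans (mul_le_mul_of_nonneg_left
            (ContinuousLinearMap.opNorm_comp_le _ _) (norm_nonneg _))
      _ ≤ C * (C * (C * ‖x - y‖) * C) := by
        gcongr
        rw [he1, he1', norm_sub_rev]
        exact (hf.lip _ (hf.inv_mem hx) _ (hf.inv_mem hy)).trans
          (mul_le_mul_of_nonneg_left (hf.inv_norm_sub_le hx hy) h0)
      _ = C ^ 4 * ‖x - y‖ := by ring
      _ ≤ _ := by gcongr; linarith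
  · have := hf.norm_sub_le (hf.inv_mem hx) (hf.inv_mem hy)
    rw [hf.apply_inv hx, hf.apply_inv hy] at this
    refine this.trans ?_
    gcongr
    linarith
  · have := hf.disp _ (hf.inv_mem hx)
    rw [hf.apply_inv hx, norm_sub_rev] at this
    linarith

/-- Dividing out a map with the same Jacobian gives an area-preserving map. -/
theorem det_comp_inv {g : ℝ × ℝ → ℝ × ℝ} (hg : Tame C' g)
    (h : ∀ x ∈ strip, (sD f x).det = (sD g x).det) {x : ℝ × ℝ} (hx : x ∈ strip) :
    (sD (g ∘ stripInv f) x).det = 1 := by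
  obtain ⟨e, he1, he2, -⟩ := hf.exists_equiv_inv hx
  rw [sD_comp hg hf.inv hx, ← he2]
  have h1 : ((sD g (stripInv f x)).comp (e.symm : ℝ × ℝ →L[ℝ] ℝ × ℝ)).det =
      (sD g (stripInv f x)).det * (e.symm : ℝ × ℝ →L[ℝ] ℝ × ℝ).det := by
    simp only [ContinuousLinearMap.det, ContinuousLinearMap.toLinearMap_comp, LinearMap.det_comp]
  rw [h1, ← h _ (hf.inv_mem hx), ← he1]
  simp [ContinuousLinearMap.det]

end Inverse

theorem contDiffOn (hf : Tame C f) : ContDiffOn ℝ 1 f strip := by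
  rw [show (1 : WithTop ℕ∞) = 0 + 1 by simp, contDiffOn_succ_iff_fderivWithin uniqueDiffOn_strip]
  refine ⟨hf.diff, by simp, contDiffOn_zero.2 ?_⟩
  exact (LipschitzOnWith.of_dist_le_mul (K := C.toNNReal) fun x hx y hy => by
    simpa [dist_eq_norm, hf.nonneg] using hf.lip x hx y hy).continuousOn

theorem isStripDiffeo (hf : Tame C f) : IsStripDiffeo 1 f :=
  ⟨hf.bijOn, by exact_mod_cast hf.contDiffOn, by exact_mod_cast hf.inv.contDiffOn⟩

end Tame

end

/-! ### Functions of class C^{1,1} and their vertical primitives. -/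

/-- A real function on the strip that is bounded by `C`, with a differential that is bounded by `C`
and `C`-Lipschitz. -/
structure C11 (C : ℝ) (g : ℝ × ℝ → ℝ) : Prop where
  diff : DifferentiableOn ℝ g strip
  bdd : ∀ x ∈ strip, |g x| ≤ C
  dbdd : ∀ x ∈ strip, ‖sD g x‖ ≤ C
  dlip : ∀ x ∈ strip, ∀ y ∈ strip, ‖sD g x - sD g y‖ ≤ C * ‖x - y‖

/-- The vertical primitive of `g` that vanishes on the lower boundary. -/
def primitive (g : ℝ × ℝ → ℝ) (x : ℝ × ℝ) : ℝ := ∫ u in (-1 : ℝ)..x.2, g (x.1, u)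

theorem mk_mem_strip {q u : ℝ} (hu : u ∈ Icc (-1 : ℝ) 1) : (q, u) ∈ strip := mem_strip.2 hu

theorem intervalIntegrable_vertical {h : ℝ × ℝ → ℝ} (hh : ContinuousOn h strip) (q : ℝ) {a b : ℝ}
    (ha : a ∈ Icc (-1 : ℝ) 1) (hb : b ∈ Icc (-1 : ℝ) 1) :
    IntervalIntegrable (fun u => h (q, u)) volume a b := by
  refine ContinuousOn.intervalIntegrable (hh.comp (by fun_prop) fun u hu => ?_)
  exact mk_mem_strip (uIcc_subset_Icc ha hb hu)

theorem vertical_integral_le {h : ℝ → ℝ} {K a b : ℝ} (ha : a ∈ Icc (-1 : ℝ) 1)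
    (hb : b ∈ Icc (-1 : ℝ) 1) (hK : ∀ u ∈ Icc (-1 : ℝ) 1, |h u| ≤ K) :
    |∫ u in a..b, h u| ≤ K * |b - a| :=
  intervalIntegral.norm_integral_le_of_norm_le_const (f := h) fun u hu =>
    hK u (uIcc_subset_Icc ha hb (uIoc_subset_uIcc hu))

theorem norm_fst_smul_add_snd_smul_le (α β : ℝ) :
    ‖α • ContinuousLinearMap.fst ℝ ℝ ℝ + β • ContinuousLinearMap.snd ℝ ℝ ℝ‖ ≤ |α| + |β| := by
  refine ContinuousLinearMap.opNorm_le_bound _ (by positivity) fun v => ?_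
  simp only [add_apply, smul_apply,
    ContinuousLinearMap.coe_fst', ContinuousLinearMap.coe_snd', smul_eq_mul]
  calc ‖α * v.1 + β * v.2‖ ≤ |α| * ‖v.1‖ + |β| * ‖v.2‖ := by
        refine (norm_add_le _ _).trans_eq ?_
        rw [norm_mul, norm_mul, Real.norm_eq_abs, Real.norm_eq_abs β]
    _ ≤ |α| * ‖v‖ + |β| * ‖v‖ := by
        gcongr
        exacts [norm_fst_le v, norm_snd_le v]
    _ = _ := by ring

namespace C11

variable {C C' : ℝ} {f g : ℝ × ℝ → ℝ}

theorem nonneg (hf : C11 C f) : 0 ≤ C := (abs_nonneg _).trans (hf.bdd _ (top_mem_strip 0))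

theorem mono (hf : C11 C f) (h : C ≤ C') : C11 C' f where
  diff := hf.diff
  bdd x hx := (hf.bdd x hx).trans h
  dbdd x hx := (hf.dbdd x hx).trans h
  dlip x hx y hy := (hf.dlip x hx y hy).trans (by gcongr)

theorem hasFDerivWithinAt (hf : C11 C f) {x : ℝ × ℝ} (hx : x ∈ strip) :
    HasFDerivWithinAt f (sD f x) strip x := (hf.diff x hx).hasFDerivWithinAt

theorem of_hasFDerivWithinAt {f' : ℝ × ℝ → ℝ × ℝ →L[ℝ] ℝ}
    (h : ∀ x ∈ strip, HasFDerivWithinAt f (f' x) strip x) (hb : ∀ x ∈ strip, |f x| ≤ C)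
    (hd : ∀ x ∈ strip, ‖f' x‖ ≤ C)
    (hl : ∀ x ∈ strip, ∀ y ∈ strip, ‖f' x - f' y‖ ≤ C * ‖x - y‖) : C11 C f := by
  have key : ∀ x ∈ strip, sD f x = f' x := fun x hx =>
    (h x hx).fderivWithin (uniqueDiffOn_strip x hx)
  refine ⟨fun x hx => (h x hx).differentiableWithinAt, hb, fun x hx => ?_, fun x hx y hy => ?_⟩
  · rw [key x hx]; exact hd x hx
  · rw [key x hx, key y hy]; exact hl x hx y hy

theorem abs_sub_le (hf : C11 C f) {x y : ℝ × ℝ} (hx : x ∈ strip) (hy : y ∈ strip) :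
    |f x - f y| ≤ C * ‖x - y‖ := norm_sub_le_of_fderivWithin hf.diff hf.dbdd hx hy

theorem continuousOn_sD (hf : C11 C f) : ContinuousOn (sD f) strip :=
  (LipschitzOnWith.of_dist_le_mul (K := C.toNNReal) fun x hx y hy => by
    simpa [dist_eq_norm, hf.nonneg] using hf.dlip x hx y hy).continuousOn

theorem continuousOn_sD_apply (hf : C11 C f) (v : ℝ × ℝ) :
    ContinuousOn (fun x => sD f x v) strip := hf.continuousOn_sD.clm_apply continuousOn_const

theorem abs_sD_apply_le (hf : C11 C f) {x v : ℝ × ℝ} (hx : x ∈ strip) (hv : ‖v‖ ≤ 1) :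
    |sD f x v| ≤ C :=
  calc |sD f x v| ≤ ‖sD f x‖ * ‖v‖ := (sD f x).le_opNorm v
    _ ≤ C * 1 := mul_le_mul (hf.dbdd x hx) hv (norm_nonneg _) hf.nonneg
    _ = C := mul_one C

theorem abs_sD_sub_apply_le (hf : C11 C f) {x y v : ℝ × ℝ} (hx : x ∈ strip) (hy : y ∈ strip)
    (hv : ‖v‖ ≤ 1) : |sD f x v - sD f y v| ≤ C * ‖x - y‖ :=
  calc |sD f x v - sD f y v| ≤ ‖sD f x - sD f y‖ * ‖v‖ := (sD f x - sD f y).le_opNorm v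
    _ ≤ (C * ‖x - y‖) * 1 := mul_le_mul (hf.dlip x hx y hy) hv (norm_nonneg _)
        (mul_nonneg hf.nonneg (norm_nonneg _))
    _ = _ := mul_one _

theorem taylor (hf : C11 C f) {x y : ℝ × ℝ} (hx : x ∈ strip) (hy : y ∈ strip) :
    |f y - f x - sD f x (y - x)| ≤ C * ‖y - x‖ ^ 2 := by
  have hs : segment ℝ x y ⊆ strip := convex_strip.segment_subset hx hy
  have := (convex_segment x y).norm_image_sub_le_of_norm_hasFDerivWithin_le' (f := f)
    (f' := sD f) (φ := sD f x) (C := C * ‖y - x‖)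
    (fun z hz => (hf.hasFDerivWithinAt (hs hz)).mono hs) (fun z hz => ?_)
    (left_mem_segment ℝ x y) (right_mem_segment ℝ x y)
  · rw [Real.norm_eq_abs] at this
    exact this.trans_eq (by ring)
  · refine (hf.dlip z (hs hz) x hx).trans ?_
    gcongr
    · exact hf.nonneg
    · obtain ⟨a, b, ha, hb, hab, rfl⟩ := hz
      have : a • x + b • y - x = b • (y - x) := by
        rw [show a = 1 - b by linarith]; module
      rw [this, norm_smul, Real.norm_of_nonneg hb]
      exact mul_le_of_le_one_left (norm_nonneg _) (by linarith)

theorem add (hf : C11 C f) (hg : C11 C' g) : C11 (C + C') (fun x => f x + g x) := by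
  refine of_hasFDerivWithinAt (fun x hx => (hf.hasFDerivWithinAt hx).add (hg.hasFDerivWithinAt hx))
    (fun x hx => (abs_add_le _ _).trans (add_le_add (hf.bdd x hx) (hg.bdd x hx)))
    (fun x hx => (norm_add_le _ _).trans (add_le_add (hf.dbdd x hx) (hg.dbdd x hx)))
    fun x hx y hy => ?_
  rw [add_sub_add_comm, add_mul]
  exact (norm_add_le _ _).trans (add_le_add (hf.dlip x hx y hy) (hg.dlip x hx y hy))

theorem const_mul (hf : C11 C f) (k : ℝ) : C11 (|k| * C) (fun x => k * f x) := by
  refine of_hasFDerivWithinAt (fun x hx => (hf.hasFDerivWithinAt hx).const_mul k)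
    (fun x hx => ?_) (fun x hx => ?_) fun x hx y hy => ?_
  · rw [abs_mul]
    exact mul_le_mul_of_nonneg_left (hf.bdd x hx) (abs_nonneg k)
  · rw [norm_smul]
    exact mul_le_mul_of_nonneg_left (hf.dbdd x hx) (abs_nonneg k)
  · have key : k • sD f x - k • sD f y = k • (sD f x - sD f y) := by module
    refine (congrArg norm key).trans_le ?_
    rw [norm_smul, mul_assoc]
    exact mul_le_mul_of_nonneg_left (hf.dlip x hx y hy) (abs_nonneg k)

theorem sub (hf : C11 C f) (hg : C11 C' g) : C11 (C + C') (fun x => f x - g x) := by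
  simpa [sub_eq_add_neg] using hf.add (hg.const_mul (-1))

theorem const (k : ℝ) : C11 |k| (fun _ => k) :=
  of_hasFDerivWithinAt (f' := fun _ => 0) (fun x _ => hasFDerivWithinAt_const k x strip)
    (fun _ _ => le_rfl) (fun _ _ => by simp) fun _ _ _ _ => by
      simp only [sub_self, norm_zero]; positivity

theorem sD_mul (hf : C11 C f) (hg : C11 C' g) {x : ℝ × ℝ} (hx : x ∈ strip) :
    sD (fun x => f x * g x) x = f x • sD g x + g x • sD f x :=
  ((hf.hasFDerivWithinAt hx).mul (hg.hasFDerivWithinAt hx)).fderivWithin (uniqueDiffOn_strip x hx)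

theorem mul (hf : C11 C f) (hg : C11 C' g) : C11 (4 * (C * C')) (fun x => f x * g x) := by
  have h0 := hf.nonneg
  have h1 := hg.nonneg
  have h2 := mul_nonneg h0 h1
  refine of_hasFDerivWithinAt (fun x hx => (hf.hasFDerivWithinAt hx).mul (hg.hasFDerivWithinAt hx))
    (fun x hx => ?_) (fun x hx => ?_) fun x hx y hy => ?_
  · rw [abs_mul]
    have := mul_le_mul (hf.bdd x hx) (hg.bdd x hx) (abs_nonneg _) h0
    linarith
  · have e1 : ‖f x • sD g x‖ ≤ C * C' := by
      rw [norm_smul]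
      exact mul_le_mul (hf.bdd x hx) (hg.dbdd x hx) (norm_nonneg _) h0
    have e2 : ‖g x • sD f x‖ ≤ C' * C := by
      rw [norm_smul]
      exact mul_le_mul (hg.bdd x hx) (hf.dbdd x hx) (norm_nonneg _) h1
    linarith [norm_add_le (f x • sD g x) (g x • sD f x)]
  · have aux : ∀ {f g : ℝ × ℝ → ℝ} {C C' : ℝ}, C11 C f → C11 C' g →
        ‖f x • sD g x - f y • sD g y‖ ≤ 2 * (C * C') * ‖x - y‖ := by
      intro f g C C' hf hg
      have key : f x • sD g x - f y • sD g y =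
          f x • (sD g x - sD g y) + (f x - f y) • sD g y := by module
      rw [key]
      refine (norm_add_le _ _).trans ?_
      rw [norm_smul, norm_smul]
      have e1 := mul_le_mul (hf.bdd x hx) (hg.dlip x hx y hy) (norm_nonneg _) hf.nonneg
      have e2 := mul_le_mul (hf.abs_sub_le hx hy) (hg.dbdd y hy) (norm_nonneg _)
        (mul_nonneg hf.nonneg (norm_nonneg _))
      simp only [Real.norm_eq_abs]
      linarith
    have key : f x • sD g x + g x • sD f x - (f y • sD g y + g y • sD f y) =
        (f x • sD g x - f y • sD g y) + (g x • sD f x - g y • sD f y) := by abel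
    rw [key]
    refine (norm_add_le _ _).trans ?_
    linarith [aux hf hg, aux hg hf]

theorem inv {c : ℝ} (hc : 0 < c) (hf : C11 C f) (h : ∀ x ∈ strip, c ≤ f x) :
    C11 (1 / c + C / c ^ 2 + 2 * C ^ 2 / c ^ 3) (fun x => (f x)⁻¹) := by
  have h0 := hf.nonneg
  have hpos : ∀ x ∈ strip, 0 < f x := fun x hx => hc.trans_le (h x hx)
  have hinv : ∀ x ∈ strip, (f x)⁻¹ ≤ 1 / c := fun x hx => by
    rw [one_div]; exact inv_anti₀ hc (h x hx)
  have hp1 : 0 ≤ 1 / c := by positivity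
  have hp2 : 0 ≤ C / c ^ 2 := by positivity
  have hp3 : 0 ≤ 2 * C ^ 2 / c ^ 3 := by positivity
  refine of_hasFDerivWithinAt (f' := fun x => (-((f x)⁻¹ ^ 2)) • sD f x)
    (fun x hx => ?_) (fun x hx => ?_) (fun x hx => ?_) fun x hx y hy => ?_
  · refine ((hasDerivAt_inv (hpos x hx).ne').comp_hasFDerivWithinAt x
      (hf.hasFDerivWithinAt hx)).congr_fderiv ?_
    rw [inv_pow]
  · rw [abs_of_pos (inv_pos.2 (hpos x hx))]
    linarith [hinv x hx]
  · rw [norm_smul, norm_neg, norm_pow, Real.norm_of_nonneg (inv_pos.2 (hpos x hx)).le]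
    calc (f x)⁻¹ ^ 2 * ‖sD f x‖ ≤ (1 / c) ^ 2 * C := by
          gcongr
          exacts [(inv_pos.2 (hpos x hx)).le, hinv x hx, hf.dbdd x hx]
      _ = C / c ^ 2 := by ring
      _ ≤ _ := by linarith
  · have key : (-((f x)⁻¹ ^ 2)) • sD f x - (-((f y)⁻¹ ^ 2)) • sD f y =
        (-((f x)⁻¹ ^ 2)) • (sD f x - sD f y) +
        (((f x)⁻¹ + (f y)⁻¹) * ((f x)⁻¹ * (f y)⁻¹ * (f x - f y))) • sD f y := by
      have e : ((f x)⁻¹ + (f y)⁻¹) * ((f x)⁻¹ * (f y)⁻¹ * (f x - f y)) =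
          (f y)⁻¹ ^ 2 - (f x)⁻¹ ^ 2 := by
        have := (hpos x hx).ne'
        have := (hpos y hy).ne'
        field_simp
        ring
      rw [e]
      module
    rw [key]
    refine (norm_add_le _ _).trans ?_
    have p1 := (inv_pos.2 (hpos x hx)).le
    have p2 := (inv_pos.2 (hpos y hy)).le
    rw [norm_smul, norm_smul, norm_neg, norm_pow, norm_mul, norm_mul, norm_mul,
      Real.norm_of_nonneg (add_nonneg p1 p2), Real.norm_of_nonneg p1, Real.norm_of_nonneg p2]
    calc (f x)⁻¹ ^ 2 * ‖sD f x - sD f y‖ +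
          ((f x)⁻¹ + (f y)⁻¹) * ((f x)⁻¹ * (f y)⁻¹ * ‖f x - f y‖) * ‖sD f y‖
        ≤ (1 / c) ^ 2 * (C * ‖x - y‖) +
          (1 / c + 1 / c) * (1 / c * (1 / c) * (C * ‖x - y‖)) * C := by
          gcongr
          exacts [hinv x hx, hf.dlip x hx y hy, hinv x hx, hinv y hy, hinv x hx, hinv y hy,
            hf.abs_sub_le hx hy, hf.dbdd y hy]
      _ = (C / c ^ 2 + 2 * C ^ 2 / c ^ 3) * ‖x - y‖ := by
          field_simp
          ring
      _ ≤ _ := mul_le_mul_of_nonneg_right (by linarith) (norm_nonneg _)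

section Horizontal

variable {p : ℝ} (hp : p ∈ Icc (-1 : ℝ) 1)
include hp

theorem hasFDerivWithinAt_comp_fst (hf : C11 C f) (x : ℝ × ℝ) :
    HasFDerivWithinAt (fun x : ℝ × ℝ => f (x.1, p))
      ((sD f (x.1, p) (1, 0)) • ContinuousLinearMap.fst ℝ ℝ ℝ) strip x := by
  have h1 : HasFDerivWithinAt (fun x : ℝ × ℝ => (x.1, p))
      ((ContinuousLinearMap.fst ℝ ℝ ℝ).prod 0) strip x :=
    (hasFDerivAt_fst.prodMk (hasFDerivAt_const p x)).hasFDerivWithinAt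
  refine ((hf.hasFDerivWithinAt (mk_mem_strip hp)).comp x h1
    (fun y _ => mk_mem_strip hp)).congr_fderiv ?_
  ext
  · simp
  · simp only [ContinuousLinearMap.comp_apply, ContinuousLinearMap.inr_apply,
      ContinuousLinearMap.prod_apply, ContinuousLinearMap.coe_fst', zero_apply, smul_apply,
      smul_zero]
    exact map_zero _

theorem comp_fst (hf : C11 C f) : C11 C (fun x => f (x.1, p)) := by
  have hfst : ‖ContinuousLinearMap.fst ℝ ℝ ℝ‖ ≤ 1 := ContinuousLinearMap.norm_fst_le ℝ ℝ ℝ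
  have he : ‖((1 : ℝ), (0 : ℝ))‖ ≤ 1 := by simp [Prod.norm_def]
  refine of_hasFDerivWithinAt (fun x _ => hf.hasFDerivWithinAt_comp_fst hp x)
    (fun x _ => hf.bdd _ (mk_mem_strip hp)) (fun x hx => ?_) fun x hx y hy => ?_
  · rw [norm_smul]
    have := mul_le_mul (hf.abs_sD_apply_le (mk_mem_strip (q := x.1) hp) he) hfst (norm_nonneg _)
      hf.nonneg
    simpa using this
  · refine (congrArg norm (sub_smul _ _ _).symm).trans_le ?_
    rw [norm_smul]
    have h1 := hf.abs_sD_sub_apply_le (mk_mem_strip (q := x.1) hp) (mk_mem_strip (q := y.1) hp) he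
    have h2 : ‖((x.1, p) : ℝ × ℝ) - (y.1, p)‖ ≤ ‖x - y‖ := by
      have : ((x.1, p) : ℝ × ℝ) - (y.1, p) = ((x - y).1, 0) := by simp
      rw [this]
      simp [Prod.norm_def]
    have h3 := mul_le_mul (h1.trans (mul_le_mul_of_nonneg_left h2 hf.nonneg)) hfst
      (norm_nonneg _) (mul_nonneg hf.nonneg (norm_nonneg _))
    simpa using h3

end Horizontal

section Primitive

/-- Differentiation under the integral with an explicit quadratic remainder, valid up to the
boundary. -/
theorem hasFDerivWithinAt_primitive (hf : C11 C f) {x : ℝ × ℝ} (hx : x ∈ strip) :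
    HasFDerivWithinAt (primitive f)
      ((primitive (fun y => sD f y (1, 0)) x) • ContinuousLinearMap.fst ℝ ℝ ℝ +
        f x • ContinuousLinearMap.snd ℝ ℝ ℝ) strip x := by
  have hm1 : (-1 : ℝ) ∈ Icc (-1 : ℝ) 1 := by norm_num
  have key : ∀ y ∈ strip, ‖primitive f y - primitive f x -
      ((primitive (fun y => sD f y (1, 0)) x) • ContinuousLinearMap.fst ℝ ℝ ℝ +
        f x • ContinuousLinearMap.snd ℝ ℝ ℝ) (y - x)‖ ≤ 3 * C * ‖‖y - x‖ ^ 2‖ := by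
    intro y hy
    have hx2 := mem_strip.1 hx
    have hy2 := mem_strip.1 hy
    have hI := fun (q : ℝ) {a b : ℝ} => @intervalIntegrable_vertical f hf.diff.continuousOn q a b
    have hI' := fun (q : ℝ) {a b : ℝ} => @intervalIntegrable_vertical (fun y => sD f y (1, 0))
      (hf.continuousOn_sD_apply (1, 0)) q a b
    -- The remainder splits into the piece between the heights `x.2` and `y.2`, where `f` varies by
    -- at most `C * ‖y - x‖`, and the change of vertical line below `x.2`, a Taylor remainder over a
    -- height of at most 2. Together they give the constant `3 * C`.
    have e1 : primitive f y - primitive f x - ((primitive (fun y => sD f y (1, 0)) x) •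
          ContinuousLinearMap.fst ℝ ℝ ℝ + f x • ContinuousLinearMap.snd ℝ ℝ ℝ) (y - x) =
        (∫ u in x.2..y.2, (f (y.1, u) - f x)) +
        ∫ u in (-1)..x.2, (f (y.1, u) - f (x.1, u) - sD f (x.1, u) (1, 0) * (y.1 - x.1)) := by
      rw [intervalIntegral.integral_sub (hI _ hx2 hy2) (by simp),
        intervalIntegral.integral_sub ((hI _ hm1 hx2).sub (hI _ hm1 hx2))
          ((hI' _ hm1 hx2).mul_const _),
        intervalIntegral.integral_sub (hI _ hm1 hx2) (hI _ hm1 hx2),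
        intervalIntegral.integral_const, intervalIntegral.integral_mul_const]
      have e2 := intervalIntegral.integral_add_adjacent_intervals
        (hI y.1 hm1 hx2) (hI y.1 hx2 hy2)
      simp only [primitive, ← e2, add_apply, smul_apply,
        ContinuousLinearMap.coe_fst', ContinuousLinearMap.coe_snd', smul_eq_mul, Prod.fst_sub,
        Prod.snd_sub]
      ring
    have hfst := norm_fst_le (y - x)
    have hsnd := norm_snd_le (y - x)
    rw [Prod.fst_sub, Real.norm_eq_abs] at hfst
    rw [Prod.snd_sub, Real.norm_eq_abs] at hsnd
    have b1 : |∫ u in x.2..y.2, (f (y.1, u) - f x)| ≤ C * ‖y - x‖ * |y.2 - x.2| := by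
      refine intervalIntegral.norm_integral_le_of_norm_le_const (f := fun u => f (y.1, u) - f x)
        fun u hu => ?_
      have hu' := uIoc_subset_uIcc hu
      refine (hf.abs_sub_le (mk_mem_strip (uIcc_subset_Icc hx2 hy2 hu')) hx).trans ?_
      refine mul_le_mul_of_nonneg_left ?_ hf.nonneg
      refine (Prod.norm_def _).trans_le (max_le ?_ ?_)
      · simpa using hfst
      · have := abs_sub_left_of_mem_uIcc hu'
        simpa using this.trans hsnd
    have b2 : |∫ u in (-1)..x.2,
        (f (y.1, u) - f (x.1, u) - sD f (x.1, u) (1, 0) * (y.1 - x.1))| ≤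
        C * ‖y - x‖ ^ 2 * |x.2 - (-1)| := by
      refine vertical_integral_le hm1 hx2 fun u hu => ?_
      have := hf.taylor (mk_mem_strip (q := x.1) hu) (mk_mem_strip (q := y.1) hu)
      have e3 : ((y.1, u) : ℝ × ℝ) - (x.1, u) = (y.1 - x.1) • ((1 : ℝ), (0 : ℝ)) := by simp
      rw [e3, map_smul, smul_eq_mul, mul_comm (y.1 - x.1)] at this
      refine this.trans (mul_le_mul_of_nonneg_left ?_ hf.nonneg)
      gcongr
      rw [norm_smul]
      simp [Prod.norm_def]
    have b3 : |x.2 - (-1)| ≤ 2 := by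
      rw [abs_le]; constructor <;> linarith [hx2.1, hx2.2]
    rw [e1, norm_pow, norm_norm]
    refine (norm_add_le _ _).trans ?_
    rw [Real.norm_eq_abs, Real.norm_eq_abs]
    have c1 := mul_le_mul_of_nonneg_left hsnd (mul_nonneg hf.nonneg (norm_nonneg (y - x)))
    have c2 := mul_le_mul_of_nonneg_left b3 (mul_nonneg hf.nonneg (sq_nonneg ‖y - x‖))
    nlinarith
  rw [hasFDerivWithinAt_iff_isLittleO]
  exact (Asymptotics.IsBigO.of_bound (3 * C) (eventually_mem_nhdsWithin.mono key)).trans_isLittleO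
    ((Asymptotics.isLittleO_pow_sub_sub x (by norm_num)).mono inf_le_left)

theorem sD_primitive (hf : C11 C f) {x : ℝ × ℝ} (hx : x ∈ strip) :
    sD (primitive f) x = (primitive (fun y => sD f y (1, 0)) x) • ContinuousLinearMap.fst ℝ ℝ ℝ +
        f x • ContinuousLinearMap.snd ℝ ℝ ℝ :=
  (hf.hasFDerivWithinAt_primitive hx).fderivWithin (uniqueDiffOn_strip x hx)

theorem primitive (hf : C11 C f) : C11 (4 * C) (primitive f) := by
  have hm1 : (-1 : ℝ) ∈ Icc (-1 : ℝ) 1 := by norm_num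
  have h0 := hf.nonneg
  have he : ‖((1 : ℝ), (0 : ℝ))‖ ≤ 1 := by simp [Prod.norm_def]
  have hlen : ∀ {x : ℝ × ℝ}, x ∈ strip → |x.2 - (-1)| ≤ 2 := fun hx => by
    rw [abs_le]; constructor <;> linarith [(mem_strip.1 hx).1, (mem_strip.1 hx).2]
  have hα : ∀ {x : ℝ × ℝ}, x ∈ strip →
      |RandomTwist.primitive (fun y => sD f y (1, 0)) x| ≤ C * 2 := fun hx =>
    (vertical_integral_le hm1 (mem_strip.1 hx) fun u hu =>
      hf.abs_sD_apply_le (mk_mem_strip hu) he).trans (mul_le_mul_of_nonneg_left (hlen hx) h0)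
  refine of_hasFDerivWithinAt (fun x hx => hf.hasFDerivWithinAt_primitive hx)
    (fun x hx => ?_) (fun x hx => ?_) fun x hx y hy => ?_
  · have := (vertical_integral_le hm1 (mem_strip.1 hx) fun u hu =>
      hf.bdd (x.1, u) (mk_mem_strip hu)).trans (mul_le_mul_of_nonneg_left (hlen hx) h0)
    exact this.trans (by linarith)
  · refine (norm_fst_smul_add_snd_smul_le _ _).trans ?_
    linarith [hα hx, hf.bdd x hx]
  · have hx2 := mem_strip.1 hx
    have hy2 := mem_strip.1 hy
    have hI' := fun (q : ℝ) {a b : ℝ} => @intervalIntegrable_vertical (fun y => sD f y (1, 0))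
      (hf.continuousOn_sD_apply (1, 0)) q a b
    have key : ∀ a b a' b' : ℝ, (a • ContinuousLinearMap.fst ℝ ℝ ℝ +
        b • ContinuousLinearMap.snd ℝ ℝ ℝ) - (a' • ContinuousLinearMap.fst ℝ ℝ ℝ +
        b' • ContinuousLinearMap.snd ℝ ℝ ℝ) = (a - a') • ContinuousLinearMap.fst ℝ ℝ ℝ +
        (b - b') • ContinuousLinearMap.snd ℝ ℝ ℝ := fun a b a' b' => by module
    rw [key]
    refine (norm_fst_smul_add_snd_smul_le _ _).trans ?_
    have hfst := norm_fst_le (x - y)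
    have hsnd := norm_snd_le (x - y)
    rw [Prod.fst_sub, Real.norm_eq_abs] at hfst
    rw [Prod.snd_sub, Real.norm_eq_abs] at hsnd
    have e1 : RandomTwist.primitive (fun y => sD f y (1, 0)) x -
        RandomTwist.primitive (fun y => sD f y (1, 0)) y =
        (∫ u in (-1)..x.2, (sD f (x.1, u) (1, 0) - sD f (y.1, u) (1, 0))) +
        ∫ u in y.2..x.2, sD f (y.1, u) (1, 0) := by
      rw [intervalIntegral.integral_sub (hI' _ hm1 hx2) (hI' _ hm1 hx2)]
      have e2 := intervalIntegral.integral_add_adjacent_intervals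
        (hI' y.1 hm1 hy2) (hI' y.1 hy2 hx2)
      simp only [RandomTwist.primitive, ← e2]
      ring
    have b1 : |∫ u in (-1)..x.2, (sD f (x.1, u) (1, 0) - sD f (y.1, u) (1, 0))| ≤
        C * ‖x - y‖ * |x.2 - (-1)| := by
      refine vertical_integral_le hm1 hx2 fun u hu => ?_
      refine (hf.abs_sD_sub_apply_le (mk_mem_strip hu) (mk_mem_strip hu) he).trans ?_
      refine mul_le_mul_of_nonneg_left ?_ h0
      simp [Prod.norm_def]
    have b2 : |∫ u in y.2..x.2, sD f (y.1, u) (1, 0)| ≤ C * |x.2 - y.2| :=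
      vertical_integral_le hy2 hx2 fun u hu => hf.abs_sD_apply_le (mk_mem_strip hu) he
    have b3 := hf.abs_sub_le hx hy
    rw [e1]
    have c1 := mul_le_mul_of_nonneg_left (hlen hx) (mul_nonneg h0 (norm_nonneg (x - y)))
    have c2 := mul_le_mul_of_nonneg_left hsnd h0
    linarith [abs_add_le (∫ u in (-1)..x.2, (sD f (x.1, u) (1, 0) - sD f (y.1, u) (1, 0)))
      (∫ u in y.2..x.2, sD f (y.1, u) (1, 0))]

theorem integral_sD_vertical (hf : C11 C f) (q : ℝ) :
    ∫ u in (-1 : ℝ)..1, sD f (q, u) (0, 1) = f (q, 1) - f (q, -1) := by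
  refine intervalIntegral.integral_eq_sub_of_hasDerivAt_of_le (f := fun u => f (q, u))
    (by norm_num) (hf.diff.continuousOn.comp (by fun_prop) fun u hu => mk_mem_strip hu)
    (fun u hu => ?_)
    (intervalIntegrable_vertical (hf.continuousOn_sD_apply (0, 1)) q (by norm_num) (by norm_num))
  have h1 : HasDerivWithinAt (fun u : ℝ => (q, u)) (0, 1) (Icc (-1) 1) u :=
    ((hasDerivAt_const u q).prodMk (hasDerivAt_id u)).hasDerivWithinAt
  have h2 := (hf.hasFDerivWithinAt (mk_mem_strip (q := q)
    (Ioo_subset_Icc_self hu))).comp_hasDerivWithinAt u h1 fun v hv => mk_mem_strip hv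
  exact h2.hasDerivAt (Icc_mem_nhds hu.1 hu.2)

end Primitive

end C11

/-! ### The Jacobian and the Knothe map. -/

theorem det_eq_entries (L : ℝ × ℝ →L[ℝ] ℝ × ℝ) :
    L.det = (L (1, 0)).1 * (L (0, 1)).2 - (L (0, 1)).1 * (L (1, 0)).2 := by
  rw [ContinuousLinearMap.det, ← LinearMap.det_toMatrix (Module.Basis.finTwoProd ℝ),
    Matrix.det_fin_two]
  simp [LinearMap.toMatrix_apply]

/-- The partial derivative `∂Q/∂q` of `f = (Q, P)` on the strip. -/
def dqQ (f : ℝ × ℝ → ℝ × ℝ) (x : ℝ × ℝ) : ℝ := (sD f x (1, 0)).1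

/-- The partial derivative `∂Q/∂p` of `f = (Q, P)` on the strip. -/
def dpQ (f : ℝ × ℝ → ℝ × ℝ) (x : ℝ × ℝ) : ℝ := (sD f x (0, 1)).1

/-- The partial derivative `∂P/∂q` of `f = (Q, P)` on the strip. -/
def dqP (f : ℝ × ℝ → ℝ × ℝ) (x : ℝ × ℝ) : ℝ := (sD f x (1, 0)).2

/-- The partial derivative `∂P/∂p` of `f = (Q, P)` on the strip. -/
def dpP (f : ℝ × ℝ → ℝ × ℝ) (x : ℝ × ℝ) : ℝ := (sD f x (0, 1)).2

/-- The Jacobian determinant of `f`. -/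
def jac (f : ℝ × ℝ → ℝ × ℝ) (x : ℝ × ℝ) : ℝ := dqQ f x * dpP f x - dpQ f x * dqP f x

theorem det_sD (f : ℝ × ℝ → ℝ × ℝ) (x : ℝ × ℝ) : (sD f x).det = jac f x := det_eq_entries _

/-- Half the area, relative to the identity, swept by `f` to the left of a vertical line. -/
def columnShift (f : ℝ × ℝ → ℝ × ℝ) (x : ℝ × ℝ) : ℝ :=
  1 / 2 * (((f (x.1, 1)).1 - x.1) + ((f (x.1, -1)).1 - x.1) -
    primitive (fun y => (f y).2 * dpQ f y) (x.1, 1))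

/-- The normalized rearrangement of the density `jac f` on a vertical line. -/
def fibre (f : ℝ × ℝ → ℝ × ℝ) (x : ℝ × ℝ) : ℝ :=
  2 * (primitive (jac f) x * (primitive (jac f) (x.1, 1))⁻¹) + -1

/-- The triangular (Knothe) map that transports the density `jac f` to the uniform density. -/
def knothe (f : ℝ × ℝ → ℝ × ℝ) (x : ℝ × ℝ) : ℝ × ℝ := (x.1 + columnShift f x, fibre f x)

/-- A tame map whose displacement has two bounded derivatives with Lipschitz bounds, and whose
Jacobian is at least `κ`. -/
structure TameC2 (C κ : ℝ) (f : ℝ × ℝ → ℝ × ℝ) : Prop where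
  tame : Tame C f
  c11_Q : C11 C fun x => (f x).1 - x.1
  c11_P : C11 C fun x => (f x).2
  c11_dqQ : C11 C (dqQ f)
  c11_dpQ : C11 C (dpQ f)
  c11_dqP : C11 C (dqP f)
  c11_dpP : C11 C (dpP f)
  symm : ∀ x ∈ strip, sD (dqQ f) x (0, 1) = sD (dpQ f) x (1, 0)
  le_jac : ∀ x ∈ strip, κ ≤ jac f x

theorem norm_one_zero_le : ‖((1 : ℝ), (0 : ℝ))‖ ≤ 1 := by simp [Prod.norm_def]

theorem norm_zero_one_le : ‖((0 : ℝ), (1 : ℝ))‖ ≤ 1 := by simp [Prod.norm_def]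

theorem neg_one_mem : (-1 : ℝ) ∈ Icc (-1 : ℝ) 1 := by norm_num

theorem one_mem : (1 : ℝ) ∈ Icc (-1 : ℝ) 1 := by norm_num

namespace TameC2

variable {C κ : ℝ} {f : ℝ × ℝ → ℝ × ℝ}

theorem c11_jac (hf : TameC2 C κ f) : C11 (8 * C ^ 2) (jac f) :=
  ((hf.c11_dqQ.mul hf.c11_dpP).sub (hf.c11_dpQ.mul hf.c11_dqP)).mono (by linarith)

theorem c11_columnShift (hf : TameC2 C κ f) : C11 (C + 8 * C ^ 2) (columnShift f) := by
  have h1 := hf.c11_Q.comp_fst one_mem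
  have h2 := hf.c11_Q.comp_fst neg_one_mem
  have h3 := (hf.c11_P.mul hf.c11_dpQ).primitive.comp_fst one_mem
  refine ((((h1.add h2).sub h3).const_mul (1 / 2)).mono ?_)
  rw [abs_of_pos (by norm_num)]
  linarith

theorem hasFDerivWithinAt_fst (hf : TameC2 C κ f) {x : ℝ × ℝ} (hx : x ∈ strip) :
    HasFDerivWithinAt (fun x => (f x).1 - x.1)
      ((ContinuousLinearMap.fst ℝ ℝ ℝ).comp (sD f x) - ContinuousLinearMap.fst ℝ ℝ ℝ) strip x :=
  ((hf.tame.hasFDerivWithinAt hx).fst).sub _root_.hasFDerivWithinAt_fst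

theorem sD_fst (hf : TameC2 C κ f) {x : ℝ × ℝ} (hx : x ∈ strip) :
    sD (fun x => (f x).1 - x.1) x (1, 0) = dqQ f x - 1 := by
  rw [sD, (hf.hasFDerivWithinAt_fst hx).fderivWithin (uniqueDiffOn_strip x hx)]
  rfl

theorem sD_snd (hf : TameC2 C κ f) {x : ℝ × ℝ} (hx : x ∈ strip) :
    sD (fun x => (f x).2) x = (ContinuousLinearMap.snd ℝ ℝ ℝ).comp (sD f x) :=
  ((hf.tame.hasFDerivWithinAt hx).snd).fderivWithin (uniqueDiffOn_strip x hx)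

/-- Stokes' formula on a vertical line. -/
theorem stokes (hf : TameC2 C κ f) (q : ℝ) :
    primitive (fun y => sD (fun y => (f y).2 * dpQ f y) y (1, 0)) (q, 1) =
      dqQ f (q, 1) + dqQ f (q, -1) - primitive (jac f) (q, 1) := by
  have hb := hf.c11_P.mul hf.c11_dpQ
  have ha := hf.c11_P.mul hf.c11_dqQ
  have h1 := ha.integral_sD_vertical q
  -- By symmetry of second derivatives, ∂_q(P ∂_pQ) = ∂_p(P ∂_qQ) − jac. The first term integrates
  -- to boundary values, where P = ±1.
  have h2 : primitive (fun y => sD (fun y => (f y).2 * dpQ f y) y (1, 0)) (q, 1) =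
      ∫ u in (-1 : ℝ)..1, (sD (fun y => (f y).2 * dqQ f y) (q, u) (0, 1) - jac f (q, u)) := by
    refine intervalIntegral.integral_congr fun u hu => ?_
    rw [uIcc_of_le (by norm_num)] at hu
    have hx := mk_mem_strip (q := q) hu
    simp only []
    rw [hf.c11_P.sD_mul hf.c11_dpQ hx, hf.c11_P.sD_mul hf.c11_dqQ hx, hf.sD_snd hx]
    change (f (q, u)).2 * sD (dpQ f) (q, u) (1, 0) + dpQ f (q, u) * (sD f (q, u) (1, 0)).2 =
      (f (q, u)).2 * sD (dqQ f) (q, u) (0, 1) + dqQ f (q, u) * (sD f (q, u) (0, 1)).2 - jac f (q, u)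
    rw [hf.symm _ hx]
    simp only [jac, dqP, dpP]
    ring
  rw [h2, intervalIntegral.integral_sub
    (intervalIntegrable_vertical (ha.continuousOn_sD_apply (0, 1)) q neg_one_mem one_mem)
    (intervalIntegrable_vertical hf.c11_jac.diff.continuousOn q neg_one_mem one_mem), h1,
    hf.tame.top, hf.tame.bot]
  simp only [primitive]
  ring

/-- In the derivative of `columnShift` the boundary terms cancel against Stokes' formula. Thus q ↦ q
+ columnShift has derivative half the mass of the vertical line through q, so it carries the
marginal of the density to twice Lebesgue measure on the line. -/
theorem sD_columnShift (hf : TameC2 C κ f) {x : ℝ × ℝ} (hx : x ∈ strip) (v : ℝ × ℝ) :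
    sD (columnShift f) x v = (primitive (jac f) (x.1, 1) / 2 - 1) * v.1 := by
  have h3 := (hf.c11_P.mul hf.c11_dpQ).primitive
  have h := (((hf.c11_Q.hasFDerivWithinAt_comp_fst one_mem x).add
    (hf.c11_Q.hasFDerivWithinAt_comp_fst neg_one_mem x)).sub
    (h3.hasFDerivWithinAt_comp_fst one_mem x)).const_mul (1 / 2)
  have h' : sD (columnShift f) x = _ := h.fderivWithin (uniqueDiffOn_strip x hx)
  rw [h', (hf.c11_P.mul hf.c11_dpQ).sD_primitive (top_mem_strip _), hf.sD_fst (top_mem_strip _),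
    hf.sD_fst (bot_mem_strip _), hf.stokes]
  simp only [smul_apply, add_apply, sub_apply, ContinuousLinearMap.coe_fst',
    ContinuousLinearMap.coe_snd', smul_eq_mul]
  ring

theorem integral_jac_ge (hf : TameC2 C κ f) (q : ℝ) {a b : ℝ} (ha : a ∈ Icc (-1 : ℝ) 1)
    (hb : b ∈ Icc (-1 : ℝ) 1) (hab : a ≤ b) :
    κ * (b - a) ≤ primitive (jac f) (q, b) - primitive (jac f) (q, a) := by
  have hI := fun {a b : ℝ} =>
    @intervalIntegrable_vertical (jac f) hf.c11_jac.diff.continuousOn q a b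
  have h1 := intervalIntegral.integral_add_adjacent_intervals
    (hI neg_one_mem ha) (hI ha hb)
  have h2 : ∫ _ in a..b, κ ≤ ∫ u in a..b, jac f (q, u) :=
    intervalIntegral.integral_mono_on hab (by simp) (hI ha hb) fun u hu =>
      hf.le_jac _ (mk_mem_strip ⟨ha.1.trans hu.1, hu.2.trans hb.2⟩)
  rw [intervalIntegral.integral_const, smul_eq_mul] at h2
  simp only [primitive, ← h1]
  linarith

theorem primitive_bot (g : ℝ × ℝ → ℝ) (q : ℝ) : primitive g (q, -1) = 0 := by
  simp [primitive]

theorem le_column (hf : TameC2 C κ f) (q : ℝ) : 2 * κ ≤ primitive (jac f) (q, 1) := by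
  have := hf.integral_jac_ge q neg_one_mem one_mem (by norm_num)
  rw [primitive_bot] at this
  linarith

theorem column_le (hf : TameC2 C κ f) (q : ℝ) : primitive (jac f) (q, 1) ≤ 32 * C ^ 2 :=
  (le_abs_self _).trans ((hf.c11_jac.primitive.bdd _ (top_mem_strip q)).trans_eq (by ring))

/-- A bound for the rearrangement `fibre f`. -/
def fibreBound (C κ : ℝ) : ℝ :=
  2 * (4 * (32 * C ^ 2 * (1 / (2 * κ) + 32 * C ^ 2 / (2 * κ) ^ 2 +
    2 * (32 * C ^ 2) ^ 2 / (2 * κ) ^ 3))) + 1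

section Pos

variable (hκ : 0 < κ) (hf : TameC2 C κ f)
include hκ hf

theorem column_pos (q : ℝ) : 0 < primitive (jac f) (q, 1) := by
  linarith [hf.le_column q]

theorem c11_column_inv : C11 (1 / (2 * κ) + 32 * C ^ 2 / (2 * κ) ^ 2 +
    2 * (32 * C ^ 2) ^ 2 / (2 * κ) ^ 3) (fun x => (primitive (jac f) (x.1, 1))⁻¹) := by
  have h := hf.c11_jac.primitive.comp_fst one_mem
  have h' : C11 (32 * C ^ 2) (fun x => primitive (jac f) (x.1, 1)) := h.mono (by linarith)
  exact h'.inv (by positivity) fun x _ => hf.le_column x.1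

theorem c11_fibre : C11 (fibreBound C κ) (fibre f) := by
  have h1 : C11 (32 * C ^ 2) (primitive (jac f)) := hf.c11_jac.primitive.mono (by linarith)
  refine (((h1.mul (hf.c11_column_inv hκ)).const_mul 2).add (C11.const (-1))).mono ?_
  rw [abs_of_pos two_pos, abs_neg, abs_one, fibreBound]

theorem sD_fibre {x : ℝ × ℝ} (hx : x ∈ strip) :
    sD (fibre f) x (0, 1) = 2 * jac f x / primitive (jac f) (x.1, 1) := by
  have h1 := hf.c11_jac.primitive
  have h2 := hf.c11_column_inv hκ
  have h := (((h1.hasFDerivWithinAt hx).mul (h2.hasFDerivWithinAt hx)).const_mul 2).add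
    (hasFDerivWithinAt_const (-1 : ℝ) x strip)
  have h' : sD (fibre f) x = _ := h.fderivWithin (uniqueDiffOn_strip x hx)
  -- The mass of a vertical line does not depend on the height.
  have h3 : sD (fun x => (primitive (jac f) (x.1, 1))⁻¹) x (0, 1) = 0 := by
    have hx1 := h1.hasFDerivWithinAt_comp_fst one_mem x
    have := ((hasDerivAt_inv (hf.column_pos hκ x.1).ne').comp_hasFDerivWithinAt x hx1).fderivWithin
      (uniqueDiffOn_strip x hx)
    have h'' : sD (fun x => (primitive (jac f) (x.1, 1))⁻¹) x = _ := this
    rw [h'']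
    simp only [smul_apply, ContinuousLinearMap.coe_fst', smul_zero]
  rw [h', hf.c11_jac.sD_primitive hx]
  simp only [smul_apply, add_apply, ContinuousLinearMap.coe_fst', zero_apply,
    ContinuousLinearMap.coe_snd', smul_eq_mul, h3]
  field_simp
  ring

theorem fibre_top (q : ℝ) : fibre f (q, 1) = 1 := by
  have := (hf.column_pos hκ q).ne'
  simp only [fibre]
  field_simp
  norm_num

omit hκ hf in
theorem fibre_bot (q : ℝ) : fibre f (q, -1) = -1 := by
  simp [fibre, primitive_bot]

theorem fibre_sub_ge (q : ℝ) {a b : ℝ} (ha : a ∈ Icc (-1 : ℝ) 1)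
    (hb : b ∈ Icc (-1 : ℝ) 1) (hab : a ≤ b) :
    κ / (16 * C ^ 2) * (b - a) ≤ fibre f (q, b) - fibre f (q, a) := by
  have h1 := hf.integral_jac_ge q ha hb hab
  have h2 := hf.column_pos hκ q
  have h3 := hf.column_le q
  have h4 : fibre f (q, b) - fibre f (q, a) =
      2 * (primitive (jac f) (q, b) - primitive (jac f) (q, a)) / primitive (jac f) (q, 1) := by
    simp only [fibre]
    ring
  rw [h4]
  calc κ / (16 * C ^ 2) * (b - a) = 2 * (κ * (b - a)) / (32 * C ^ 2) := by ring
    _ ≤ 2 * (κ * (b - a)) / primitive (jac f) (q, 1) := by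
      have : 0 ≤ 2 * (κ * (b - a)) := by have := sub_nonneg.2 hab; positivity
      gcongr
    _ ≤ _ := by gcongr

theorem C_pos : 0 < C := by
  rcases hf.tame.nonneg.eq_or_lt with h | h
  · have h1 := hf.column_le 0
    have h2 := hf.column_pos hκ 0
    rw [← h] at h1
    norm_num at h1
    linarith
  · exact h

theorem fibre_mem {x : ℝ × ℝ} (hx : x ∈ strip) : fibre f x ∈ Icc (-1 : ℝ) 1 := by
  have hx2 := mem_strip.1 hx
  have hC := hf.C_pos hκ
  have h1 := hf.fibre_sub_ge hκ x.1 neg_one_mem hx2 hx2.1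
  have h2 := hf.fibre_sub_ge hκ x.1 hx2 one_mem hx2.2
  rw [fibre_bot] at h1
  rw [hf.fibre_top hκ] at h2
  have hp : 0 ≤ κ / (16 * C ^ 2) := by positivity
  have h3 := mul_nonneg hp (sub_nonneg.2 hx2.1)
  have h4 := mul_nonneg hp (sub_nonneg.2 hx2.2)
  constructor <;> linarith

theorem hasFDerivWithinAt_knothe {x : ℝ × ℝ} (hx : x ∈ strip) :
    HasFDerivWithinAt (knothe f)
      ((ContinuousLinearMap.fst ℝ ℝ ℝ + sD (columnShift f) x).prod (sD (fibre f) x)) strip x :=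
  (_root_.hasFDerivWithinAt_fst.add (hf.c11_columnShift.hasFDerivWithinAt hx)).prodMk
    ((hf.c11_fibre hκ).hasFDerivWithinAt hx)

theorem sD_knothe {x : ℝ × ℝ} (hx : x ∈ strip) : sD (knothe f) x =
    (ContinuousLinearMap.fst ℝ ℝ ℝ + sD (columnShift f) x).prod (sD (fibre f) x) :=
  (hf.hasFDerivWithinAt_knothe hκ hx).fderivWithin (uniqueDiffOn_strip x hx)

theorem dqQ_knothe {x : ℝ × ℝ} (hx : x ∈ strip) :
    dqQ (knothe f) x = primitive (jac f) (x.1, 1) / 2 := by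
  rw [dqQ, hf.sD_knothe hκ hx]
  change 1 + sD (columnShift f) x (1, 0) = _
  rw [hf.sD_columnShift hx]
  ring

/-- The differential is triangular. With R the mass of the vertical line, its diagonal entries are
R/2 and 2 jac/R. -/
theorem jac_knothe {x : ℝ × ℝ} (hx : x ∈ strip) : jac (knothe f) x = jac f x := by
  have h := (hf.column_pos hκ x.1).ne'
  have h1 : dpP (knothe f) x = 2 * jac f x / primitive (jac f) (x.1, 1) := by
    rw [dpP, hf.sD_knothe hκ hx]
    exact hf.sD_fibre hκ hx
  have h2 : dpQ (knothe f) x = 0 := by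
    rw [dpQ, hf.sD_knothe hκ hx]
    change 0 + sD (columnShift f) x (0, 1) = _
    rw [hf.sD_columnShift hx]
    ring
  rw [jac, h1, h2, hf.dqQ_knothe hκ hx]
  field_simp
  ring

omit hκ in
theorem columnShift_sub_ge {a b : ℝ} (hab : a ≤ b) :
    κ * (b - a) ≤ (b + columnShift f (b, 0)) - (a + columnShift f (a, 0)) := by
  have hd : ∀ q, HasDerivAt (fun q => q + columnShift f (q, 0))
      (primitive (jac f) (q, 1) / 2) q := by
    intro q
    have hx : ((q, 0) : ℝ × ℝ) ∈ strip := mk_mem_strip (by norm_num)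
    have h1 := (hf.c11_columnShift.hasFDerivWithinAt hx).comp_hasDerivWithinAt (s := univ) q
      ((hasDerivAt_id q).prodMk (hasDerivAt_const q (0 : ℝ))).hasDerivWithinAt
      (fun u _ => mk_mem_strip (by norm_num))
    rw [hasDerivWithinAt_univ] at h1
    refine ((hasDerivAt_id q).add h1).congr_deriv ?_
    rw [hf.sD_columnShift hx]
    ring
  refine Convex.mul_sub_le_image_sub_of_le_deriv convex_univ
    (fun q _ => (hd q).continuousAt.continuousWithinAt)
    (fun q _ => (hd q).differentiableAt.differentiableWithinAt) (fun q _ => ?_) a (mem_univ a) b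
    (mem_univ b) hab
  rw [(hd q).deriv]
  linarith [hf.le_column q]

end Pos

/-- The constant with which `knothe f` is tame. -/
def knotheBound (C κ : ℝ) : ℝ :=
  3 + (C + 8 * C ^ 2) + fibreBound C κ + 1 / κ +
    (1 + fibreBound C κ * (1 / κ)) * (16 * C ^ 2 / κ)

variable (hκ : 0 < κ) (hf : TameC2 C κ f)
include hκ hf

theorem abs_fst_sub_le (x y : ℝ × ℝ) :
    |x.1 - y.1| ≤ 1 / κ * ‖knothe f x - knothe f y‖ := by
  have h1 : |(knothe f x).1 - (knothe f y).1| ≤ ‖knothe f x - knothe f y‖ :=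
    norm_fst_le (knothe f x - knothe f y)
  have h2 : κ * |x.1 - y.1| ≤ |(knothe f x).1 - (knothe f y).1| := by
    rcases le_total x.1 y.1 with h | h
    · have := hf.columnShift_sub_ge h
      rw [abs_sub_comm, abs_of_nonneg (sub_nonneg.2 h), abs_sub_comm]
      exact this.trans (le_abs_self _)
    · have := hf.columnShift_sub_ge h
      rw [abs_of_nonneg (sub_nonneg.2 h)]
      exact this.trans (le_abs_self _)
  rw [one_div, ← div_eq_inv_mul, le_div_iff₀ hκ]
  linarith

/-- Comparison through the intermediate point `(x.1, y.2)`: the lower bound for the vertical slope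
of `fibre f` controls the vertical displacement, and its Lipschitz bound together with the
horizontal estimate controls the rest. -/
theorem abs_snd_sub_le {x y : ℝ × ℝ} (hx : x ∈ strip) (hy : y ∈ strip) :
    |x.2 - y.2| ≤
      (1 + fibreBound C κ * (1 / κ)) * (16 * C ^ 2 / κ) * ‖knothe f x - knothe f y‖ := by
  have hC := hf.C_pos hκ
  have hx2 := mem_strip.1 hx
  have hy2 := mem_strip.1 hy
  have h1 : |(knothe f x).2 - (knothe f y).2| ≤ ‖knothe f x - knothe f y‖ :=
    norm_snd_le (knothe f x - knothe f y)
  have h2 : κ / (16 * C ^ 2) * |x.2 - y.2| ≤ |fibre f x - fibre f (x.1, y.2)| := by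
    rcases le_total x.2 y.2 with h | h
    · have := hf.fibre_sub_ge hκ x.1 hx2 hy2 h
      rw [abs_sub_comm, abs_of_nonneg (sub_nonneg.2 h), abs_sub_comm]
      exact this.trans (le_abs_self _)
    · have := hf.fibre_sub_ge hκ x.1 hy2 hx2 h
      rw [abs_of_nonneg (sub_nonneg.2 h)]
      exact this.trans (le_abs_self _)
  have h3 : |fibre f (x.1, y.2) - fibre f y| ≤ fibreBound C κ * |x.1 - y.1| := by
    refine ((hf.c11_fibre hκ).abs_sub_le (mk_mem_strip hy2) hy).trans_eq ?_
    congr 1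
    simp [Prod.norm_def]
  have h4 := abs_sub_le (fibre f x) (fibre f y) (fibre f (x.1, y.2))
  rw [abs_sub_comm (fibre f y)] at h4
  have h5 := mul_le_mul_of_nonneg_left (hf.abs_fst_sub_le hκ x y) (hf.c11_fibre hκ).nonneg
  have h6 : κ / (16 * C ^ 2) * |x.2 - y.2| ≤
      (1 + fibreBound C κ * (1 / κ)) * ‖knothe f x - knothe f y‖ := by
    change |fibre f x - fibre f y| ≤ _ at h1
    linarith
  calc |x.2 - y.2| = 16 * C ^ 2 / κ * (κ / (16 * C ^ 2) * |x.2 - y.2|) := by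
        field_simp
    _ ≤ 16 * C ^ 2 / κ * ((1 + fibreBound C κ * (1 / κ)) * ‖knothe f x - knothe f y‖) := by
        gcongr
    _ = _ := by ring

/-- A triangular system: the first coordinate is solved for q alone, then the second for p by the
intermediate value theorem. -/
theorem surjOn_knothe : SurjOn (knothe f) strip strip := by
  intro z hz
  have hc1 : Continuous fun q => q + columnShift f (q, 0) :=
    continuous_id.add (hf.c11_columnShift.diff.continuousOn.comp_continuous
      (by fun_prop) fun q => mk_mem_strip (by norm_num))
  have hb : ∀ q, |columnShift f (q, 0)| ≤ C + 8 * C ^ 2 := fun q =>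
    hf.c11_columnShift.bdd _ (mk_mem_strip (by norm_num))
  have h1 : Tendsto (fun q => q + columnShift f (q, 0)) atTop atTop :=
    tendsto_atTop_add_right_of_le _ _ tendsto_id fun q => (abs_le.1 (hb q)).1
  have h2 : Tendsto (fun q => q + columnShift f (q, 0)) atBot atBot :=
    tendsto_atBot_add_right_of_ge _ _ tendsto_id fun q => (abs_le.1 (hb q)).2
  obtain ⟨q, hq⟩ := hc1.surjective h1 h2 z.1
  have hc2 : ContinuousOn (fun u => fibre f (q, u)) (Icc (-1) 1) :=
    (hf.c11_fibre hκ).diff.continuousOn.comp (by fun_prop) fun u hu => mk_mem_strip hu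
  have h3 := intermediate_value_Icc (by norm_num : (-1 : ℝ) ≤ 1) hc2
  simp only [fibre_bot, hf.fibre_top hκ] at h3
  obtain ⟨p, hp, hpz⟩ := h3 (mem_strip.1 hz)
  -- The shift ignores the height, so `hq`, found at height 0, also holds at height `p`.
  exact ⟨(q, p), mk_mem_strip hp, Prod.ext hq hpz⟩

theorem tame_knothe : Tame (knotheBound C κ) (knothe f) := by
  have hC := hf.C_pos hκ
  have hB := (hf.c11_fibre hκ).nonneg
  have hS := hf.c11_columnShift.nonneg
  have hK1 : 0 ≤ 1 / κ := by positivity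
  have hK2 : 0 ≤ (1 + fibreBound C κ * (1 / κ)) * (16 * C ^ 2 / κ) := by positivity
  have hanti : ∀ x ∈ strip, ∀ y ∈ strip,
      ‖x - y‖ ≤ knotheBound C κ * ‖knothe f x - knothe f y‖ := fun x hx y hy => by
    refine (Prod.norm_def _).trans_le (max_le ?_ ?_)
    · refine (hf.abs_fst_sub_le hκ x y).trans ?_
      exact mul_le_mul_of_nonneg_right (by rw [knotheBound]; linarith) (norm_nonneg _)
    · refine (hf.abs_snd_sub_le hκ hx hy).trans ?_
      exact mul_le_mul_of_nonneg_right (by rw [knotheBound]; linarith) (norm_nonneg _)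
  refine ⟨⟨fun x hx => mem_strip.2 (hf.fibre_mem hκ hx), fun x hx y hy h => ?_,
    hf.surjOn_knothe hκ⟩, fun q => hf.fibre_top hκ q, fun q => fibre_bot q,
    fun x hx => (hf.hasFDerivWithinAt_knothe hκ hx).differentiableWithinAt, fun x hx => ?_,
    fun x hx y hy => ?_, hanti, fun x hx => ?_⟩
  · have := hanti x hx y hy
    rw [h, sub_self, norm_zero, mul_zero] at this
    exact sub_eq_zero.1 (norm_le_zero_iff.1 this)
  · rw [hf.sD_knothe hκ hx]
    refine ContinuousLinearMap.opNorm_le_bound _ (by rw [knotheBound]; linarith) fun v => ?_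
    refine (Prod.norm_def _).trans_le (max_le ?_ ?_)
    · calc ‖v.1 + sD (columnShift f) x v‖ ≤ ‖v.1‖ + ‖sD (columnShift f) x v‖ := norm_add_le _ _
        _ ≤ ‖v‖ + (C + 8 * C ^ 2) * ‖v‖ := add_le_add (norm_fst_le v)
          ((sD (columnShift f) x).le_of_opNorm_le (hf.c11_columnShift.dbdd x hx) v)
        _ = (1 + (C + 8 * C ^ 2)) * ‖v‖ := by ring
        _ ≤ _ := mul_le_mul_of_nonneg_right (by rw [knotheBound]; linarith) (norm_nonneg _)
    · refine ((sD (fibre f) x).le_of_opNorm_le ((hf.c11_fibre hκ).dbdd x hx) v).trans ?_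
      exact mul_le_mul_of_nonneg_right (by rw [knotheBound]; linarith) (norm_nonneg _)
  · rw [hf.sD_knothe hκ hx, hf.sD_knothe hκ hy]
    have key : (ContinuousLinearMap.fst ℝ ℝ ℝ + sD (columnShift f) x).prod (sD (fibre f) x) -
        (ContinuousLinearMap.fst ℝ ℝ ℝ + sD (columnShift f) y).prod (sD (fibre f) y) =
        (sD (columnShift f) x - sD (columnShift f) y).prod (sD (fibre f) x - sD (fibre f) y) := by
      ext <;> simp
    rw [key, ContinuousLinearMap.opNorm_prod]
    refine (Prod.norm_def _).trans_le (max_le ?_ ?_)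
    · refine (hf.c11_columnShift.dlip x hx y hy).trans ?_
      exact mul_le_mul_of_nonneg_right (by rw [knotheBound]; linarith) (norm_nonneg _)
    · refine ((hf.c11_fibre hκ).dlip x hx y hy).trans ?_
      exact mul_le_mul_of_nonneg_right (by rw [knotheBound]; linarith) (norm_nonneg _)
  · refine (Prod.norm_def _).trans_le (max_le ?_ ?_)
    · have := hf.c11_columnShift.bdd x hx
      have e : (knothe f x - x).1 = columnShift f x := by simp [knothe]
      rw [e, Real.norm_eq_abs, knotheBound]
      linarith
    · have h1 := hf.fibre_mem hκ hx
      have h2 := mem_strip.1 hx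
      have e : (knothe f x - x).2 = fibre f x - x.2 := rfl
      rw [e, Real.norm_eq_abs, knotheBound]
      have : |fibre f x - x.2| ≤ 2 := by
        rw [abs_le]; constructor <;> linarith [h1.1, h1.2, h2.1, h2.2]
      linarith

/-- `knothe` is Lipschitz from the `C¹` norm to the `C⁰` norm. -/
theorem norm_knothe_sub_le {g : ℝ × ℝ → ℝ × ℝ} (hg : TameC2 C κ g) {ε : ℝ}
    (h0 : ∀ x ∈ strip, ‖f x - g x‖ ≤ ε) (h1 : ∀ x ∈ strip, ‖sD f x - sD g x‖ ≤ ε)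
    {x : ℝ × ℝ} (hx : x ∈ strip) :
    ‖knothe f x - knothe g x‖ ≤ (1 + 2 * C + 16 * C / κ) * ε := by
  have hC := hf.C_pos hκ
  have hε : 0 ≤ ε := (norm_nonneg _).trans (h0 x hx)
  have happ : ∀ x ∈ strip, ∀ v : ℝ × ℝ, ‖v‖ ≤ 1 → ‖sD f x v - sD g x v‖ ≤ ε :=
    fun x hx v hv => calc
      ‖sD f x v - sD g x v‖ ≤ ‖sD f x - sD g x‖ * ‖v‖ := (sD f x - sD g x).le_opNorm v
      _ ≤ ε * 1 := mul_le_mul (h1 x hx) hv (norm_nonneg _) hε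
      _ = ε := mul_one ε
  have hfst : ∀ x ∈ strip, |(f x).1 - (g x).1| ≤ ε := fun x hx =>
    (norm_fst_le (f x - g x)).trans (h0 x hx)
  have hsnd : ∀ x ∈ strip, |(f x).2 - (g x).2| ≤ ε := fun x hx =>
    (norm_snd_le (f x - g x)).trans (h0 x hx)
  have hmulsub : ∀ {a b a' b' : ℝ}, |a| ≤ C → |b'| ≤ C → |a - a'| ≤ ε → |b - b'| ≤ ε →
      |a * b - a' * b'| ≤ 2 * C * ε := by
    intro a b a' b' ha hb' haa hbb
    have e : a * b - a' * b' = a * (b - b') + (a - a') * b' := by ring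
    rw [e]
    refine (abs_add_le _ _).trans ?_
    rw [abs_mul, abs_mul]
    have e1 := mul_le_mul ha hbb (abs_nonneg _) hC.le
    have e2 := mul_le_mul haa hb' (abs_nonneg _) hε
    linarith
  have ha : ∀ x ∈ strip, |dqQ f x - dqQ g x| ≤ ε := fun x hx =>
    (norm_fst_le (sD f x (1, 0) - sD g x (1, 0))).trans (happ x hx _ norm_one_zero_le)
  have hb : ∀ x ∈ strip, |dpQ f x - dpQ g x| ≤ ε := fun x hx =>
    (norm_fst_le (sD f x (0, 1) - sD g x (0, 1))).trans (happ x hx _ norm_zero_one_le)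
  have hc : ∀ x ∈ strip, |dqP f x - dqP g x| ≤ ε := fun x hx =>
    (norm_snd_le (sD f x (1, 0) - sD g x (1, 0))).trans (happ x hx _ norm_one_zero_le)
  have hd : ∀ x ∈ strip, |dpP f x - dpP g x| ≤ ε := fun x hx =>
    (norm_snd_le (sD f x (0, 1) - sD g x (0, 1))).trans (happ x hx _ norm_zero_one_le)
  have hjac : ∀ x ∈ strip, |jac f x - jac g x| ≤ 4 * C * ε := fun x hx => by
    have e1 := hmulsub (hf.c11_dqQ.bdd x hx) (hg.c11_dpP.bdd x hx) (ha x hx) (hd x hx)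
    have e2 := hmulsub (hf.c11_dpQ.bdd x hx) (hg.c11_dqP.bdd x hx) (hb x hx) (hc x hx)
    have e : jac f x - jac g x = (dqQ f x * dpP f x - dqQ g x * dpP g x) -
        (dpQ f x * dqP f x - dpQ g x * dqP g x) := by simp only [jac]; ring
    rw [e]
    refine (abs_sub _ _).trans ?_
    linarith
  have hprim : ∀ {h k : ℝ × ℝ → ℝ} {K : ℝ}, ContinuousOn h strip → ContinuousOn k strip →
      (∀ x ∈ strip, |h x - k x| ≤ K) → ∀ x ∈ strip, |primitive h x - primitive k x| ≤ K * 2 := by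
    intro h k K hh hk hK x hx
    have hK0 : 0 ≤ K := (abs_nonneg _).trans (hK x hx)
    have hx2 := mem_strip.1 hx
    rw [primitive, primitive, ← intervalIntegral.integral_sub
      (intervalIntegrable_vertical hh _ neg_one_mem hx2)
      (intervalIntegrable_vertical hk _ neg_one_mem hx2)]
    refine (vertical_integral_le neg_one_mem hx2 fun u hu => hK _ (mk_mem_strip hu)).trans ?_
    refine mul_le_mul_of_nonneg_left ?_ hK0
    rw [abs_le]; constructor <;> linarith [hx2.1, hx2.2]
  have hR := hprim hf.c11_jac.diff.continuousOn hg.c11_jac.diff.continuousOn hjac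
  have hN := hprim (hf.c11_P.mul hf.c11_dpQ).diff.continuousOn
    (hg.c11_P.mul hg.c11_dpQ).diff.continuousOn
    (fun x hx => hmulsub (hf.c11_P.bdd x hx) (hg.c11_dpQ.bdd x hx) (hsnd x hx) (hb x hx))
  refine (Prod.norm_def _).trans_le (max_le ?_ ?_)
  · have e : (knothe f x - knothe g x).1 = 1 / 2 * (((f (x.1, 1)).1 - (g (x.1, 1)).1) +
        ((f (x.1, -1)).1 - (g (x.1, -1)).1) - (primitive (fun y => (f y).2 * dpQ f y) (x.1, 1) -
          primitive (fun y => (g y).2 * dpQ g y) (x.1, 1))) := by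
      simp only [knothe, columnShift, Prod.fst_sub]
      ring
    have e1 := abs_le.1 (hfst _ (top_mem_strip x.1))
    have e2 := abs_le.1 (hfst _ (bot_mem_strip x.1))
    have e3 := abs_le.1 (hN _ (top_mem_strip x.1))
    have hp : 0 ≤ 16 * C / κ * ε := by positivity
    rw [e, Real.norm_eq_abs, abs_le]
    constructor <;> linarith [e1.1, e1.2, e2.1, e2.2, e3.1, e3.2]
  · have hS := hf.column_pos hκ x.1
    have hS' := hg.column_pos hκ x.1
    -- With A, B the primitives at `x` and S, T the masses of the line: A/S − B/T = (A − B)/S −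
    -- (B/T)(S − T)/S. Here B/T lies in [0, 1], so only the lower bound for S enters.
    have e : (knothe f x - knothe g x).2 =
        2 * ((primitive (jac f) x - primitive (jac g) x) * (primitive (jac f) (x.1, 1))⁻¹ -
        primitive (jac g) x * (primitive (jac g) (x.1, 1))⁻¹ *
        ((primitive (jac f) (x.1, 1) - primitive (jac g) (x.1, 1)) *
          (primitive (jac f) (x.1, 1))⁻¹)) := by
      simp only [knothe, fibre, Prod.snd_sub]
      field_simp
      ring
    have hinv : |(primitive (jac f) (x.1, 1))⁻¹| ≤ (2 * κ)⁻¹ := by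
      rw [abs_of_pos (inv_pos.2 hS)]
      exact inv_anti₀ (by positivity) (hf.le_column x.1)
    have hle : |primitive (jac g) x * (primitive (jac g) (x.1, 1))⁻¹| ≤ 1 := by
      have := hg.fibre_mem hκ hx
      simp only [fibre, mem_Icc] at this
      rw [abs_le]
      constructor <;> linarith [this.1, this.2]
    have e1 := mul_le_mul (hR x hx) hinv (abs_nonneg _) (by positivity)
    have e2 := mul_le_mul (hR _ (top_mem_strip x.1)) hinv (abs_nonneg _) (by positivity)
    rw [← abs_mul] at e1 e2
    have e3 := mul_le_mul hle e2 (abs_nonneg _) zero_le_one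
    rw [← abs_mul] at e3
    rw [e, Real.norm_eq_abs, abs_mul, abs_of_pos (two_pos : (0 : ℝ) < 2)]
    have e4 := abs_sub ((primitive (jac f) x - primitive (jac g) x) *
      (primitive (jac f) (x.1, 1))⁻¹) (primitive (jac g) x * (primitive (jac g) (x.1, 1))⁻¹ *
        ((primitive (jac f) (x.1, 1) - primitive (jac g) (x.1, 1)) *
          (primitive (jac f) (x.1, 1))⁻¹))
    have e5 : 4 * C * ε * 2 * (2 * κ)⁻¹ = 4 * C / κ * ε := by
      field_simp
    have hp : 0 ≤ (1 + 2 * C) * ε := by positivity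
    rw [e5] at e1 e3
    have e6 : 16 * C / κ * ε = 4 * (4 * C / κ * ε) := by ring
    linarith

end TameC2

/-! ### Determinant bounds and consequences of C³ bounds. -/

theorem abs_det_le (L : ℝ × ℝ →L[ℝ] ℝ × ℝ) : |L.det| ≤ 2 * ‖L‖ ^ 2 := by
  have h : ∀ v : ℝ × ℝ, ‖v‖ ≤ 1 → ‖L v‖ ≤ ‖L‖ := fun v hv =>
    (L.le_opNorm v).trans (mul_le_of_le_one_right (norm_nonneg _) hv)
  have h1 := (norm_fst_le (L (1, 0))).trans (h _ norm_one_zero_le)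
  have h2 := (norm_snd_le (L (1, 0))).trans (h _ norm_one_zero_le)
  have h3 := (norm_fst_le (L (0, 1))).trans (h _ norm_zero_one_le)
  have h4 := (norm_snd_le (L (0, 1))).trans (h _ norm_zero_one_le)
  rw [det_eq_entries]
  refine (abs_sub _ _).trans ?_
  rw [abs_mul, abs_mul]
  have e1 := mul_le_mul h1 h4 (norm_nonneg _) (norm_nonneg _)
  have e2 := mul_le_mul h3 h2 (norm_nonneg _) (norm_nonneg _)
  simp only [Real.norm_eq_abs] at e1 e2
  linarith

/-- The differential of the inverse has norm at most `C`, hence determinant at most `2 * C ^ 2`, and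
the two determinants have product one. -/
theorem Tame.one_le_mul_abs_jac {C : ℝ} {f : ℝ × ℝ → ℝ × ℝ} (hf : Tame C f) {x : ℝ × ℝ}
    (hx : x ∈ strip) : 1 ≤ 2 * C ^ 2 * |jac f x| := by
  obtain ⟨e, he, hs⟩ := hf.exists_equiv hx
  have h1 : (e.symm : ℝ × ℝ →L[ℝ] ℝ × ℝ).det * (e : ℝ × ℝ →L[ℝ] ℝ × ℝ).det = 1 := by
    simp [ContinuousLinearMap.det]
  rw [he, det_sD] at h1
  have h2 := abs_det_le (e.symm : ℝ × ℝ →L[ℝ] ℝ × ℝ)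
  calc 1 = |(e.symm : ℝ × ℝ →L[ℝ] ℝ × ℝ).det| * |jac f x| := by rw [← abs_mul, h1, abs_one]
    _ ≤ 2 * C ^ 2 * |jac f x| := by
      refine mul_le_mul_of_nonneg_right (h2.trans ?_) (abs_nonneg _)
      gcongr

section Bounded

variable {C : ℝ} {g : ℝ × ℝ → ℝ × ℝ} (hg : IsBoundedInC 3 C g)
include hg

theorem IsBoundedInC.contDiffOn_sD : ContDiffOn ℝ 2 (sD g) strip :=
  hg.1.fderivWithin uniqueDiffOn_strip (by norm_num)

theorem IsBoundedInC.contDiffOn_sD_sD : ContDiffOn ℝ 1 (sD (sD g)) strip :=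
  hg.contDiffOn_sD.fderivWithin uniqueDiffOn_strip (by norm_num)

theorem IsBoundedInC.norm_le {x : ℝ × ℝ} (hx : x ∈ strip) : ‖g x‖ ≤ C := by
  simpa using hg.2 0 (by norm_num) x hx

theorem IsBoundedInC.norm_sD_le {x : ℝ × ℝ} (hx : x ∈ strip) : ‖sD g x‖ ≤ C := by
  have := hg.2 1 (by norm_num) x hx
  rwa [norm_iteratedFDerivWithin_one _ (uniqueDiffOn_strip x hx)] at this

theorem IsBoundedInC.norm_sD_sD_le {x : ℝ × ℝ} (hx : x ∈ strip) : ‖sD (sD g) x‖ ≤ C := by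
  have := hg.2 2 (by norm_num) x hx
  rwa [← norm_iteratedFDerivWithin_fderivWithin uniqueDiffOn_strip hx,
    norm_iteratedFDerivWithin_one _ (uniqueDiffOn_strip x hx)] at this

theorem IsBoundedInC.norm_sD_sD_sD_le {x : ℝ × ℝ} (hx : x ∈ strip) :
    ‖sD (sD (sD g)) x‖ ≤ C := by
  have := hg.2 3 le_rfl x hx
  rwa [← norm_iteratedFDerivWithin_fderivWithin uniqueDiffOn_strip hx,
    ← norm_iteratedFDerivWithin_fderivWithin uniqueDiffOn_strip hx,
    norm_iteratedFDerivWithin_one _ (uniqueDiffOn_strip x hx)] at this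

theorem IsBoundedInC.differentiableOn : DifferentiableOn ℝ g strip :=
  hg.1.differentiableOn (by norm_num)

theorem IsBoundedInC.nonneg : 0 ≤ C := (norm_nonneg _).trans (hg.norm_le (top_mem_strip 0))

end Bounded

section Displacement

variable {C : ℝ} {f : ℝ × ℝ → ℝ × ℝ} (hf : IsBoundedInC 3 C fun x => f x - x)
include hf

theorem IsBoundedInC.hasFDerivWithinAt_displaced {x : ℝ × ℝ} (hx : x ∈ strip) :
    HasFDerivWithinAt f (sD (fun x => f x - x) x + ContinuousLinearMap.id ℝ (ℝ × ℝ)) strip x := by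
  have h := (hf.differentiableOn x hx).hasFDerivWithinAt.add (hasFDerivWithinAt_id x strip)
  refine h.congr_of_eventuallyEq (Eventually.of_forall fun y => ?_) ?_ <;> simp

theorem IsBoundedInC.sD_displaced {x : ℝ × ℝ} (hx : x ∈ strip) :
    sD f x = sD (fun x => f x - x) x + ContinuousLinearMap.id ℝ (ℝ × ℝ) :=
  (hf.hasFDerivWithinAt_displaced hx).fderivWithin (uniqueDiffOn_strip x hx)

theorem IsBoundedInC.norm_sD_displaced_le {x : ℝ × ℝ} (hx : x ∈ strip) : ‖sD f x‖ ≤ C + 1 := by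
  rw [hf.sD_displaced hx]
  exact (norm_add_le _ _).trans (add_le_add (hf.norm_sD_le hx) ContinuousLinearMap.norm_id_le)

theorem IsBoundedInC.sD_sD_displaced {x : ℝ × ℝ} (hx : x ∈ strip) :
    sD (sD f) x = sD (sD fun x => f x - x) x := by
  rw [sD_congr (fun y hy => hf.sD_displaced hy) hx, sD, fderivWithin_add_const]

theorem IsBoundedInC.hasFDerivWithinAt_sD_displaced {x : ℝ × ℝ} (hx : x ∈ strip) :
    HasFDerivWithinAt (sD f) (sD (sD f) x) strip x := by
  refine DifferentiableWithinAt.hasFDerivWithinAt ?_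
  refine ((hf.contDiffOn_sD.differentiableOn (by norm_num) x hx).add_const
    (ContinuousLinearMap.id ℝ (ℝ × ℝ))).congr (fun y hy => hf.sD_displaced hy) (hf.sD_displaced hx)

theorem IsBoundedInC.norm_sD_displaced_sub_le {x y : ℝ × ℝ} (hx : x ∈ strip) (hy : y ∈ strip) :
    ‖sD f x - sD f y‖ ≤ C * ‖x - y‖ := by
  rw [hf.sD_displaced hx, hf.sD_displaced hy, add_sub_add_right_eq_sub]
  exact norm_sub_le_of_fderivWithin (hf.contDiffOn_sD.differentiableOn (by norm_num))
    (fun z hz => hf.norm_sD_sD_le hz) hx hy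

/-- The place where three derivatives are needed: the entries of the differential must themselves be
C^{1,1}, so that the Jacobian and then the Knothe map are. -/
theorem IsBoundedInC.c11_clm {ℓ : (ℝ × ℝ →L[ℝ] ℝ × ℝ) →L[ℝ] ℝ} (hℓ : ‖ℓ‖ ≤ 1) :
    C11 (C + 1) (fun x => ℓ (sD f x)) ∧
      ∀ x ∈ strip, sD (fun x => ℓ (sD f x)) x = ℓ.comp (sD (sD f) x) := by
  have hC := hf.nonneg
  have h : ∀ x ∈ strip, HasFDerivWithinAt (fun x => ℓ (sD f x)) (ℓ.comp (sD (sD f) x)) strip x :=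
    fun x hx => ℓ.hasFDerivAt.comp_hasFDerivWithinAt x (hf.hasFDerivWithinAt_sD_displaced hx)
  refine ⟨C11.of_hasFDerivWithinAt h (fun x hx => ?_) (fun x hx => ?_) fun x hx y hy => ?_,
    fun x hx => (h x hx).fderivWithin (uniqueDiffOn_strip x hx)⟩
  · calc ‖ℓ (sD f x)‖ ≤ 1 * ‖sD f x‖ := ℓ.le_of_opNorm_le hℓ _
      _ ≤ C + 1 := by rw [one_mul]; exact hf.norm_sD_displaced_le hx
  · calc ‖ℓ.comp (sD (sD f) x)‖ ≤ ‖ℓ‖ * ‖sD (sD f) x‖ := ContinuousLinearMap.opNorm_comp_le _ _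
      _ ≤ 1 * C := by
        gcongr
        rw [hf.sD_sD_displaced hx]
        exact hf.norm_sD_sD_le hx
      _ ≤ C + 1 := by linarith
  · rw [← ContinuousLinearMap.comp_sub]
    calc _ ≤ ‖ℓ‖ * ‖sD (sD f) x - sD (sD f) y‖ := ContinuousLinearMap.opNorm_comp_le _ _
      _ ≤ 1 * (C * ‖x - y‖) := by
        gcongr
        rw [hf.sD_sD_displaced hx, hf.sD_sD_displaced hy]
        exact norm_sub_le_of_fderivWithin (hf.contDiffOn_sD_sD.differentiableOn (by norm_num))
          (fun z hz => hf.norm_sD_sD_sD_le hz) hx hy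
      _ ≤ (C + 1) * ‖x - y‖ := by
        rw [one_mul]
        exact mul_le_mul_of_nonneg_right (by linarith) (norm_nonneg _)

end Displacement

/-- The functional that reads the first coordinate of the image of `v`. -/
def evalFst (v : ℝ × ℝ) : (ℝ × ℝ →L[ℝ] ℝ × ℝ) →L[ℝ] ℝ :=
  (ContinuousLinearMap.fst ℝ ℝ ℝ).comp (ContinuousLinearMap.apply ℝ (ℝ × ℝ) v)

/-- The functional that reads the second coordinate of the image of `v`. -/
def evalSnd (v : ℝ × ℝ) : (ℝ × ℝ →L[ℝ] ℝ × ℝ) →L[ℝ] ℝ :=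
  (ContinuousLinearMap.snd ℝ ℝ ℝ).comp (ContinuousLinearMap.apply ℝ (ℝ × ℝ) v)

theorem norm_evalFst_le {v : ℝ × ℝ} (hv : ‖v‖ ≤ 1) : ‖evalFst v‖ ≤ 1 :=
  ContinuousLinearMap.opNorm_le_bound _ zero_le_one fun L => by
    refine (norm_fst_le (L v)).trans ((L.le_opNorm v).trans ?_)
    rw [one_mul]
    exact mul_le_of_le_one_right (norm_nonneg _) hv

theorem norm_evalSnd_le {v : ℝ × ℝ} (hv : ‖v‖ ≤ 1) : ‖evalSnd v‖ ≤ 1 :=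
  ContinuousLinearMap.opNorm_le_bound _ zero_le_one fun L => by
    refine (norm_snd_le (L v)).trans ((L.le_opNorm v).trans ?_)
    rw [one_mul]
    exact mul_le_of_le_one_right (norm_nonneg _) hv

/-! ### Good paths: time regularity, boundary components, positivity of the Jacobian. -/

/-- A path of diffeomorphisms of the strip from the identity to an area-preserving map, with
uniform `C³` bounds. -/
structure GoodPath (C : ℝ) (f : ℝ → ℝ × ℝ → ℝ × ℝ) : Prop where
  zero : EqOn (f 0) id strip
  diffeo : ∀ t ∈ Icc (0 : ℝ) 1, IsStripDiffeo 3 (f t)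
  differentiable : ∀ t ∈ Icc (0 : ℝ) 1, ∀ x ∈ strip,
    DifferentiableWithinAt ℝ (fun s => f s x) (Icc 0 1) t
  velocity : ∀ t ∈ Icc (0 : ℝ) 1,
    IsBoundedInC 3 C fun x => derivWithin (fun s => f s x) (Icc 0 1) t
  displacement : ∀ t ∈ Icc (0 : ℝ) 1, IsBoundedInC 3 C fun x => f t x - x
  inv_displacement : ∀ t ∈ Icc (0 : ℝ) 1, IsBoundedInC 3 C fun x => stripInv (f t) x - x
  det_one : ∀ x ∈ strip, (sD (f 1) x).det = 1

namespace GoodPath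

variable {C : ℝ} {f : ℝ → ℝ × ℝ → ℝ × ℝ} (hf : GoodPath C f) {s t : ℝ}
include hf

theorem nonneg : 0 ≤ C := (hf.displacement 0 (by norm_num)).nonneg

/-- The mean value inequality in time, applied to the difference of two trajectories, whose
velocities differ by at most `C * ‖x - y‖`. Dividing by the distance gives Lipschitz dependence of
the differential on t without exchanging time and space derivatives. -/
theorem norm_sub_sub_le (hs : s ∈ Icc (0 : ℝ) 1) (ht : t ∈ Icc (0 : ℝ) 1) {x y : ℝ × ℝ}
    (hx : x ∈ strip) (hy : y ∈ strip) :
    ‖(f t x - f s x) - (f t y - f s y)‖ ≤ C * |t - s| * ‖x - y‖ := by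
  have := (convex_Icc (0 : ℝ) 1).norm_image_sub_le_of_norm_derivWithin_le
    (f := fun τ => f τ x - f τ y) (C := C * ‖x - y‖)
    (fun τ hτ => (hf.differentiable τ hτ x hx).sub (hf.differentiable τ hτ y hy)) (fun τ hτ => ?_)
    hs ht
  · rw [show (f t x - f s x) - (f t y - f s y) = (f t x - f t y) - (f s x - f s y) by abel]
    exact this.trans_eq (by rw [Real.norm_eq_abs]; ring)
  · have e : derivWithin (fun τ => f τ x - f τ y) (Icc 0 1) τ =
        derivWithin (fun s => f s x) (Icc 0 1) τ - derivWithin (fun s => f s y) (Icc 0 1) τ :=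
      derivWithin_fun_sub (hf.differentiable τ hτ x hx) (hf.differentiable τ hτ y hy)
    rw [e]
    exact norm_sub_le_of_fderivWithin (hf.velocity τ hτ).differentiableOn
      (fun z hz => (hf.velocity τ hτ).norm_sD_le hz) hx hy

theorem norm_sub_le (hs : s ∈ Icc (0 : ℝ) 1) (ht : t ∈ Icc (0 : ℝ) 1) {x : ℝ × ℝ}
    (hx : x ∈ strip) : ‖f t x - f s x‖ ≤ C * |t - s| :=
  (convex_Icc (0 : ℝ) 1).norm_image_sub_le_of_norm_derivWithin_le
    (fun τ hτ => hf.differentiable τ hτ x hx) (fun τ hτ => (hf.velocity τ hτ).norm_le hx) hs ht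

theorem hasFDerivWithinAt (ht : t ∈ Icc (0 : ℝ) 1) {x : ℝ × ℝ} (hx : x ∈ strip) :
    HasFDerivWithinAt (f t) (sD (f t) x) strip x :=
  ((hf.displacement t ht).hasFDerivWithinAt_displaced hx).differentiableWithinAt.hasFDerivWithinAt

theorem norm_sD_sub_le (hs : s ∈ Icc (0 : ℝ) 1) (ht : t ∈ Icc (0 : ℝ) 1) {x : ℝ × ℝ}
    (hx : x ∈ strip) : ‖sD (f t) x - sD (f s) x‖ ≤ C * |t - s| := by
  have h := (hf.hasFDerivWithinAt ht hx).sub (hf.hasFDerivWithinAt hs hx)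
  exact ContinuousLinearMap.opNorm_le_bound _ (mul_nonneg hf.nonneg (abs_nonneg _))
    (norm_apply_le_of_lipschitz hx h fun y hy => hf.norm_sub_sub_le hs ht hy hx)

theorem continuousOn_apply {x : ℝ × ℝ} (hx : x ∈ strip) :
    ContinuousOn (fun t => f t x) (Icc 0 1) :=
  fun t ht => (hf.differentiable t ht x hx).continuousWithinAt

theorem continuousOn_sD {x : ℝ × ℝ} (hx : x ∈ strip) :
    ContinuousOn (fun t => sD (f t) x) (Icc 0 1) :=
  (LipschitzOnWith.of_dist_le_mul (K := C.toNNReal) fun t ht s hs => by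
    simpa [dist_eq_norm, hf.nonneg] using hf.norm_sD_sub_le hs ht hx).continuousOn

theorem continuousOn_jac {x : ℝ × ℝ} (hx : x ∈ strip) :
    ContinuousOn (fun t => jac (f t) x) (Icc 0 1) := by
  have h := hf.continuousOn_sD hx
  have h1 : ContinuousOn (fun t => sD (f t) x (1, 0)) (Icc 0 1) := h.clm_apply continuousOn_const
  have h2 : ContinuousOn (fun t => sD (f t) x (0, 1)) (Icc 0 1) := h.clm_apply continuousOn_const
  exact (h1.fst.mul h2.snd).sub (h2.fst.mul h1.snd)

theorem antilip (ht : t ∈ Icc (0 : ℝ) 1) {x y : ℝ × ℝ} (hx : x ∈ strip) (hy : y ∈ strip) :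
    ‖x - y‖ ≤ (C + 1) * ‖f t x - f t y‖ := by
  have hb := (hf.diffeo t ht).bijOn
  have hd := hf.inv_displacement t ht
  have := norm_sub_le_of_fderivWithin (f := stripInv (f t)) (C := C + 1)
    (fun z hz => (hd.hasFDerivWithinAt_displaced hz).differentiableWithinAt)
    (fun z hz => hd.norm_sD_displaced_le hz) (hb.mapsTo hx) (hb.mapsTo hy)
  rwa [stripInv_apply hb.injOn hx, stripInv_apply hb.injOn hy] at this

/-- Near an interior image point the inverse map is C¹ with invertible differential, hence open by
the inverse function theorem. Therefore boundary points go to boundary points. -/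
theorem mem_interior_of_apply_mem_interior (ht : t ∈ Icc (0 : ℝ) 1) {x : ℝ × ℝ} (hx : x ∈ strip)
    (h : f t x ∈ interior strip) : x ∈ interior strip := by
  have hb := (hf.diffeo t ht).bijOn
  have hg := (hf.diffeo t ht).contDiffOn_inv
  have hy := hb.mapsTo hx
  have hnhds : strip ∈ 𝓝 (f t x) := mem_interior_iff_mem_nhds.1 h
  have hs : HasStrictFDerivAt (stripInv (f t)) (fderiv ℝ (stripInv (f t)) (f t x)) (f t x) :=
    (hg.contDiffAt hnhds).hasStrictFDerivAt (by norm_num)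
  have hd := hf.displacement t ht
  obtain ⟨e, he, -⟩ := exists_equiv_of_antilipschitz (C := C + 1) (by linarith [hf.nonneg])
    (le_norm_apply_of_antilipschitz hy hs.hasFDerivAt.hasFDerivWithinAt fun z hz => by
      have := norm_sub_le_of_fderivWithin (f := f t) (C := C + 1)
        (fun z hz => (hd.hasFDerivWithinAt_displaced hz).differentiableWithinAt)
        (fun z hz => hd.norm_sD_displaced_le hz) (stripInv_mem hb.surjOn hz)
        (stripInv_mem hb.surjOn hy)
      rwa [apply_stripInv hb.surjOn hz, apply_stripInv hb.surjOn hy] at this)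
  rw [← he] at hs
  have hmap := hs.map_nhds_eq_of_equiv
  rw [stripInv_apply hb.injOn hx] at hmap
  rw [mem_interior_iff_mem_nhds, ← hmap]
  exact mem_of_superset (image_mem_map hnhds) (by
    rintro _ ⟨z, hz, rfl⟩
    exact stripInv_mem hb.surjOn hz)

theorem abs_snd_eq_one (ht : t ∈ Icc (0 : ℝ) 1) {x : ℝ × ℝ} (hx : |x.2| = 1) :
    |(f t x).2| = 1 := by
  have hx' : x ∈ strip := mem_strip.2 (abs_le.1 hx.le)
  have h1 := mem_strip.1 ((hf.diffeo t ht).bijOn.mapsTo hx')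
  refine le_antisymm (abs_le.2 h1) (not_lt.1 fun hlt => ?_)
  have h2 := hf.mem_interior_of_apply_mem_interior ht hx' (by
    rw [interior_strip]
    exact ⟨mem_univ _, abs_lt.1 hlt⟩)
  rw [interior_strip] at h2
  exact absurd hx (abs_lt.2 h2.2).ne

/-- The height of the image is ±1 at all times, is continuous in time and equals 1 at time 0, so it
cannot change sign. -/
theorem top (ht : t ∈ Icc (0 : ℝ) 1) (q : ℝ) : (f t (q, 1)).2 = 1 := by
  have hsub : Icc (0 : ℝ) t ⊆ Icc 0 1 := Icc_subset_Icc_right ht.2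
  rcases eq_or_eq_neg_of_abs_eq (hf.abs_snd_eq_one ht (x := (q, 1)) (by simp)) with h | h
  · exact h
  · have h0 : (f 0 (q, 1)).2 = 1 := by rw [hf.zero (top_mem_strip q)]; rfl
    obtain ⟨τ, hτ, hz⟩ := intermediate_value_Icc' ht.1
      ((hf.continuousOn_apply (top_mem_strip q)).snd.mono hsub)
      (show (0 : ℝ) ∈ _ by rw [h0, h]; norm_num)
    have := hf.abs_snd_eq_one (hsub hτ) (x := (q, 1)) (by simp)
    simp only at hz
    rw [hz, abs_zero] at this
    norm_num at this

theorem bot (ht : t ∈ Icc (0 : ℝ) 1) (q : ℝ) : (f t (q, -1)).2 = -1 := by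
  have hsub : Icc (0 : ℝ) t ⊆ Icc 0 1 := Icc_subset_Icc_right ht.2
  rcases eq_or_eq_neg_of_abs_eq (hf.abs_snd_eq_one ht (x := (q, -1)) (by simp)) with h | h
  · have h0 : (f 0 (q, -1)).2 = -1 := by rw [hf.zero (bot_mem_strip q)]; rfl
    obtain ⟨τ, hτ, hz⟩ := intermediate_value_Icc ht.1
      ((hf.continuousOn_apply (bot_mem_strip q)).snd.mono hsub)
      (show (0 : ℝ) ∈ _ by rw [h0, h]; norm_num)
    have := hf.abs_snd_eq_one (hsub hτ) (x := (q, -1)) (by simp)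
    simp only at hz
    rw [hz, abs_zero] at this
    norm_num at this
  · exact h

theorem tame (ht : t ∈ Icc (0 : ℝ) 1) : Tame (C + 1) (f t) := by
  have hd := hf.displacement t ht
  refine ⟨(hf.diffeo t ht).bijOn, hf.top ht, hf.bot ht,
    fun x hx => (hf.hasFDerivWithinAt ht hx).differentiableWithinAt,
    fun x hx => hd.norm_sD_displaced_le hx,
    fun x hx y hy => (hd.norm_sD_displaced_sub_le hx hy).trans
      (mul_le_mul_of_nonneg_right (by linarith) (norm_nonneg _)),
    fun x hx y hy => hf.antilip ht hx hy, fun x hx => (hd.norm_le hx).trans (by linarith)⟩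

/-- The Jacobian is continuous in time, never vanishes and equals 1 at time 0, hence stays positive.
Its size is then bounded below through the bounded inverse differential. -/
theorem jac_ge (ht : t ∈ Icc (0 : ℝ) 1) {x : ℝ × ℝ} (hx : x ∈ strip) :
    1 / (2 * (C + 1) ^ 2) ≤ jac (f t) x := by
  have hC := hf.nonneg
  have hne : ∀ s ∈ Icc (0 : ℝ) 1, jac (f s) x ≠ 0 := fun s hs h => by
    have := (hf.tame hs).one_le_mul_abs_jac hx
    rw [h, abs_zero, mul_zero] at this
    norm_num at this
  have hpos : 0 ≤ jac (f t) x := by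
    by_contra! hneg
    have hsub : Icc (0 : ℝ) t ⊆ Icc 0 1 := Icc_subset_Icc_right ht.2
    have h0 : jac (f 0) x = 1 := by
      rw [← det_sD, sD_congr hf.zero hx, sD, fderivWithin_id (uniqueDiffOn_strip x hx)]
      simp [ContinuousLinearMap.det]
    obtain ⟨τ, hτ, hz⟩ := intermediate_value_Icc' ht.1 ((hf.continuousOn_jac hx).mono hsub)
      (show (0 : ℝ) ∈ _ by rw [h0]; exact ⟨hneg.le, zero_le_one⟩)
    exact hne τ (hsub hτ) hz
  have := (hf.tame ht).one_le_mul_abs_jac hx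
  rw [abs_of_nonneg hpos] at this
  rw [div_le_iff₀ (by positivity)]
  linarith

theorem tameC2 (ht : t ∈ Icc (0 : ℝ) 1) : TameC2 (C + 1) (1 / (2 * (C + 1) ^ 2)) (f t) := by
  have hd := hf.displacement t ht
  have hC := hf.nonneg
  have hT := hf.tame ht
  have hfst : ‖ContinuousLinearMap.fst ℝ ℝ ℝ‖ ≤ 1 := ContinuousLinearMap.norm_fst_le ℝ ℝ ℝ
  have hsnd : ‖ContinuousLinearMap.snd ℝ ℝ ℝ‖ ≤ 1 := ContinuousLinearMap.norm_snd_le ℝ ℝ ℝ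
  have hcomp : ∀ {p : ℝ × ℝ →L[ℝ] ℝ} {L : ℝ × ℝ →L[ℝ] ℝ × ℝ}, ‖p‖ ≤ 1 → ‖p.comp L‖ ≤ ‖L‖ :=
    fun hp => (ContinuousLinearMap.opNorm_comp_le _ _).trans
      (mul_le_of_le_one_left (norm_nonneg _) hp)
  refine ⟨hT, ?_, ?_, (hd.c11_clm (norm_evalFst_le norm_one_zero_le)).1,
    (hd.c11_clm (norm_evalFst_le norm_zero_one_le)).1,
    (hd.c11_clm (norm_evalSnd_le norm_one_zero_le)).1,
    (hd.c11_clm (norm_evalSnd_le norm_zero_one_le)).1, fun x hx => ?_, fun x hx => hf.jac_ge ht hx⟩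
  · refine C11.of_hasFDerivWithinAt (fun x hx => (hd.differentiableOn x hx).hasFDerivWithinAt.fst)
      (fun x hx => (norm_fst_le (f t x - x)).trans (hT.disp x hx))
      (fun x hx => (hcomp hfst).trans ((hd.norm_sD_le hx).trans (by linarith)))
      fun x hx y hy => ?_
    rw [← ContinuousLinearMap.comp_sub]
    refine (hcomp hfst).trans ?_
    have := hd.norm_sD_displaced_sub_le hx hy
    rw [hd.sD_displaced hx, hd.sD_displaced hy, add_sub_add_right_eq_sub] at this
    exact this.trans (mul_le_mul_of_nonneg_right (by linarith) (norm_nonneg _))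
  · refine C11.of_hasFDerivWithinAt (fun x hx => (hT.hasFDerivWithinAt hx).snd)
      (fun x hx => (abs_le.2 (mem_strip.1 (hT.mem hx))).trans (by linarith))
      (fun x hx => (hcomp hsnd).trans (hT.norm_le x hx)) fun x hx y hy => ?_
    rw [← ContinuousLinearMap.comp_sub]
    exact (hcomp hsnd).trans (hT.lip x hx y hy)
  · have h1 := (hd.c11_clm (norm_evalFst_le norm_one_zero_le)).2 x hx
    have h2 := (hd.c11_clm (norm_evalFst_le norm_zero_one_le)).2 x hx
    have h3 : IsSymmSndFDerivWithinAt ℝ (f t) strip x :=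
      ((hf.diffeo t ht).contDiffOn x hx).isSymmSndFDerivWithinAt (by simp; norm_num)
        uniqueDiffOn_strip (subset_closure_interior_strip hx) hx
    have e1 : sD (dqQ (f t)) x (0, 1) = (sD (sD (f t)) x (0, 1) (1, 0)).1 :=
      congrArg (fun L : ℝ × ℝ →L[ℝ] ℝ => L (0, 1)) h1
    have e2 : sD (dpQ (f t)) x (1, 0) = (sD (sD (f t)) x (1, 0) (0, 1)).1 :=
      congrArg (fun L : ℝ × ℝ →L[ℝ] ℝ => L (1, 0)) h2
    rw [e1, e2]
    exact congrArg Prod.fst (h3 _ _)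

end GoodPath

/-! ### Area-preserving parts and short steps between them. -/

/-- The area-preserving map obtained from `f` by dividing out its Knothe map. -/
def areaPart (f : ℝ × ℝ → ℝ × ℝ) : ℝ × ℝ → ℝ × ℝ := f ∘ stripInv (knothe f)

/-- A tame area-preserving map that becomes a monotone twist after a large shear. -/
structure IsStep (K : ℝ) (ψ : ℝ × ℝ → ℝ × ℝ) : Prop where
  tame : Tame K ψ
  det_one : ∀ x ∈ strip, (sD ψ x).det = 1
  half_le : ∀ x ∈ strip, 1 / 2 ≤ dqQ ψ x

theorem IsStep.mono {K K' : ℝ} {ψ : ℝ × ℝ → ℝ × ℝ} (h : IsStep K ψ) (hK : K ≤ K') :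
    IsStep K' ψ := ⟨h.tame.mono hK, h.det_one, h.half_le⟩

/-- A tame map that is uniformly close to the identity has `∂Q/∂q` close to one. -/
theorem Tame.half_le_dqQ {K : ℝ} {ψ : ℝ × ℝ → ℝ × ℝ} (hψ : Tame K ψ)
    (h : ∀ x ∈ strip, ‖ψ x - x‖ ≤ 1 / (32 * (K + 1))) {x : ℝ × ℝ} (hx : x ∈ strip) :
    1 / 2 ≤ dqQ ψ x := by
  have hK := hψ.nonneg
  have hfst : ‖ContinuousLinearMap.fst ℝ ℝ ℝ‖ ≤ 1 := ContinuousLinearMap.norm_fst_le ℝ ℝ ℝ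
  have hcomp : ∀ {L : ℝ × ℝ →L[ℝ] ℝ × ℝ},
      ‖(ContinuousLinearMap.fst ℝ ℝ ℝ).comp L‖ ≤ ‖L‖ :=
    (ContinuousLinearMap.opNorm_comp_le _ _).trans (mul_le_of_le_one_left (norm_nonneg _) hfst)
  have hd : ∀ x ∈ strip, HasFDerivWithinAt (fun x => (ψ x).1 - x.1)
      ((ContinuousLinearMap.fst ℝ ℝ ℝ).comp (sD ψ x) - ContinuousLinearMap.fst ℝ ℝ ℝ) strip x :=
    fun x hx => ((hψ.hasFDerivWithinAt hx).fst).sub hasFDerivWithinAt_fst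
  have hc : C11 (K + 1) (fun x => (ψ x).1 - x.1) := by
    refine C11.of_hasFDerivWithinAt hd
      (fun x hx => (norm_fst_le (ψ x - x)).trans ((hψ.disp x hx).trans (by linarith)))
      (fun x hx => (_root_.norm_sub_le _ _).trans (add_le_add (hcomp.trans (hψ.norm_le x hx)) hfst))
      fun x hx y hy => ?_
    rw [sub_sub_sub_cancel_right, ← ContinuousLinearMap.comp_sub]
    exact hcomp.trans ((hψ.lip x hx y hy).trans
      (mul_le_mul_of_nonneg_right (by linarith) (norm_nonneg _)))
  -- Interpolation over a horizontal distance δ. The Taylor remainder is `(K + 1) * δ ^ 2 = δ / 4`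
  -- and each of the two displacements is at most `δ / 8`, so ∂Q/∂q differs from 1 by at most 1/2.
  set δ : ℝ := 1 / (4 * (K + 1)) with hδ
  have hδ0 : 0 < δ := by positivity
  have hy := strip_add_mem hx δ
  have ht := hc.taylor hx hy
  have e0 : x + (δ, 0) - x = δ • ((1 : ℝ), (0 : ℝ)) := by simp
  have e1 : sD (fun x => (ψ x).1 - x.1) x (1, 0) = dqQ ψ x - 1 := by
    rw [sD, (hd x hx).fderivWithin (uniqueDiffOn_strip x hx)]
    rfl
  have e2 : ‖δ • ((1 : ℝ), (0 : ℝ))‖ = δ := by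
    rw [norm_smul, Real.norm_of_nonneg hδ0.le]
    simp [Prod.norm_def]
  rw [e0, map_smul, e1, e2, smul_eq_mul] at ht
  have b1 := abs_le.1 ((norm_fst_le (ψ x - x)).trans (h x hx))
  have b2 := abs_le.1 ((norm_fst_le (ψ (x + (δ, 0)) - (x + (δ, 0)))).trans (h _ hy))
  simp only [Prod.fst_sub] at b1 b2
  have e3 : 1 / (32 * (K + 1)) = δ / 8 := by rw [hδ]; field_simp; norm_num
  have e4 : (K + 1) * δ ^ 2 = δ / 4 := by rw [hδ]; field_simp
  rw [e3] at b1 b2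
  rw [e4] at ht
  have ht' := abs_le.1 ht
  have key : δ * (1 / 2) ≤ δ * dqQ ψ x := by
    linarith [ht'.1, ht'.2, b1.1, b1.2, b2.1, b2.2]
  exact le_of_mul_le_mul_left key hδ0

theorem knothe_eqOn_id {f : ℝ × ℝ → ℝ × ℝ} (hf : EqOn f id strip) :
    EqOn (knothe f) id strip := by
  have hD : ∀ x ∈ strip, sD f x = ContinuousLinearMap.id ℝ (ℝ × ℝ) := fun x hx => by
    rw [sD_congr hf hx, sD, fderivWithin_id (uniqueDiffOn_strip x hx)]
  have hjac : ∀ x ∈ strip, primitive (jac f) x = x.2 + 1 := fun x hx => by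
    have : primitive (jac f) x = ∫ _ in (-1 : ℝ)..x.2, (1 : ℝ) := by
      refine intervalIntegral.integral_congr fun u hu => ?_
      have hx2 := mem_strip.1 hx
      have := hD (x.1, u) (mk_mem_strip (uIcc_subset_Icc neg_one_mem hx2 hu))
      simp only [jac, dqQ, dpQ, dqP, dpP, this]
      simp
    rw [this]
    simp
  have hP : ∀ q, primitive (fun y => (f y).2 * dpQ f y) (q, 1) = 0 := fun q => by
    have : primitive (fun y => (f y).2 * dpQ f y) (q, 1) = ∫ _ in (-1 : ℝ)..1, (0 : ℝ) := by
      refine intervalIntegral.integral_congr fun u hu => ?_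
      rw [uIcc_of_le (by norm_num)] at hu
      simp only [dpQ, hD (q, u) (mk_mem_strip hu)]
      simp
    rw [this]
    simp
  intro x hx
  refine Prod.ext ?_ ?_
  · simp [knothe, columnShift, hP, hf (top_mem_strip x.1), hf (bot_mem_strip x.1)]
  · simp only [knothe, fibre, hjac x hx, hjac _ (top_mem_strip x.1), id]
    ring

section

variable {C : ℝ}

/-- The lower bound for the Jacobian along a path with `C³` bound `C`. -/
def pathJac (C : ℝ) : ℝ := 1 / (2 * (C + 1) ^ 2)

theorem pathJac_pos (hC : 0 ≤ C) : 0 < pathJac C := by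
  unfold pathJac
  positivity

namespace GoodPath

variable {f : ℝ → ℝ × ℝ → ℝ × ℝ} (hf : GoodPath C f) {s t : ℝ}
include hf

theorem tame_knothe (ht : t ∈ Icc (0 : ℝ) 1) :
    Tame (TameC2.knotheBound (C + 1) (pathJac C)) (knothe (f t)) :=
  (hf.tameC2 ht).tame_knothe (pathJac_pos hf.nonneg)

theorem areaPart_det (ht : t ∈ Icc (0 : ℝ) 1) {x : ℝ × ℝ} (hx : x ∈ strip) :
    (sD (areaPart (f t)) x).det = 1 :=
  (hf.tame_knothe ht).det_comp_inv (hf.tame ht) (fun y hy => by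
    rw [det_sD, det_sD]
    exact (hf.tameC2 ht).jac_knothe (pathJac_pos hf.nonneg) hy) hx

theorem areaPart_zero : EqOn (areaPart (f 0)) id strip := fun x hx => by
  have hT := hf.tame_knothe (t := 0) (by norm_num)
  have h := knothe_eqOn_id hf.zero
  have hx' := hT.inv_mem hx
  have e : stripInv (knothe (f 0)) x = x := by
    have := hT.apply_inv hx
    rwa [h hx'] at this
  rw [areaPart, Function.comp_apply, e, hf.zero hx]

theorem areaPart_knothe (ht : t ∈ Icc (0 : ℝ) 1) :
    EqOn (areaPart (f t) ∘ knothe (f t)) (f t) strip := fun x hx => by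
  rw [areaPart, Function.comp_apply, Function.comp_apply, (hf.tame_knothe ht).inv_apply hx]

/-- At time 1 the Jacobian is one, so every vertical line has mass 2 and the horizontal derivative,
half of that mass, is 1. -/
theorem isStep_knothe_one : IsStep (TameC2.knotheBound (C + 1) (pathJac C)) (knothe (f 1)) := by
  have h1 : (1 : ℝ) ∈ Icc (0 : ℝ) 1 := by norm_num
  have hκ := pathJac_pos hf.nonneg
  have hjac : ∀ x ∈ strip, jac (f 1) x = 1 := fun x hx => by rw [← det_sD, hf.det_one x hx]
  refine ⟨hf.tame_knothe h1, fun x hx => ?_, fun x hx => ?_⟩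
  · rw [det_sD, (hf.tameC2 h1).jac_knothe hκ hx, hjac x hx]
  · rw [(hf.tameC2 h1).dqQ_knothe hκ hx]
    have : primitive (jac (f 1)) (x.1, 1) = ∫ _ in (-1 : ℝ)..1, (1 : ℝ) := by
      refine intervalIntegral.integral_congr fun u hu => ?_
      rw [uIcc_of_le (by norm_num)] at hu
      exact hjac _ (mk_mem_strip hu)
    rw [this]
    norm_num

/-- Let u and v be the preimages of x under the Knothe maps k_t and k_s. The distance from u to v is
controlled by that from x = k_s(v) to k_t(v), so only the maps k_s and k_t are compared, at one
point, and not their inverses. -/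
theorem norm_areaPart_sub_le (hs : s ∈ Icc (0 : ℝ) 1) (ht : t ∈ Icc (0 : ℝ) 1) {x : ℝ × ℝ}
    (hx : x ∈ strip) : ‖areaPart (f t) x - areaPart (f s) x‖ ≤
      ((C + 1) * (TameC2.knotheBound (C + 1) (pathJac C) *
        ((1 + 2 * (C + 1) + 16 * (C + 1) / pathJac C) * C)) + C) * |t - s| := by
  have hC := hf.nonneg
  have hκ := pathJac_pos hC
  have hTt := hf.tame_knothe ht
  have hTs := hf.tame_knothe hs
  have hu := hTt.inv_mem hx
  have hv := hTs.inv_mem hx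
  have h1 := hTt.antilip _ hu _ hv
  rw [hTt.apply_inv hx] at h1
  have h2 : ‖x - knothe (f t) (stripInv (knothe (f s)) x)‖ ≤
      (1 + 2 * (C + 1) + 16 * (C + 1) / pathJac C) * (C * |t - s|) := by
    have := (hf.tameC2 hs).norm_knothe_sub_le hκ (hf.tameC2 ht) (ε := C * |t - s|)
      (fun y hy => by rw [abs_sub_comm]; exact hf.norm_sub_le ht hs hy)
      (fun y hy => by rw [abs_sub_comm]; exact hf.norm_sD_sub_le ht hs hy) hv
    rwa [hTs.apply_inv hx] at this
  have h3 := (hf.tame ht).norm_sub_le hu hv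
  have h4 := hf.norm_sub_le hs ht hv
  have h5 := mul_le_mul_of_nonneg_left (h1.trans (mul_le_mul_of_nonneg_left h2 hTt.nonneg))
    (show 0 ≤ C + 1 by linarith)
  have e : areaPart (f t) x - areaPart (f s) x =
      (f t (stripInv (knothe (f t)) x) - f t (stripInv (knothe (f s)) x)) +
      (f t (stripInv (knothe (f s)) x) - f s (stripInv (knothe (f s)) x)) := by
    simp [areaPart]
  rw [e]
  refine (norm_add_le _ _).trans ?_
  linarith

end GoodPath

theorem exists_tame_areaPart (C : ℝ) : ∃ K, ∀ {f : ℝ → ℝ × ℝ → ℝ × ℝ}, GoodPath C f →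
    ∀ t ∈ Icc (0 : ℝ) 1, Tame K (areaPart (f t)) :=
  ⟨_, fun hf _ ht => (hf.tame ht).comp (hf.tame_knothe ht).inv⟩

/-- The map that leads from the area-preserving part of `f` to that of `g`. -/
def stepMap (f g : ℝ × ℝ → ℝ × ℝ) : ℝ × ℝ → ℝ × ℝ := areaPart g ∘ stripInv (areaPart f)

/-- The constants `K` and `n` are chosen before the path. This makes the number of factors and the
bounds nonrandom. -/
theorem exists_isStep (C : ℝ) : ∃ (K : ℝ) (n : ℕ), 0 < n ∧
    ∀ {f : ℝ → ℝ × ℝ → ℝ × ℝ}, GoodPath C f → IsStep K (knothe (f 1)) ∧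
      ∀ s ∈ Icc (0 : ℝ) 1, ∀ t ∈ Icc (0 : ℝ) 1, |t - s| ≤ 1 / n →
        IsStep K (stepMap (f s) (f t)) := by
  obtain ⟨K, hK⟩ := exists_tame_areaPart C
  set L : ℝ := (C + 1) * (TameC2.knotheBound (C + 1) (pathJac C) *
        ((1 + 2 * (C + 1) + 16 * (C + 1) / pathJac C) * C)) + C
  set M : ℝ := K * (K + K ^ 4) ^ 2 + K * (K + K ^ 4) + K + (K + K ^ 4)
  -- `L` is the Lipschitz constant of the area-preserving part in time, `M` the tameness constant of
  -- a step; the choice gives the closeness demanded by `Tame.half_le_dqQ`.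
  obtain ⟨n, hn⟩ := exists_nat_gt (|L| * (32 * (M + 1)))
  have hL := abs_nonneg L
  have hknothe := le_max_left (TameC2.knotheBound (C + 1) (pathJac C)) M
  have hM' := le_max_right (TameC2.knotheBound (C + 1) (pathJac C)) M
  refine ⟨max (TameC2.knotheBound (C + 1) (pathJac C)) M, n + 1, n.succ_pos, fun hf =>
    ⟨hf.isStep_knothe_one.mono hknothe, fun s hs t ht hst => ?_⟩⟩
  have hAs := hK hf s hs
  have hAt := hK hf t ht
  have hT : Tame M (stepMap _ _) := hAt.comp hAs.inv
  have hM := hT.nonneg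
  refine ⟨hT.mono hM', fun x hx => hAs.det_comp_inv hAt (fun y hy => ?_) hx,
    fun x hx => hT.half_le_dqQ (fun y hy => ?_) hx⟩
  · rw [hf.areaPart_det hs hy, hf.areaPart_det ht hy]
  · have h1 := hf.norm_areaPart_sub_le hs ht (hAs.inv_mem hy)
    rw [hAs.apply_inv hy] at h1
    refine h1.trans ?_
    push_cast at hst
    calc L * |t - s| ≤ |L| * (1 / (n + 1)) :=
          mul_le_mul (le_abs_self _) hst (abs_nonneg _) hL
      _ ≤ 1 / (32 * (M + 1)) := by
        rw [mul_one_div, div_le_div_iff₀ (by positivity) (by positivity)]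
        linarith

end

/-! ### Joint measurability of random maps. -/

/-- The nearest-point retraction of the plane onto the strip. -/
def clamp (x : ℝ × ℝ) : ℝ × ℝ := (x.1, max (-1) (min x.2 1))

theorem clamp_mem (x : ℝ × ℝ) : clamp x ∈ strip :=
  mem_strip.2 ⟨le_max_left _ _, max_le (by norm_num) (min_le_right _ _)⟩

theorem clamp_eq {x : ℝ × ℝ} (hx : x ∈ strip) : clamp x = x := by
  have h := mem_strip.1 hx
  simp [clamp, min_eq_left h.2, max_eq_right h.1]

theorem continuous_clamp : Continuous clamp := by
  unfold clamp
  fun_prop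

section Measurability

variable {Ω : Type*} [MeasurableSpace Ω] {E : Type} [TopologicalSpace E]
  [TopologicalSpace.PseudoMetrizableSpace E] [MeasurableSpace E] [BorelSpace E]

/-- The Carathéodory argument: continuity in x and measurability in ω give joint measurability. The
retraction extends the maps continuously to the plane. -/
theorem measurable_uncurry_clamp {f : Ω → ℝ × ℝ → E} (hc : ∀ ω, ContinuousOn (f ω) strip)
    (hm : ∀ x ∈ strip, Measurable fun ω => f ω x) :
    Measurable fun z : Ω × (ℝ × ℝ) => f z.1 (clamp z.2) := by
  have h : Measurable (Function.uncurry fun (x : ℝ × ℝ) (ω : Ω) => f ω (clamp x)) :=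
    measurable_uncurry_of_continuous_of_measurable
      (fun ω => (hc ω).comp_continuous continuous_clamp clamp_mem)
      (fun x => hm _ (clamp_mem x))
  exact h.comp measurable_swap

theorem measurable_eval {f : Ω → ℝ × ℝ → E} (hc : ∀ ω, ContinuousOn (f ω) strip)
    (hm : ∀ x ∈ strip, Measurable fun ω => f ω x) {g : Ω → ℝ × ℝ} (hg : Measurable g)
    (hgs : ∀ ω, g ω ∈ strip) : Measurable fun ω => f ω (g ω) := by
  have := (measurable_uncurry_clamp hc hm).comp (measurable_id.prodMk hg)
  convert this using 1
  funext ω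
  simp [clamp_eq (hgs ω)]

theorem measurable_primitive {g : Ω → ℝ × ℝ → ℝ} (hc : ∀ ω, ContinuousOn (g ω) strip)
    (hm : ∀ x ∈ strip, Measurable fun ω => g ω x) {x : ℝ × ℝ} (hx : x ∈ strip) :
    Measurable fun ω => primitive (g ω) x := by
  have hx2 := mem_strip.1 hx
  have h1 : Measurable fun z : Ω × ℝ => g z.1 (clamp (x.1, z.2)) :=
    (measurable_uncurry_clamp hc hm).comp
      (measurable_fst.prodMk (measurable_const.prodMk measurable_snd))
  have h2 := (h1.stronglyMeasurable.integral_prod_right'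
    (ν := volume.restrict (Ioc (-1 : ℝ) x.2))).measurable
  convert h2 using 1
  funext ω
  rw [primitive, intervalIntegral.integral_of_le hx2.1]
  refine setIntegral_congr_fun measurableSet_Ioc fun u hu => ?_
  simp only [clamp_eq (mk_mem_strip (q := x.1) ⟨hu.1.le, hu.2.trans hx2.2⟩)]

theorem measurable_sD_apply {f : Ω → ℝ × ℝ → ℝ × ℝ}
    (hd : ∀ ω, DifferentiableOn ℝ (f ω) strip) (hm : ∀ x ∈ strip, Measurable fun ω => f ω x)
    {x : ℝ × ℝ} (hx : x ∈ strip) (v : ℝ × ℝ) : Measurable fun ω => sD (f ω) x v := by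
  obtain ⟨c, d, -, hmem, h⟩ := exists_tendsto_fderivWithin_apply hx v
  exact measurable_of_tendsto_metrizable
    (fun n => ((hm _ (hmem n)).sub (hm _ hx)).const_smul (c n))
    (tendsto_pi_nhds.2 fun ω => h (hd ω x hx).hasFDerivWithinAt)

end Measurability

/-! ### Stationary random maps. -/

variable {Ω : Type*} [TopologicalSpace Ω] [MeasurableSpace Ω] {τ : Flow ℝ Ω}

/-- A random map of the strip is stationary if translating it amounts to moving `ω` along the
flow. -/
def IsStationary (τ : Flow ℝ Ω) (f : Ω → ℝ × ℝ → ℝ × ℝ) : Prop :=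
  ∀ ω a, ∀ x ∈ strip, f (τ a ω) x = f ω (x + (a, 0)) - (a, 0)

/-- A stationary, measurable random map that is uniformly tame. -/
structure RandomTame (τ : Flow ℝ Ω) (C : ℝ) (f : Ω → ℝ × ℝ → ℝ × ℝ) : Prop where
  tame : ∀ ω, Tame C (f ω)
  stationary : IsStationary τ f
  meas : ∀ x ∈ strip, Measurable fun ω => f ω x

namespace RandomTame

variable {C C' : ℝ} {f g : Ω → ℝ × ℝ → ℝ × ℝ}

theorem comp (hf : RandomTame τ C f) (hg : RandomTame τ C' g) :
    RandomTame τ (C * C' ^ 2 + C * C' + C + C') (fun ω => f ω ∘ g ω) where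
  tame ω := (hf.tame ω).comp (hg.tame ω)
  stationary ω a x hx := by
    simp only [Function.comp_apply]
    rw [hf.stationary ω a _ ((hg.tame _).mem hx), hg.stationary ω a x hx, sub_add_cancel]
  meas x hx := measurable_eval (fun ω => (hf.tame ω).diff.continuousOn) hf.meas (hg.meas x hx)
    fun ω => (hg.tame ω).mem hx

theorem inv (hf : RandomTame τ C f) : RandomTame τ (C + C ^ 4) (fun ω => stripInv (f ω)) where
  tame ω := (hf.tame ω).inv
  stationary ω a x hx := by
    have hxa := strip_add_mem hx a
    have hy := strip_sub_mem ((hf.tame ω).inv_mem hxa) a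
    have h := hf.stationary ω a _ hy
    rw [sub_add_cancel, (hf.tame ω).apply_inv hxa, add_sub_cancel_right] at h
    conv_lhs => rw [← h]
    exact (hf.tame _).inv_apply hy
  meas x hx := by
    have : Nonempty strip := ⟨⟨_, hx⟩⟩
    let y : ℕ → strip := TopologicalSpace.denseSeq strip
    have hy : DenseRange y := TopologicalSpace.denseRange_denseSeq strip
    -- The first point of a dense sequence whose image lies within 1/(k+1) of `x` is a measurable
    -- function of ω. The lower Lipschitz bound makes these points converge to the preimage of `x`.
    have hex : ∀ (k : ℕ) (ω : Ω), ∃ n, ‖f ω (y n) - x‖ < 1 / ((k : ℝ) + 1) := by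
      intro k ω
      have hC := (hf.tame ω).nonneg
      obtain ⟨n, hn⟩ := hy.exists_dist_lt ⟨_, (hf.tame ω).inv_mem hx⟩
        (show 0 < 1 / ((k : ℝ) + 1) / (C + 1) by positivity)
      refine ⟨n, ?_⟩
      have h1 := (hf.tame ω).norm_sub_le (y n).2 ((hf.tame ω).inv_mem hx)
      rw [(hf.tame ω).apply_inv hx] at h1
      rw [dist_comm, Subtype.dist_eq, dist_eq_norm, lt_div_iff₀ (by positivity)] at hn
      have := norm_nonneg ((y n : ℝ × ℝ) - stripInv (f ω) x)
      nlinarith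
    classical
    let N : ℕ → Ω → ℕ := fun k ω => Nat.find (hex k ω)
    have hN : ∀ k, Measurable (N k) := fun k => measurable_find (hex k) fun n =>
      measurableSet_lt ((hf.meas _ (y n).2).sub_const x).norm measurable_const
    refine measurable_of_tendsto_metrizable (f := fun k ω => (y (N k ω) : ℝ × ℝ))
      (fun k => (measurable_from_nat (f := fun n => (y n : ℝ × ℝ))).comp (hN k))
      (tendsto_pi_nhds.2 fun ω => ?_)
    rw [tendsto_iff_norm_sub_tendsto_zero]
    have hlim : Tendsto (fun k : ℕ => C * (1 / ((k : ℝ) + 1))) atTop (𝓝 0) := by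
      simpa using tendsto_one_div_add_atTop_nhds_zero_nat.const_mul C
    refine squeeze_zero (fun _ => norm_nonneg _) (fun k => ?_) hlim
    have h1 := (hf.tame ω).antilip _ (y (N k ω)).2 _ ((hf.tame ω).inv_mem hx)
    rw [(hf.tame ω).apply_inv hx] at h1
    exact h1.trans (mul_le_mul_of_nonneg_left (Nat.find_spec (hex k ω)).le (hf.tame ω).nonneg)

end RandomTame

section Knothe

variable {C κ : ℝ} {f : Ω → ℝ × ℝ → ℝ × ℝ}

theorem fderivWithin_translate {E : Type} [NormedAddCommGroup E] [NormedSpace ℝ E]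
    (f : ℝ × ℝ → E) (a : ℝ) (x : ℝ × ℝ) :
    sD (fun x => f (x + (a, 0))) x = sD f (x + (a, 0)) := by
  rw [sD, fderivWithin_comp_add_right, vadd_strip]

omit [MeasurableSpace Ω] in
theorem IsStationary.sD_eq (hf : IsStationary τ f) (ω : Ω) (a : ℝ) {x : ℝ × ℝ} (hx : x ∈ strip) :
    sD (f (τ a ω)) x = sD (f ω) (x + (a, 0)) := by
  rw [sD_congr (fun y hy => hf ω a y hy) hx, sD, fderivWithin_sub_const]
  exact fderivWithin_translate (f ω) a x

omit [MeasurableSpace Ω] in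
theorem IsStationary.jac_eq (hf : IsStationary τ f) (ω : Ω) (a : ℝ) {x : ℝ × ℝ} (hx : x ∈ strip) :
    jac (f (τ a ω)) x = jac (f ω) (x + (a, 0)) := by
  simp only [jac, dqQ, dpQ, dqP, dpP, hf.sD_eq ω a hx]

theorem primitive_congr_translate {g h : ℝ × ℝ → ℝ} {a : ℝ}
    (hgh : ∀ x ∈ strip, g x = h (x + (a, 0))) {x : ℝ × ℝ} (hx : x ∈ strip) :
    primitive g x = primitive h (x + (a, 0)) := by
  have hx2 := mem_strip.1 hx
  simp only [primitive, Prod.snd_add, Prod.fst_add, add_zero]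
  refine intervalIntegral.integral_congr fun u hu => ?_
  simpa using hgh (x.1, u) (mk_mem_strip (uIcc_subset_Icc neg_one_mem hx2 hu))

omit [MeasurableSpace Ω] in
-- The Knothe map at a point depends only on the values and differentials of the map along the
-- vertical line through that point, with no base point on the q-axis, and hence commutes with
-- translations.
theorem IsStationary.knothe (hf : IsStationary τ f) : IsStationary τ fun ω => knothe (f ω) := by
  intro ω a x hx
  have hR : ∀ {x : ℝ × ℝ}, x ∈ strip →
      primitive (jac (f (τ a ω))) x = primitive (jac (f ω)) (x + (a, 0)) := fun hx =>
    primitive_congr_translate (fun y hy => hf.jac_eq ω a hy) hx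
  have hN := primitive_congr_translate (g := fun y => (f (τ a ω) y).2 * dpQ (f (τ a ω)) y)
    (h := fun y => (f ω y).2 * dpQ (f ω) y) (a := a) (fun y hy => by
      simp only [dpQ, hf.sD_eq ω a hy, hf ω a y hy, Prod.snd_sub, sub_zero]) (top_mem_strip x.1)
  have h1 := hf ω a _ (top_mem_strip x.1)
  have h2 := hf ω a _ (bot_mem_strip x.1)
  refine Prod.ext ?_ ?_
  · simp only [RandomTwist.knothe, columnShift, hN, h1, h2, Prod.fst_sub, Prod.fst_add,
      Prod.mk_add_mk, add_zero]
    ring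
  · simp only [RandomTwist.knothe, fibre, hR hx, hR (top_mem_strip x.1), Prod.snd_sub,
      Prod.mk_add_mk, add_zero, sub_zero, Prod.fst_add]

theorem randomTame_knothe (hκ : 0 < κ) (hf : ∀ ω, TameC2 C κ (f ω)) (hs : IsStationary τ f)
    (hm : ∀ x ∈ strip, Measurable fun ω => f ω x) :
    RandomTame τ (TameC2.knotheBound C κ) fun ω => knothe (f ω) where
  tame ω := (hf ω).tame_knothe hκ
  stationary := hs.knothe
  meas x hx := by
    have hd := fun {x : ℝ × ℝ} (hx : x ∈ strip) (v : ℝ × ℝ) =>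
      measurable_sD_apply (fun ω => (hf ω).tame.diff) hm hx v
    have hjac : ∀ x ∈ strip, Measurable fun ω => jac (f ω) x := fun x hx =>
      ((hd hx (1, 0)).fst.mul (hd hx (0, 1)).snd).sub ((hd hx (0, 1)).fst.mul (hd hx (1, 0)).snd)
    have hR := fun {x : ℝ × ℝ} (hx : x ∈ strip) =>
      measurable_primitive (fun ω => (hf ω).c11_jac.diff.continuousOn) hjac hx
    have hN := measurable_primitive (g := fun ω y => (f ω y).2 * dpQ (f ω) y)
      (fun ω => ((hf ω).c11_P.mul (hf ω).c11_dpQ).diff.continuousOn)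
      (fun y hy => (hm y hy).snd.mul (hd hy (0, 1)).fst) (top_mem_strip x.1)
    refine Measurable.prodMk ?_ ?_
    · exact ((((((hm _ (top_mem_strip x.1)).fst.sub_const _).add
        ((hm _ (bot_mem_strip x.1)).fst.sub_const _)).sub hN).const_mul _).const_add _)
    · exact (((hR hx).mul (hR (top_mem_strip x.1)).inv).const_mul 2).add_const _

end Knothe

/-! ### Invariant null sets. -/

section NullSets

variable {Ω : Type*} [TopologicalSpace Ω] [SecondCountableTopology Ω] [MeasurableSpace Ω]
  [BorelSpace Ω] {τ : Flow ℝ Ω} {P : Measure Ω}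

theorem measurable_flow (τ : Flow ℝ Ω) : Measurable fun z : ℝ × Ω => τ z.1 z.2 :=
  τ.cont'.measurable

omit [SecondCountableTopology Ω] [BorelSpace Ω] in
theorem IsInvariantErgodic.measure_preimage (h : IsInvariantErgodic τ P) (a : ℝ) {A : Set Ω}
    (hA : MeasurableSet A) : P (τ a ⁻¹' A) = P A := by
  have e : τ a ⁻¹' A = τ (-a) '' A := by
    ext ω
    constructor
    · intro hω
      exact ⟨τ a ω, hω, by rw [← Flow.map_add, neg_add_cancel, Flow.map_zero_apply]⟩
    · rintro ⟨ω', hω', rfl⟩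
      rw [mem_preimage, ← Flow.map_add, add_neg_cancel, Flow.map_zero_apply]
      exact hω'
  rw [e, h.invariant _ _ hA]

/-- A null set is met by almost no orbit in positive time, and the set of exceptional orbits is
measurable and invariant. -/
theorem IsInvariantErgodic.exists_invariant_null (h : IsInvariantErgodic τ P) {N : Set Ω}
    (hN : P N = 0) : ∃ M : Set Ω, MeasurableSet M ∧ P M = 0 ∧
      (∀ a ω, τ a ω ∈ M ↔ ω ∈ M) ∧ ∀ ω, ω ∉ M → ∃ a, τ a ω ∉ N := by
  have := h.isProbabilityMeasure
  set N' := toMeasurable P N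
  have hN' : MeasurableSet N' := measurableSet_toMeasurable P N
  have hN0 : P N' = 0 := by rw [measure_toMeasurable, hN]
  have hS : MeasurableSet {z : Ω × ℝ | τ z.2 z.1 ∈ N'} :=
    ((measurable_flow τ).comp measurable_swap) hN'
  -- The exceptional orbits are those that spend almost all their time in `N'`. This condition is
  -- invariant because Lebesgue measure is.
  refine ⟨{ω | volume {a | τ a ω ∉ N'} = 0}, ?_, ?_, fun a ω => ?_, fun ω hω => ?_⟩
  · exact (measurable_measure_prodMk_left hS.compl) (measurableSet_singleton 0)
  · have h0 : (P.prod volume) {z : Ω × ℝ | τ z.2 z.1 ∈ N'} = 0 := by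
      rw [Measure.prod_apply_symm hS]
      have : ∀ a : ℝ, P ((fun ω => (ω, a)) ⁻¹' {z : Ω × ℝ | τ z.2 z.1 ∈ N'}) = 0 := fun a => by
        rw [← hN0, ← h.measure_preimage a hN']
        rfl
      exact (lintegral_congr this).trans lintegral_zero
    have h1 := Measure.measure_ae_null_of_prod_null h0
    refine measure_mono_null ?_ (ae_iff.1 h1)
    intro ω hω hω'
    -- By Fubini almost every orbit spends time zero in `N'`; were it also exceptional, the line
    -- would have measure zero.
    have huniv : (univ : Set ℝ) ⊆ {a | τ a ω ∉ N'} ∪ {a | τ a ω ∈ N'} := fun a _ =>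
      (em _).symm
    have h2 := measure_mono_null huniv (measure_union_null hω hω')
    simp at h2
  · have e : {b | τ b (τ a ω) ∉ N'} = (fun b => b + a) ⁻¹' {b | τ b ω ∉ N'} := by
      ext b
      simp [Flow.map_add]
    rw [mem_ofPred_eq, e, measure_preimage_add_right]
    rfl
  · by_contra! hall
    refine hω ?_
    have : {a | τ a ω ∉ N'} = ∅ := by
      ext a
      simpa using subset_toMeasurable P N (hall a)
    rw [mem_ofPred_eq, this, measure_empty]

end NullSets

/-! ### Conjugation by horizontal translations. -/

section Translation

variable {C : ℝ}

theorem IsBoundedInC.translate {r : ℕ} {g : ℝ × ℝ → ℝ × ℝ} (hg : IsBoundedInC r C g) (a : ℝ) :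
    IsBoundedInC r C fun x => g (x + (a, 0)) := by
  refine ⟨hg.1.comp (by fun_prop) fun x hx => strip_add_mem hx a, fun k hk x hx => ?_⟩
  rw [iteratedFDerivWithin_comp_add_right, vadd_strip]
  exact hg.2 k hk _ (strip_add_mem hx a)

theorem IsBoundedInC.congr {r : ℕ} {g h : ℝ × ℝ → ℝ × ℝ} (hg : IsBoundedInC r C g)
    (hgh : EqOn h g strip) : IsBoundedInC r C h := by
  refine ⟨hg.1.congr hgh, fun k hk x hx => ?_⟩
  rw [iteratedFDerivWithin_congr hgh hx]
  exact hg.2 k hk x hx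

theorem isBoundedInC_zero {r : ℕ} (hC : 0 ≤ C) : IsBoundedInC r C fun _ => 0 := by
  refine ⟨contDiffOn_const, fun k _ x _ => ?_⟩
  rw [iteratedFDerivWithin_fun_zero]
  simpa using hC

theorem IsBoundedInC.of_le {r r' : ℕ} {g : ℝ × ℝ → ℝ × ℝ} (hg : IsBoundedInC r C g)
    (h : r' ≤ r) : IsBoundedInC r' C g :=
  ⟨hg.1.of_le (by exact_mod_cast h), fun k hk x hx => hg.2 k (hk.trans h) x hx⟩

theorem IsStripDiffeo.of_le {r r' : ℕ} {f : ℝ × ℝ → ℝ × ℝ} (hf : IsStripDiffeo r f)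
    (h : r' ≤ r) : IsStripDiffeo r' f :=
  ⟨hf.bijOn, hf.contDiffOn.of_le (by exact_mod_cast h), hf.contDiffOn_inv.of_le (by exact_mod_cast h)⟩

/-- The conjugate of `f` by a horizontal translation. -/
def translate (a : ℝ) (f : ℝ × ℝ → ℝ × ℝ) (x : ℝ × ℝ) : ℝ × ℝ := f (x + (a, 0)) - (a, 0)

theorem bijOn_translate {f : ℝ × ℝ → ℝ × ℝ} (hf : BijOn f strip strip) (a : ℝ) :
    BijOn (translate a f) strip strip := by
  refine ⟨fun x hx => strip_sub_mem (hf.mapsTo (strip_add_mem hx a)) a, fun x hx y hy h => ?_,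
    fun x hx => ?_⟩
  · exact add_right_cancel (hf.injOn (strip_add_mem hx a) (strip_add_mem hy a)
      (sub_left_injective h))
  · obtain ⟨y, hy, hyx⟩ := hf.surjOn (strip_add_mem hx a)
    exact ⟨y - (a, 0), strip_sub_mem hy a, by rw [translate, sub_add_cancel, hyx, add_sub_cancel_right]⟩

theorem stripInv_translate {f : ℝ × ℝ → ℝ × ℝ} (hf : BijOn f strip strip) (a : ℝ) :
    EqOn (stripInv (translate a f)) (translate a (stripInv f)) strip := by
  refine stripInv_eqOn_of_rightInv (bijOn_translate hf a).injOn
    (fun x hx => strip_sub_mem (stripInv_mem hf.surjOn (strip_add_mem hx a)) a) fun x hx => ?_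
  rw [translate, translate, sub_add_cancel, apply_stripInv hf.surjOn (strip_add_mem hx a),
    add_sub_cancel_right]

theorem contDiffOn_translate {r : ℕ} {f : ℝ × ℝ → ℝ × ℝ} (hf : ContDiffOn ℝ r f strip) (a : ℝ) :
    ContDiffOn ℝ r (translate a f) strip :=
  (hf.comp (by fun_prop) fun x hx => strip_add_mem hx a).sub contDiffOn_const

/-- Moving ω along the flow conjugates its lift by a translation, so this transports goodness along
an orbit with the same constant. -/
theorem GoodPath.translate {f : ℝ → ℝ × ℝ → ℝ × ℝ} (hf : GoodPath C f) (a : ℝ) :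
    GoodPath C fun t => translate a (f t) where
  zero x hx := by
    rw [RandomTwist.translate, hf.zero (strip_add_mem hx a)]
    simp
  diffeo t ht := by
    have h := hf.diffeo t ht
    exact ⟨bijOn_translate h.bijOn a, contDiffOn_translate h.contDiffOn a,
      (contDiffOn_translate h.contDiffOn_inv a).congr (stripInv_translate h.bijOn a)⟩
  differentiable t ht x hx :=
    (hf.differentiable t ht _ (strip_add_mem hx a)).sub_const _
  velocity t ht := by
    refine ((hf.velocity t ht).translate a).congr fun x _ => ?_
    simp only [RandomTwist.translate]
    exact derivWithin_sub_const _
  displacement t ht := by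
    refine ((hf.displacement t ht).translate a).congr fun x _ => ?_
    simp only [RandomTwist.translate]
    abel
  inv_displacement t ht := by
    refine ((hf.inv_displacement t ht).translate a).congr fun x hx => ?_
    simp only
    rw [stripInv_translate (hf.diffeo t ht).bijOn a hx, RandomTwist.translate]
    abel
  det_one x hx := by
    have : sD (RandomTwist.translate a (f 1)) x = sD (f 1) (x + (a, 0)) := by
      unfold RandomTwist.translate
      rw [sD, fderivWithin_sub_const]
      exact fderivWithin_translate (f 1) a x
    rw [this]
    exact hf.det_one _ (strip_add_mem hx a)

theorem stripInv_id : EqOn (stripInv id) id strip :=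
  stripInv_eqOn_of_rightInv (injOn_id _) (mapsTo_id _) fun _ _ => rfl

theorem goodPath_id (hC : 0 ≤ C) : GoodPath C fun _ => id where
  zero _ _ := rfl
  diffeo _ _ := ⟨bijOn_id _, contDiffOn_id, contDiffOn_id.congr stripInv_id⟩
  differentiable _ _ _ _ := differentiableWithinAt_const _
  velocity t _ := (isBoundedInC_zero hC).congr fun x _ => by simp
  displacement _ _ := (isBoundedInC_zero hC).congr fun x _ => by simp
  inv_displacement _ _ := (isBoundedInC_zero hC).congr fun x hx => by
    simp [stripInv_id hx]
  det_one x hx := by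
    rw [sD, fderivWithin_id (uniqueDiffOn_strip x hx)]
    simp [ContinuousLinearMap.det]

end Translation

/-! ### From the isotopy to a random good path. -/

section Lift

variable {Ω : Type*} [TopologicalSpace Ω] {τ : Flow ℝ Ω}

theorem lift_flow (G : Ω → ℝ → ℝ × ℝ) (ω : Ω) (a : ℝ) (x : ℝ × ℝ) :
    lift τ G (τ a ω) x = lift τ G ω (x + (a, 0)) - (a, 0) := by
  refine Prod.ext ?_ ?_
  · simp only [lift, Prod.fst_add, Prod.snd_add, add_zero, Prod.fst_sub, Flow.map_add]
    ring
  · simp only [lift, Prod.fst_add, Prod.snd_add, add_zero, Prod.snd_sub, sub_zero, Flow.map_add]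

variable [MeasurableSpace Ω] {P : Measure Ω}

theorem measurable_lift [SecondCountableTopology Ω] [BorelSpace Ω] {G : Ω → ℝ → ℝ × ℝ}
    (hG : IsGenerator G) {x : ℝ × ℝ} (hx : x ∈ strip) : Measurable fun ω => lift τ G ω x := by
  have h : Measurable fun ω : Ω => G (τ x.1 ω) x.2 :=
    hG.measurable.comp (((τ.continuous continuous_const continuous_id).measurable).prodMk
      (measurable_const (a := (⟨x.2, mem_strip.1 hx⟩ : Icc (-1 : ℝ) 1))))
  exact (h.fst.const_add _).prodMk h.snd

/-- Almost every path of an isotopy to an area-preserving twist is a good path. -/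
theorem IsIsotopy.exists_goodPath {F : Ω → ℝ → ℝ × ℝ} {Φ : ℝ → Ω → ℝ → ℝ × ℝ} {r : ℕ}
    (hr : 3 ≤ r) (hF : ∀ᵐ ω ∂P, IsAreaPreservingDiffeo (lift τ F ω))
    (hΦ : IsIsotopy τ P r F Φ) : ∃ C, ∀ᵐ ω ∂P, GoodPath C (fun t => lift τ (Φ t) ω) ∧
      EqOn (lift τ (Φ 1) ω) (lift τ F ω) strip := by
  obtain ⟨C, hC⟩ := hΦ.regular
  refine ⟨C, ?_⟩
  filter_upwards [hC, hF, hΦ.at_zero, hΦ.at_one, hΦ.isStripDiffeo, hΦ.differentiable]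
    with ω h1 h2 h3 h4 h5 h6
  refine ⟨⟨h3, fun t ht => (h5 t ht).of_le hr, h6, fun t ht => (h1 t ht).1.of_le hr,
    fun t ht => (h1 t ht).2.1.of_le hr, fun t ht => (h1 t ht).2.2.of_le hr, fun x hx => ?_⟩, h4⟩
  rw [sD_congr h4 hx]
  exact h2.det_eq_one x hx

/-- After a modification on an invariant null set, every path of the isotopy is good. -/
theorem IsIsotopy.exists_random_goodPath [SecondCountableTopology Ω] [BorelSpace Ω]
    (hP : IsInvariantErgodic τ P) {F : Ω → ℝ → ℝ × ℝ} {Φ : ℝ → Ω → ℝ → ℝ × ℝ} {r : ℕ}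
    (hr : 3 ≤ r) (hF : ∀ᵐ ω ∂P, IsAreaPreservingDiffeo (lift τ F ω))
    (hΦ : IsIsotopy τ P r F Φ) :
    ∃ (C : ℝ) (M : Set Ω) (f : ℝ → Ω → ℝ × ℝ → ℝ × ℝ), MeasurableSet M ∧ P M = 0 ∧
      (∀ a ω, τ a ω ∈ M ↔ ω ∈ M) ∧ (∀ ω, GoodPath C fun t => f t ω) ∧
      (∀ t, IsStationary τ (f t)) ∧
      (∀ t ∈ Icc (0 : ℝ) 1, ∀ x ∈ strip, Measurable fun ω => f t ω x) ∧
      ∀ ω, ω ∉ M → EqOn (f 1 ω) (lift τ F ω) strip := by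
  classical
  have := hP.isProbabilityMeasure
  obtain ⟨C, hC⟩ := hΦ.exists_goodPath hr hF
  have hC0 : 0 ≤ C := hC.exists.choose_spec.1.nonneg
  obtain ⟨M, hM, hM0, hinv, hgood⟩ := hP.exists_invariant_null (ae_iff.1 hC)
  have key : ∀ ω, ω ∉ M → GoodPath C (fun t => lift τ (Φ t) ω) ∧
      EqOn (lift τ (Φ 1) ω) (lift τ F ω) strip := by
    intro ω hω
    obtain ⟨a, ha⟩ := hgood ω hω
    rw [mem_ofPred_eq, not_not] at ha
    -- One good time on the orbit suffices: the lift at ω is a translate of the lift at `τ a ω`.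
    have e : ∀ (G : Ω → ℝ → ℝ × ℝ) (x : ℝ × ℝ),
        lift τ G ω x = translate (-a) (lift τ G (τ a ω)) x := fun G x => by
      have e1 : ((-a, 0) : ℝ × ℝ) + (a, 0) = 0 := by ext <;> simp
      rw [translate, lift_flow, add_assoc, e1, add_zero, sub_sub, add_comm (a, (0 : ℝ)), e1, sub_zero]
    refine ⟨?_, fun x hx => ?_⟩
    · have := ha.1.translate (-a)
      refine (funext fun t => funext fun x => ?_ : (fun t => lift τ (Φ t) ω) = _) ▸ this
      exact e (Φ t) x
    · rw [e, e, translate, translate, ha.2 (strip_add_mem hx (-a))]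
  refine ⟨C, M, fun t ω => if ω ∈ M then id else lift τ (Φ t) ω, hM, hM0, hinv, fun ω => ?_,
    fun t ω a x hx => ?_, fun t ht x hx => ?_, fun ω hω => ?_⟩
  · by_cases hω : ω ∈ M
    · simp only [if_pos hω]
      exact goodPath_id hC0
    · simp only [if_neg hω]
      exact (key ω hω).1
  · by_cases hω : ω ∈ M
    · simp [if_pos hω, if_pos ((hinv a ω).2 hω)]
    · simp only [if_neg hω, if_neg fun h => hω ((hinv a ω).1 h)]
      exact lift_flow _ _ _ _
  · have : Measurable fun ω => if ω ∈ M then x else lift τ (Φ t) ω x :=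
      Measurable.ite hM measurable_const (measurable_lift (hΦ.isGenerator t ht) hx)
    convert this using 2 with ω
    by_cases hω : ω ∈ M
    · simp only [if_pos hω, id]
    · simp only [if_neg hω]
  · simp only [if_neg hω]
    exact (key ω hω).2

end Lift

/-! ### Shears and monotone twists. -/

/-- The shear `(q, p) ↦ (q + s p, p)`. -/
def shear (s : ℝ) (x : ℝ × ℝ) : ℝ × ℝ := (x.1 + s * x.2, x.2)

theorem shear_mem {x : ℝ × ℝ} (hx : x ∈ strip) (s : ℝ) : shear s x ∈ strip := hx

theorem shear_neg_shear (s : ℝ) (x : ℝ × ℝ) : shear (-s) (shear s x) = x := by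
  ext <;> simp [shear]

theorem shear_shear_neg (s : ℝ) (x : ℝ × ℝ) : shear s (shear (-s) x) = x := by
  ext <;> simp [shear]

/-- The shear as a linear map. -/
def shearL (s : ℝ) : ℝ × ℝ →L[ℝ] ℝ × ℝ :=
  (ContinuousLinearMap.fst ℝ ℝ ℝ + s • ContinuousLinearMap.snd ℝ ℝ ℝ).prod
    (ContinuousLinearMap.snd ℝ ℝ ℝ)

theorem shearL_apply (s : ℝ) (x : ℝ × ℝ) : shearL s x = shear s x := rfl

theorem norm_shear_le (s : ℝ) (x : ℝ × ℝ) : ‖shear s x‖ ≤ (1 + |s|) * ‖x‖ := by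
  have h1 := norm_fst_le x
  have h2 := norm_snd_le x
  refine (Prod.norm_def _).trans_le (max_le ?_ ?_)
  · calc ‖x.1 + s * x.2‖ ≤ ‖x.1‖ + |s| * ‖x.2‖ := by
          refine (norm_add_le _ _).trans_eq ?_
          rw [norm_mul, Real.norm_eq_abs s]
      _ ≤ ‖x‖ + |s| * ‖x‖ := by gcongr
      _ = _ := by ring
  · refine h2.trans (le_mul_of_one_le_left (norm_nonneg _) ?_)
    linarith [abs_nonneg s]

theorem sD_shear (s : ℝ) {x : ℝ × ℝ} (hx : x ∈ strip) : sD (shear s) x = shearL s :=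
  (shearL s).hasFDerivWithinAt.fderivWithin (uniqueDiffOn_strip x hx)

theorem shear_sub (s : ℝ) (x y : ℝ × ℝ) : shear s x - shear s y = shear s (x - y) :=
  ((shearL s).map_sub x y).symm

theorem tame_shear (s : ℝ) : Tame (1 + |s|) (shear s) where
  bijOn := ⟨fun x hx => shear_mem hx s, fun x _ y _ h => by
    rw [← shear_neg_shear s x, h, shear_neg_shear], fun x hx =>
    ⟨shear (-s) x, shear_mem hx _, shear_shear_neg s x⟩⟩
  top q := rfl
  bot q := rfl
  diff := (shearL s).differentiable.differentiableOn
  norm_le x hx := by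
    rw [sD_shear s hx]
    exact ContinuousLinearMap.opNorm_le_bound _ (by positivity) (norm_shear_le s)
  lip x hx y hy := by
    rw [sD_shear s hx, sD_shear s hy, sub_self, norm_zero]
    positivity
  antilip x _ y _ := by
    rw [shear_sub]
    have := norm_shear_le (-s) (shear s (x - y))
    rwa [shear_neg_shear, abs_neg] at this
  disp x hx := by
    have e : shear s x - x = (s * x.2, 0) := by ext <;> simp [shear]
    have h2 : |x.2| ≤ 1 := abs_le.2 (mem_strip.1 hx)
    rw [e]
    refine (Prod.norm_def _).trans_le (max_le ?_ ?_)
    · rw [Real.norm_eq_abs, abs_mul]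
      have := mul_le_mul_of_nonneg_left h2 (abs_nonneg s)
      linarith
    · rw [norm_zero]; positivity

theorem det_shearL (s : ℝ) : (shearL s).det = 1 := by
  rw [det_eq_entries]
  simp [shearL_apply, shear]

theorem isStep_id : IsStep 1 (id : ℝ × ℝ → ℝ × ℝ) where
  tame := Tame.identity
  det_one x hx := by
    rw [sD, fderivWithin_id (uniqueDiffOn_strip x hx)]
    simp [ContinuousLinearMap.det]
  half_le x hx := by
    rw [dqQ, sD, fderivWithin_id (uniqueDiffOn_strip x hx)]
    norm_num

namespace IsStep

variable {K : ℝ} {ψ : ℝ × ℝ → ℝ × ℝ} (hψ : IsStep K ψ)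
include hψ

theorem isAreaPreservingDiffeo_comp_shear (s : ℝ) : IsAreaPreservingDiffeo (ψ ∘ shear s) where
  isStripDiffeo := (hψ.tame.comp (tame_shear s)).isStripDiffeo
  det_eq_one x hx := by
    change (sD (ψ ∘ shear s) x).det = 1
    have := hψ.tame.sD_comp (tame_shear s) hx
    rw [this, sD_shear s hx]
    have h1 : ((sD ψ (shear s x)).comp (shearL s)).det =
        (sD ψ (shear s x)).det * (shearL s).det := by
      simp only [ContinuousLinearMap.det, ContinuousLinearMap.toLinearMap_comp, LinearMap.det_comp]
    rw [h1, det_shearL, hψ.det_one _ (shear_mem hx s), one_mul]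

theorem strictMono_horizontal {p : ℝ} (hp : p ∈ Icc (-1 : ℝ) 1) (c : ℝ) :
    StrictMono fun q => (ψ (q + c, p)).1 := by
  have hd : ∀ q, HasDerivAt (fun q => (ψ (q + c, p)).1) (dqQ ψ (q + c, p)) q := by
    intro q
    have h1 := (hψ.tame.hasFDerivWithinAt (mk_mem_strip (q := q + c) hp)).comp_hasDerivWithinAt
      (s := univ) q (((hasDerivAt_id q).add_const c).prodMk (hasDerivAt_const q p)).hasDerivWithinAt
      (fun u _ => mk_mem_strip hp)
    rw [hasDerivWithinAt_univ] at h1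
    exact h1.fst
  refine strictMono_of_deriv_pos fun q => ?_
  rw [(hd q).deriv]
  linarith [hψ.half_le _ (mk_mem_strip (q := q + c) hp)]

/-- The derivative is s ∂Q/∂q + ∂Q/∂p ≥ s/2 − K > 0. -/
theorem strictMonoOn_vertical {s : ℝ} (hs : 2 * K < s) (c : ℝ) :
    StrictMonoOn (fun p => (ψ (c + s * p, p)).1) (Icc (-1) 1) := by
  have hd : ∀ p ∈ Icc (-1 : ℝ) 1, HasDerivWithinAt (fun p => (ψ (c + s * p, p)).1)
      (sD ψ (c + s * p, p) (s, 1)).1 (Icc (-1) 1) p := by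
    intro p hp
    have h0 : HasDerivWithinAt (fun p : ℝ => (c + s * p, p)) (s, 1) (Icc (-1) 1) p := by
      have := (((hasDerivAt_id p).const_mul s).const_add c).prodMk (hasDerivAt_id p)
      simpa using this.hasDerivWithinAt
    have hx := mk_mem_strip (q := c + s * p) hp
    exact (HasFDerivWithinAt.comp_hasDerivWithinAt (f := fun p : ℝ => (c + s * p, p)) p
      (hψ.tame.hasFDerivWithinAt hx) h0
      fun u hu => mk_mem_strip (q := c + s * u) hu).fst
  refine strictMonoOn_of_deriv_pos (convex_Icc _ _) (fun p hp => (hd p hp).continuousWithinAt)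
    fun p hp => ?_
  rw [interior_Icc] at hp
  have hp' := Ioo_subset_Icc_self hp
  rw [((hd p hp').hasDerivAt (Icc_mem_nhds hp.1 hp.2)).deriv]
  have hx := mk_mem_strip (q := c + s * p) hp'
  have h1 := hψ.half_le _ hx
  have h2 : |dpQ ψ (c + s * p, p)| ≤ K :=
    (norm_fst_le (sD ψ (c + s * p, p) (0, 1))).trans
      (((sD ψ _).le_of_opNorm_le (hψ.tame.norm_le _ hx) _).trans
        (mul_le_of_le_one_right hψ.tame.nonneg norm_zero_one_le))
  have e : (sD ψ (c + s * p, p) (s, 1)).1 = s * dqQ ψ (c + s * p, p) + dpQ ψ (c + s * p, p) := by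
    have : ((s, 1) : ℝ × ℝ) = s • ((1 : ℝ), (0 : ℝ)) + ((0 : ℝ), (1 : ℝ)) := by simp
    rw [this, map_add, map_smul]
    rfl
  rw [e]
  have := (abs_le.1 h2).1
  have hK := hψ.tame.nonneg
  nlinarith

end IsStep

section Random

variable {Ω : Type*} [TopologicalSpace Ω] [MeasurableSpace Ω] {τ : Flow ℝ Ω} {P : Measure Ω}

/-- A stationary, measurable random step. -/
structure IsRandomStep (τ : Flow ℝ Ω) (K : ℝ) (ψ : Ω → ℝ × ℝ → ℝ × ℝ) : Prop where
  step : ∀ ω, IsStep K (ψ ω)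
  stationary : IsStationary τ ψ
  meas : ∀ x ∈ strip, Measurable fun ω => ψ ω x

theorem isRandomStep_id (τ : Flow ℝ Ω) : IsRandomStep τ 1 fun _ => id where
  step _ := isStep_id
  stationary ω a x _ := by simp
  meas x _ := measurable_const

omit [TopologicalSpace Ω] [MeasurableSpace Ω] in
/-- The generator of the composition of `ψ` with a shear. -/
def shearGen (s : ℝ) (ψ : Ω → ℝ × ℝ → ℝ × ℝ) (ω : Ω) (p : ℝ) : ℝ × ℝ := ψ ω (s * p, p)

namespace IsRandomStep

variable {K : ℝ} {ψ : Ω → ℝ × ℝ → ℝ × ℝ} (hψ : IsRandomStep τ K ψ) (s : ℝ)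
include hψ

/-- A stationary map is recovered from its values on the line q = 0, here those of `ψ ω ∘ shear s`.
-/
theorem lift_shearGen (ω : Ω) : EqOn (ψ ω ∘ shear s) (lift τ (shearGen s ψ) ω) strip := by
  intro x hx
  have hx' : (s * x.2, x.2) ∈ strip := hx
  have e : ((s * x.2, x.2) : ℝ × ℝ) + (x.1, 0) = shear s x := by
    ext <;> simp [shear, add_comm]
  refine Prod.ext ?_ ?_ <;>
    simp [lift, shearGen, hψ.stationary ω x.1 _ hx', e]

theorem isGenerator : IsGenerator (shearGen s ψ) where
  measurable := by
    have h := measurable_uncurry_clamp (fun ω => (hψ.step ω).tame.diff.continuousOn) hψ.meas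
    have h2 : Measurable fun z : Ω × Icc (-1 : ℝ) 1 => (z.1, (s * (z.2 : ℝ), (z.2 : ℝ))) := by
      fun_prop
    convert h.comp h2 using 1
    funext z
    simp only [shearGen, Function.comp_apply]
    rw [clamp_eq (mk_mem_strip z.2.2)]
  mapsTo ω p hp := (hψ.step ω).tame.mem (mk_mem_strip hp)

theorem tame_lift (ω : Ω) : Tame (K * (1 + |s|) ^ 2 + K * (1 + |s|) + K + (1 + |s|))
    (lift τ (shearGen s ψ) ω) :=
  ((hψ.step ω).tame.comp (tame_shear s)).congr (hψ.lift_shearGen s ω)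

theorem isRegular : IsRegular τ P (shearGen s ψ) := by
  refine ⟨_, Eventually.of_forall fun ω x hx => ⟨?_, (hψ.tame_lift s ω).inv.norm_le x hx⟩⟩
  refine ((hψ.tame_lift s ω).norm_le x hx).trans (le_add_of_nonneg_right ?_)
  have := (hψ.tame_lift s ω).nonneg
  positivity

theorem isPositiveMonotoneTwist [IsProbabilityMeasure P] (hs : 2 * K < s) :
    IsPositiveMonotoneTwist τ P (shearGen s ψ) where
  isTwist :=
    { isGenerator := hψ.isGenerator s
      area_preserving := Eventually.of_forall fun ω => by
        have h := (hψ.step ω).isAreaPreservingDiffeo_comp_shear s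
        refine ⟨(hψ.tame_lift s ω).isStripDiffeo, fun x hx => ?_⟩
        change (sD (lift τ (shearGen s ψ) ω) x).det = 1
        rw [← sD_congr (hψ.lift_shearGen s ω) hx]
        exact h.det_eq_one x hx
      boundary_invariance := Eventually.of_forall fun ω q =>
        ⟨(hψ.tame_lift s ω).top q, (hψ.tame_lift s ω).bot q⟩
      boundary_increasing := Eventually.of_forall fun ω => by
        refine ⟨?_, ?_⟩
        · simp_rw [← hψ.lift_shearGen s ω (top_mem_strip _)]
          exact (hψ.step ω).strictMono_horizontal one_mem (s * 1)
        · simp_rw [← hψ.lift_shearGen s ω (bot_mem_strip _)]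
          exact (hψ.step ω).strictMono_horizontal neg_one_mem (s * -1)
      boundary_twisting := Eventually.of_forall fun ω q => by
        have hT := (hψ.step (τ q ω)).tame
        have hK := hT.nonneg
        have h1 := abs_le.1 ((norm_fst_le _).trans (hT.disp (s * 1, 1) (top_mem_strip _)))
        have h2 := abs_le.1 ((norm_fst_le _).trans (hT.disp (s * -1, -1) (bot_mem_strip _)))
        simp only [Prod.fst_sub] at h1 h2
        simp only [shearGen]
        constructor <;> linarith [h1.1, h1.2, h2.1, h2.2]
      finite_second_moment := by
        refine (iSup₂_le (a := ENNReal.ofReal ((|s| + K) ^ 2 + 1)) fun p hp => ?_).trans_lt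
          ENNReal.ofReal_lt_top
        have hbound : ∀ ω, (shearGen s ψ ω p).1 ^ 2 + (shearGen s ψ ω p).2 ^ 2 ≤
            (|s| + K) ^ 2 + 1 := by
          intro ω
          have hT := (hψ.step ω).tame
          have h1 := (norm_fst_le _).trans (hT.disp (s * p, p) (mk_mem_strip hp))
          have h2 := abs_le.2 (mem_strip.1 (hT.mem (mk_mem_strip (q := s * p) hp)))
          have h3 : |s * p| ≤ |s| := by
            rw [abs_mul]
            exact mul_le_of_le_one_right (abs_nonneg _) (abs_le.2 hp)
          have h4 : |(ψ ω (s * p, p)).1| ≤ |s| + K := by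
            rw [Prod.fst_sub, Real.norm_eq_abs] at h1
            have := abs_add_le ((ψ ω (s * p, p)).1 - s * p) (s * p)
            rw [sub_add_cancel] at this
            linarith
          refine add_le_add (sq_le_sq' ?_ ?_) ?_
          · exact (abs_le.1 h4).1
          · exact (abs_le.1 h4).2
          · rw [← sq_abs]
            exact pow_le_one₀ (abs_nonneg _) h2
        calc ∫⁻ ω, ENNReal.ofReal ((shearGen s ψ ω p).1 ^ 2 + (shearGen s ψ ω p).2 ^ 2) ∂P
            ≤ ∫⁻ _, ENNReal.ofReal ((|s| + K) ^ 2 + 1) ∂P :=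
              lintegral_mono fun ω => ENNReal.ofReal_le_ofReal (hbound ω)
          _ = _ := by simp }
  increasing := Eventually.of_forall fun ω q => by
    have := (hψ.step (τ q ω)).strictMonoOn_vertical hs 0
    simpa only [shearGen, zero_add] using this

end IsRandomStep

/-- The inverse shear is the identity step, of constant 1, composed with `shear s`; hence the
threshold 2. -/
theorem isNegativeMonotoneTwist_shear [IsProbabilityMeasure P] {s : ℝ} (hs : 2 < s) :
    IsNegativeMonotoneTwist τ P (shearGen (-s) fun _ => id) where
  isGenerator := (isRandomStep_id τ).isGenerator _
  isInverse := by
    have hid := isRandomStep_id τ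
    refine ⟨shearGen s fun _ => id, hid.isPositiveMonotoneTwist s (by linarith),
      Eventually.of_forall fun ω => ⟨fun x hx => ?_, fun x hx => ?_⟩⟩
    · rw [← hid.lift_shearGen s ω hx]
      exact (hid.lift_shearGen (-s) ω (shear_mem hx s)).symm.trans (shear_neg_shear s x)
    · rw [← hid.lift_shearGen (-s) ω hx]
      exact (hid.lift_shearGen s ω (shear_mem hx (-s))).symm.trans (shear_shear_neg s x)

section Congr

variable {G G' : Ω → ℝ → ℝ × ℝ} (h : ∀ᵐ ω ∂P, ∀ q, G' (τ q ω) = G (τ q ω))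
include h

/-- A lift reads its generator along the whole orbit, so agreement is required at every `τ q ω`.
Modification on an invariant null set provides this. -/
theorem lift_ae_eq : ∀ᵐ ω ∂P, lift τ G' ω = lift τ G ω := by
  filter_upwards [h] with ω hω
  funext x
  simp only [lift, hω]

theorem IsRegular.congr (hG : IsRegular τ P G) : IsRegular τ P G' := by
  obtain ⟨C, hC⟩ := hG
  refine ⟨C, ?_⟩
  filter_upwards [hC, lift_ae_eq h] with ω h1 h2
  rwa [h2]

theorem IsAreaPreservingRandomTwist.congr (hG : IsAreaPreservingRandomTwist τ P G)
    (hG' : IsGenerator G') : IsAreaPreservingRandomTwist τ P G' where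
  isGenerator := hG'
  area_preserving := by
    filter_upwards [hG.area_preserving, lift_ae_eq h] with ω h1 h2
    rwa [h2]
  boundary_invariance := by
    filter_upwards [hG.boundary_invariance, lift_ae_eq h] with ω h1 h2
    rwa [h2]
  boundary_increasing := by
    filter_upwards [hG.boundary_increasing, lift_ae_eq h] with ω h1 h2
    rwa [h2]
  boundary_twisting := by
    filter_upwards [hG.boundary_twisting, h] with ω h1 h2
    simpa only [h2] using h1
  finite_second_moment := by
    have e : ∀ p, ∫⁻ ω, ENNReal.ofReal ((G' ω p).1 ^ 2 + (G' ω p).2 ^ 2) ∂P =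
        ∫⁻ ω, ENNReal.ofReal ((G ω p).1 ^ 2 + (G ω p).2 ^ 2) ∂P := fun p => by
      refine lintegral_congr_ae ?_
      filter_upwards [h] with ω hω
      have := hω 0
      rw [Flow.map_zero_apply] at this
      rw [this]
    simp_rw [e]
    exact hG.finite_second_moment

theorem IsPositiveMonotoneTwist.congr (hG : IsPositiveMonotoneTwist τ P G)
    (hG' : IsGenerator G') : IsPositiveMonotoneTwist τ P G' where
  isTwist := hG.isTwist.congr h hG'
  increasing := by
    filter_upwards [hG.increasing, h] with ω h1 h2
    simpa only [h2] using h1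

theorem IsNegativeMonotoneTwist.congr (hG : IsNegativeMonotoneTwist τ P G)
    (hG' : IsGenerator G') : IsNegativeMonotoneTwist τ P G' where
  isGenerator := hG'
  isInverse := by
    obtain ⟨F, hF, hinv⟩ := hG.isInverse
    refine ⟨F, hF, ?_⟩
    filter_upwards [hinv, lift_ae_eq h] with ω h1 h2
    rwa [h2]

end Congr

end Random

/-! ### The alternating decomposition. -/

section Decomposition

variable {Ω : Type*} [TopologicalSpace Ω] [MeasurableSpace Ω] {τ : Flow ℝ Ω} {P : Measure Ω}

theorem RandomTame.isRandomStep {C K : ℝ} {ψ : Ω → ℝ × ℝ → ℝ × ℝ} (h : RandomTame τ C ψ)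
    (hψ : ∀ ω, IsStep K (ψ ω)) : IsRandomStep τ K ψ := ⟨hψ, h.stationary, h.meas⟩

/-- The end of a random good path is a composition of random steps. -/
theorem exists_isRandomStep [Nonempty Ω] {C : ℝ} {f : ℝ → Ω → ℝ × ℝ → ℝ × ℝ}
    (hf : ∀ ω, GoodPath C fun t => f t ω) (hs : ∀ t, IsStationary τ (f t))
    (hm : ∀ t ∈ Icc (0 : ℝ) 1, ∀ x ∈ strip, Measurable fun ω => f t ω x) :
    ∃ (K : ℝ) (n : ℕ) (ψ : ℕ → Ω → ℝ × ℝ → ℝ × ℝ), (∀ i ≤ n, IsRandomStep τ K (ψ i)) ∧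
      ∀ ω, EqOn (compUpTo (fun i => ψ i ω) n) (f 1 ω) strip := by
  have hC := (hf (Classical.arbitrary Ω)).nonneg
  obtain ⟨K, n, hn, hK⟩ := exists_isStep C
  have hn' : (0 : ℝ) < n := by exact_mod_cast hn
  have hmem : ∀ i ≤ n, (i : ℝ) / n ∈ Icc (0 : ℝ) 1 := fun i hi =>
    ⟨by positivity, (div_le_one hn').2 (by exact_mod_cast hi)⟩
  have hknothe : ∀ t ∈ Icc (0 : ℝ) 1, RandomTame τ _ fun ω => knothe (f t ω) := fun t ht =>
    randomTame_knothe (κ := pathJac C) (C := C + 1) (pathJac_pos hC)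
      (fun ω => (hf ω).tameC2 ht) (hs t) (hm t ht)
  have hpath : ∀ t ∈ Icc (0 : ℝ) 1, RandomTame τ (C + 1) (f t) := fun t ht =>
    ⟨fun ω => (hf ω).tame ht, hs t, hm t ht⟩
  have harea : ∀ t ∈ Icc (0 : ℝ) 1, RandomTame τ _ fun ω => areaPart (f t ω) := fun t ht =>
    (hpath t ht).comp (hknothe t ht).inv
  -- The Knothe map of the endpoint acts first, at index 0, followed by `n` quotients of
  -- area-preserving parts: `n + 1` steps in all.
  let ψ : ℕ → Ω → ℝ × ℝ → ℝ × ℝ := fun i ω => match i with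
    | 0 => knothe (f 1 ω)
    | i + 1 => stepMap (f ((i : ℝ) / n) ω) (f (((i + 1 : ℕ) : ℝ) / n) ω)
  have h1 : (1 : ℝ) ∈ Icc (0 : ℝ) 1 := by norm_num
  have hψ : ∀ i ≤ n, IsRandomStep τ K (ψ i) := by
    intro i hi
    match i with
    | 0 => exact (hknothe 1 h1).isRandomStep fun ω => (hK (hf ω)).1
    | i + 1 =>
      have hi0 := hmem i (by omega)
      have hi1 := hmem (i + 1) hi
      refine ((harea _ hi1).comp (harea _ hi0).inv).isRandomStep fun ω =>
        (hK (hf ω)).2 _ hi0 _ hi1 ?_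
      rw [← sub_div, abs_of_nonneg (by push_cast; simp)]
      push_cast
      rw [add_sub_cancel_left]
  refine ⟨K, n, ψ, hψ, fun ω => ?_⟩
  have key : ∀ i ≤ n, EqOn (compUpTo (fun i => ψ i ω) i)
      (areaPart (f ((i : ℝ) / n) ω) ∘ knothe (f 1 ω)) strip := by
    intro i
    induction i with
    | zero =>
      intro _ x hx
      have := (hf ω).areaPart_zero (((hf ω).tame_knothe h1).mem hx)
      simp only [Nat.cast_zero, zero_div]
      exact this.symm
    | succ i ih =>
      intro hi x hx
      have hi0 := hmem i (by omega)
      have h2 := ih (by omega) hx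
      have hy := ((hf ω).tame_knothe h1).mem hx
      change stepMap _ _ (compUpTo (fun i => ψ i ω) i x) = _
      rw [h2, stepMap, Function.comp_apply, Function.comp_apply, Function.comp_apply,
        ((harea _ hi0).tame ω).inv_apply hy]
  intro x hx
  rw [key n le_rfl hx, div_self hn'.ne']
  exact (hf ω).areaPart_knothe h1 hx

/-- Each random step is a monotone twist after a shear, so that a composition of random steps is a
composition of alternating monotone twists. -/
theorem compUpTo_shearGen {K s : ℝ} {n : ℕ} {ψ : ℕ → Ω → ℝ × ℝ → ℝ × ℝ}
    (hψ : ∀ i ≤ n, IsRandomStep τ K (ψ i)) (G : ℕ → Ω → ℝ → ℝ × ℝ)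
    (h0 : ∀ i, G (2 * i) = shearGen (-s) fun _ => id)
    (h1 : ∀ i, G (2 * i + 1) = shearGen s (ψ i)) (ω : Ω) :
    EqOn (compUpTo (fun j => lift τ (G j) ω) (2 * n + 1)) (compUpTo (fun i => ψ i ω) n) strip := by
  have hstep : ∀ i ≤ n, ∀ x ∈ strip,
      lift τ (G (2 * i + 1)) ω (lift τ (G (2 * i)) ω x) = ψ i ω x := fun i hi x hx => by
    rw [h0, h1, ← (isRandomStep_id τ).lift_shearGen (-s) ω hx]
    refine ((hψ i hi).lift_shearGen s ω (shear_mem hx (-s))).symm.trans ?_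
    simp only [Function.comp_apply]
    rw [shear_shear_neg]
  have key : ∀ i ≤ n, EqOn (compUpTo (fun j => lift τ (G j) ω) (2 * i + 1))
      (compUpTo (fun i => ψ i ω) i) strip ∧ MapsTo (compUpTo (fun i => ψ i ω) i) strip strip := by
    intro i
    induction i with
    | zero => exact fun hi => ⟨fun x hx => hstep 0 hi x hx, fun x hx =>
        ((hψ 0 hi).step ω).tame.mem hx⟩
    | succ i ih =>
      intro hi
      obtain ⟨ih1, ih2⟩ := ih (by omega)
      refine ⟨fun x hx => ?_, fun x hx => ((hψ (i + 1) hi).step ω).tame.mem (ih2 hx)⟩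
      have := hstep (i + 1) hi _ (ih2 hx)
      rw [← ih1 hx] at this
      exact this.trans (congrArg (ψ (i + 1) ω) (ih1 hx))
  exact (key n le_rfl).1

/-- A random composition of steps, modified on an invariant null set, is a composition of
alternating monotone twists. -/
theorem exists_alternating_twists [IsProbabilityMeasure P] {K : ℝ} {n : ℕ}
    {ψ : ℕ → Ω → ℝ × ℝ → ℝ × ℝ} (hψ : ∀ i ≤ n, IsRandomStep τ K (ψ i)) {M : Set Ω}
    (hM : MeasurableSet M) (hM0 : P M = 0) (hinv : ∀ a ω, τ a ω ∈ M ↔ ω ∈ M)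
    {F : Ω → ℝ → ℝ × ℝ} (hF : IsGenerator F)
    (hFψ : ∀ ω, ω ∉ M → EqOn (compUpTo (fun i => ψ i ω) n) (lift τ F ω) strip) :
    ∃ (N : ℕ) (G : ℕ → Ω → ℝ → ℝ × ℝ),
      (∀ j ≤ N, IsRegular τ P (G j) ∧ (Even j → IsNegativeMonotoneTwist τ P (G j)) ∧
        (Odd j → IsPositiveMonotoneTwist τ P (G j))) ∧
      ∀ ω, EqOn (lift τ F ω) (compUpTo (fun j => lift τ (G j) ω) N) strip := by
  classical
  -- Large enough both for the steps, `2 * K < s`, and for the identity step behind the negative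
  -- shears, `2 < s`.
  set s : ℝ := 2 * |K| + 3
  have hs : 2 * K < s := by linarith [le_abs_self K]
  have hs2 : 2 < s := by linarith [abs_nonneg K]
  let H : ℕ → Ω → ℝ → ℝ × ℝ := fun j =>
    if Even j then shearGen (-s) fun _ => id else shearGen s (ψ (j / 2))
  -- The replacement on the exceptional orbits: F followed by identities, since the generator (0, p)
  -- lifts to the identity.
  let R : ℕ → Ω → ℝ → ℝ × ℝ := fun j => if j = 0 then F else fun _ p => (0, p)
  let G : ℕ → Ω → ℝ → ℝ × ℝ := fun j ω => if ω ∈ M then R j ω else H j ω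
  have hR : ∀ j, IsGenerator (R j) := fun j => by
    by_cases hj : j = 0
    · simpa only [R, if_pos hj] using hF
    · simp only [R, if_neg hj]
      exact ⟨by fun_prop, fun ω p hp => mk_mem_strip hp⟩
  have hH : ∀ j ≤ 2 * n + 1, IsGenerator (H j) := fun j hj => by
    by_cases he : Even j
    · simpa only [H, if_pos he] using (isRandomStep_id τ).isGenerator (-s)
    · simpa only [H, if_neg he] using (hψ (j / 2) (by omega)).isGenerator s
  have hG : ∀ j ≤ 2 * n + 1, IsGenerator (G j) := fun j hj => by
    refine ⟨?_, fun ω p hp => ?_⟩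
    · have : Measurable fun z : Ω × Icc (-1 : ℝ) 1 =>
          if z.1 ∈ M then R j z.1 z.2 else H j z.1 z.2 :=
        Measurable.ite (measurable_fst hM) (hR j).measurable (hH j hj).measurable
      convert this using 2 with z
      by_cases hz : z.1 ∈ M
      · simp only [G, if_pos hz]
      · simp only [G, if_neg hz]
    · by_cases hω : ω ∈ M
      · simpa only [G, if_pos hω] using (hR j).mapsTo ω p hp
      · simpa only [G, if_neg hω] using (hH j hj).mapsTo ω p hp
  have hM' : ∀ᵐ ω ∂P, ω ∉ M := by
    rw [ae_iff]
    simpa using hM0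
  have hGH : ∀ j, ∀ᵐ ω ∂P, ∀ q, G j (τ q ω) = H j (τ q ω) := fun j => by
    filter_upwards [hM'] with ω hω q
    simp only [G, if_neg fun h => hω ((hinv q ω).1 h)]
  refine ⟨2 * n + 1, G, fun j hj => ⟨?_, fun he => ?_, fun ho => ?_⟩, fun ω => ?_⟩
  · refine IsRegular.congr (hGH j) ?_
    by_cases he : Even j
    · simpa only [H, if_pos he] using (isRandomStep_id τ).isRegular (-s)
    · simpa only [H, if_neg he] using (hψ (j / 2) (by omega)).isRegular s
  · refine IsNegativeMonotoneTwist.congr (hGH j) ?_ (hG j hj)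
    simpa only [H, if_pos he] using isNegativeMonotoneTwist_shear hs2
  · refine IsPositiveMonotoneTwist.congr (hGH j) ?_ (hG j hj)
    simpa only [H, if_neg (Nat.not_even_iff_odd.2 ho)] using
      (hψ (j / 2) (by omega)).isPositiveMonotoneTwist s hs
  · by_cases hω : ω ∈ M
    · have hl : ∀ j, lift τ (G j) ω = lift τ (R j) ω := fun j => by
        funext x
        simp only [lift, G, if_pos ((hinv x.1 ω).2 hω)]
      have key : ∀ j, compUpTo (fun j => lift τ (G j) ω) j = lift τ F ω := fun j => by
        induction j with
        | zero => exact hl 0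
        | succ j ih =>
          change lift τ (G (j + 1)) ω ∘ compUpTo _ j = _
          rw [ih, hl]
          funext x
          simp [lift, R]
      rw [key]
      exact eqOn_refl _ _
    · have hl : ∀ j, lift τ (G j) ω = lift τ (H j) ω := fun j => by
        funext x
        simp only [lift, G, if_neg fun h => hω ((hinv x.1 ω).1 h)]
      simp only [hl]
      refine (hFψ ω hω).symm.trans (compUpTo_shearGen (s := s) hψ H (fun i => ?_) (fun i => ?_) ω).symm
      · simp only [H, if_pos (even_two_mul i)]
      · have hodd : ¬ Even (2 * i + 1) := by simp
        simp only [H, if_neg hodd]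
        congr 2
        omega

end Decomposition

end RandomTwist

end

theorem theoremB :
    ∃ r₀ : ℕ, ∀ (Ω : Type*) [MetricSpace Ω] [TopologicalSpace.SeparableSpace Ω]
      [MeasurableSpace Ω] [BorelSpace Ω] (τ : Flow ℝ Ω) (P : MeasureTheory.Measure Ω)
      (_ : RandomTwist.IsInvariantErgodic τ P)
      (F : Ω → ℝ → ℝ × ℝ)
      (_ : RandomTwist.IsAreaPreservingRandomTwist τ P F)
      (_ : RandomTwist.IsRegular τ P F)
      (r : ℕ) (_ : r₀ ≤ r)
      (_ : RandomTwist.IsIsotopicToIdentity τ P r F),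
      ∃ (N : ℕ) (G : ℕ → Ω → ℝ → ℝ × ℝ),
        (∀ j ≤ N, RandomTwist.IsRegular τ P (G j) ∧
          (Even j → RandomTwist.IsNegativeMonotoneTwist τ P (G j)) ∧
          (Odd j → RandomTwist.IsPositiveMonotoneTwist τ P (G j))) ∧
        ∀ ω : Ω, Set.EqOn (RandomTwist.lift τ F ω)
          (RandomTwist.compUpTo (fun j => RandomTwist.lift τ (G j) ω) N) RandomTwist.strip := by
  -- Three bounded derivatives of the path give the C^{1,1} bounds on the Jacobian from which the
  -- Knothe map is built.
  refine ⟨3, fun Ω _ _ _ _ τ P hP F hF _ r hr hiso => ?_⟩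
  have := UniformSpace.secondCountable_of_separable Ω
  have := hP.isProbabilityMeasure
  have := MeasureTheory.nonempty_of_isProbabilityMeasure P
  obtain ⟨Φ, hΦ⟩ := hiso
  obtain ⟨C, M, f, hM, hM0, hinv, hgood, hstat, hmeas, hf⟩ :=
    hΦ.exists_random_goodPath hP hr hF.area_preserving
  obtain ⟨K, n, ψ, hψ, hcomp⟩ := RandomTwist.exists_isRandomStep hgood hstat hmeas
  exact RandomTwist.exists_alternating_twists hψ hM hM0 hinv hF.isGenerator
    fun ω hω => (hcomp ω).trans (hf ω hω)
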